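/- Let $(N,g)$ be a smooth Riemannian manifold of dimension $n=2m$ with Levi-Civita connection $\nabla$. Let $\pi:\mathcal Z\to N$ be its twistor space, i.e. the smooth bundle whose fibre over $p\in N$ consists of all complex structures $j$ on $T_pN$ (endomorphisms with $j^2=-\mathrm{Id}$) that are orthogonal with respect to $g_p$. For $z=(p,j)\in\mathcal Z$ write $T_z\mathcal Z=\mathcal H_z\oplus\mathcal V_z$, where $\mathcal V_z$ is the tangent space of the fibre, identified with the space of $g_p$-skew-symmetric endomorphisms of $T_pN$ that anti-commute with $j$, and $\mathcal H_z$ is the horizontal space determined by $\nabla$. For $t>0$ let $h_t$ be the Riemannian metric on $\mathcal Z$ for which $\mathcal H_z\perp\mathcal V_z$, $h_t=\pi^*g$ on $\mathcal H_z$, and $h_t(A,B)=-\frac{t}{n}\,\mathrm{Trace}(A\circ B)$ for $A,B\in\mathcal V_z$. Let $J$ be an almost complex structure on $N$ such that $(N,g,J)$ is Kähler: $J$ is smooth, $J^2=-\mathrm{Id}$, $J$ is $g$-orthogonal, $J$ is integrable (its Nijenhuis tensor vanishes), and the form $\omega(X,Y)=g(JX,Y)$ is closed. Then, for every $t>0$,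 the map $J:(N,g)\to(\mathcal Z,h_t)$, $p\mapsto (p,J_p)$, is a totally geodesic isometric embedding. That is, it is a smooth embedding, $J^*h_t=g$, and its second fundamental form $$\widetilde\nabla J_*(X,Y)=\widetilde D_X(J_*Y)-J_*(\nabla_XY)$$ vanishes for all vector fields $X,Y$, where $\widetilde D$ is the connection on $J^*T\mathcal Z$ induced by the Levi-Civita connection of $h_t$. -/

import Mathlib

open scoped Manifold ContDiff Topology RealInnerProductSpace

noncomputable section

namespace Twistor


/-! ### Linear algebra: orthogonal complex structures on `ℝ^{2m}` -/

/-- The Euclidean space `ℝ^{2m} = ℝ^m ⊕ ℝ^m`. -/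
def Std (m : ℕ) : Type := EuclideanSpace ℝ (Fin m ⊕ Fin m)

instance (m : ℕ) : NormedAddCommGroup (Std m) :=
  inferInstanceAs (NormedAddCommGroup (EuclideanSpace ℝ (Fin m ⊕ Fin m)))

instance (m : ℕ) : InnerProductSpace ℝ (Std m) :=
  inferInstanceAs (InnerProductSpace ℝ (EuclideanSpace ℝ (Fin m ⊕ Fin m)))

instance (m : ℕ) : FiniteDimensional ℝ (Std m) :=
  inferInstanceAs (FiniteDimensional ℝ (EuclideanSpace ℝ (Fin m ⊕ Fin m)))

/-- The coordinates of a vector of `ℝ^m ⊕ ℝ^m`. -/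
def Std.equiv (m : ℕ) : Std m ≃ₗᵢ[ℝ] EuclideanSpace ℝ (Fin m ⊕ Fin m) :=
  LinearIsometryEquiv.refl ℝ (EuclideanSpace ℝ (Fin m ⊕ Fin m))

/-- The standard complex structure `(a, b) ↦ (-b, a)` of `ℝ^m ⊕ ℝ^m`. -/
def stdJ (m : ℕ) : Std m →L[ℝ] Std m :=
  LinearMap.toContinuousLinearMap
    { toFun := fun v => (Std.equiv m).symm (WithLp.toLp 2
        (Sum.elim (fun k => - Std.equiv m v (Sum.inr k)) (fun k => Std.equiv m v (Sum.inl k))))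
      map_add' := by
        intro u v
        apply (Std.equiv m).injective
        ext k; rcases k with k | k <;> simp; ring
      map_smul' := by
        intro c v
        apply (Std.equiv m).injective
        ext k; rcases k with k | k <;> simp }

theorem stdJ_inl {m : ℕ} (v : Std m) (k : Fin m) :
    Std.equiv m (stdJ m v) (Sum.inl k) = - Std.equiv m v (Sum.inr k) := rfl

theorem stdJ_inr {m : ℕ} (v : Std m) (k : Fin m) :
    Std.equiv m (stdJ m v) (Sum.inr k) = Std.equiv m v (Sum.inl k) := rfl

theorem stdJ_mul_self (m : ℕ) : stdJ m * stdJ m = -1 := by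
  ext v
  apply (Std.equiv m).injective
  ext k
  rcases k with k | k <;> simp [stdJ_inl, stdJ_inr]

theorem inner_stdJ {m : ℕ} (u v : Std m) : ⟪stdJ m u, stdJ m v⟫ = ⟪u, v⟫ := by
  rw [← (Std.equiv m).inner_map_map (stdJ m u), ← (Std.equiv m).inner_map_map u v]
  simp only [PiLp.inner_apply, Fintype.sum_sum_type, stdJ_inl, stdJ_inr]
  simp [add_comm]

/-- The tangent space at `stdJ m` of the manifold of orthogonal complex structures of `ℝ^{2m}`:
skew-symmetric endomorphisms anti-commuting with `stdJ m`. -/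
def tangentF (m : ℕ) : Submodule ℝ (Std m →L[ℝ] Std m) where
  carrier := {Q | (∀ u v, ⟪Q u, v⟫ = -⟪u, Q v⟫) ∧ Q * stdJ m = -(stdJ m * Q)}
  add_mem' := by
    rintro A B ⟨hA, hA'⟩ ⟨hB, hB'⟩
    refine ⟨fun u v => ?_, ?_⟩
    · simp only [add_apply, inner_add_left, inner_add_right, hA, hB]; ring
    · rw [add_mul, hA', hB', mul_add]; abel
  zero_mem' := by simp
  smul_mem' := by
    rintro c A ⟨hA, hA'⟩
    refine ⟨fun u v => ?_, ?_⟩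
    · simp only [smul_apply, inner_smul_left, inner_smul_right, hA]; simp
    · rw [smul_mul_assoc, hA', mul_smul_comm, smul_neg]

/-- The vector space `tangentF m`, as the model space of the fibres of the twistor space. -/
def FModel (m : ℕ) : Type := tangentF m

instance (m : ℕ) : NormedAddCommGroup (FModel m) :=
  inferInstanceAs (NormedAddCommGroup (tangentF m))

instance (m : ℕ) : NormedSpace ℝ (FModel m) := inferInstanceAs (NormedSpace ℝ (tangentF m))

instance (m : ℕ) : FiniteDimensional ℝ (FModel m) :=
  inferInstanceAs (FiniteDimensional ℝ (tangentF m))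

/-- The inclusion of `tangentF m` in the space of endomorphisms. -/
def inclF (m : ℕ) : FModel m →L[ℝ] (Std m →L[ℝ] Std m) := (tangentF m).subtypeL

/-- A linear projection of the endomorphisms of `ℝ^{2m}` onto `tangentF m`. -/
def projF (m : ℕ) : (Std m →L[ℝ] Std m) →L[ℝ] FModel m :=
  (Submodule.ClosedComplemented.of_finiteDimensional (tangentF m)).choose

theorem inclF_mem {m : ℕ} (Q : FModel m) : inclF m Q ∈ tangentF m := Q.2

theorem projF_inclF {m : ℕ} (Q : FModel m) : projF m (inclF m Q) = Q :=
  (Submodule.ClosedComplemented.of_finiteDimensional (tangentF m)).choose_spec Q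

theorem inclF_projF {m : ℕ} {Q : Std m →L[ℝ] Std m} (hQ : Q ∈ tangentF m) :
    inclF m (projF m Q) = Q :=
  congrArg (inclF m) (projF_inclF (m := m) (⟨Q, hQ⟩ : tangentF m))

/-- Orthogonal complex structures of `ℝ^{2m}`. -/
def IsOrthoCplx {m : ℕ} (K : Std m →L[ℝ] Std m) : Prop :=
  K * K = -1 ∧ ∀ u v, ⟪K u, K v⟫ = ⟪u, v⟫

/-- The Cayley transform, `Q ↦ J₀ (1 + Q) (1 - Q)⁻¹` for `J₀ = stdJ m`; it maps `tangentF m`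
bijectively onto the orthogonal complex structures `K` for which `1 - J₀ K` is invertible. -/
def cayley {m : ℕ} (Q : Std m →L[ℝ] Std m) : Std m →L[ℝ] Std m :=
  stdJ m * ((1 + Q) * Ring.inverse (1 - Q))

/-- The inverse of the Cayley transform, `K ↦ (A - 1) (A + 1)⁻¹` with `A = J₀⁻¹ K = - J₀ K`. -/
def cayleyInv {m : ℕ} (K : Std m →L[ℝ] Std m) : Std m →L[ℝ] Std m :=
  (-(stdJ m * K) - 1) * Ring.inverse (1 - stdJ m * K)

theorem ringInverse_eq {R : Type*} [Ring R] {a b : R} (h1 : a * b = 1) (h2 : b * a = 1) :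
    Ring.inverse a = b :=
  Ring.inverse_unit ⟨a, b, h1, h2⟩

theorem isUnit_of_forall_ne {m : ℕ} {A : Std m →L[ℝ] Std m} (h : ∀ v, A v = 0 → v = 0) :
    IsUnit A := by
  rw [ContinuousLinearMap.isUnit_iff_bijective]
  have hi : Function.Injective A := (injective_iff_map_eq_zero A).2 h
  exact ⟨hi, (LinearMap.injective_iff_surjective (f := (A : Std m →ₗ[ℝ] Std m))).1 hi⟩

theorem isUnit_one_sub {m : ℕ} {Q : Std m →L[ℝ] Std m} (h : ∀ u v, ⟪Q u, v⟫ = -⟪u, Q v⟫) :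
    IsUnit (1 - Q) := by
  refine isUnit_of_forall_ne fun v hv => ?_
  have h1 : v = Q v := by simpa [sub_eq_zero] using hv
  have h2 := h v v
  rw [← h1] at h2
  have : ⟪v, v⟫ = 0 := by linarith
  exact inner_self_eq_zero.1 this

theorem IsOrthoCplx.skew {m : ℕ} {K : Std m →L[ℝ] Std m} (hK : IsOrthoCplx K) (u v : Std m) :
    ⟪K u, v⟫ = -⟪u, K v⟫ := by
  have h := hK.2 u (K v)
  have h2 : K (K v) = -v := by
    have := congrArg (fun A : Std m →L[ℝ] Std m => A v) hK.1
    simpa using this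
  rw [h2, inner_neg_right] at h
  linarith

theorem isOrthoCplx_stdJ (m : ℕ) : IsOrthoCplx (stdJ m) := ⟨stdJ_mul_self m, inner_stdJ⟩

theorem isOrthoCplx_cayley {m : ℕ} {Q : Std m →L[ℝ] Std m} (hQ : Q ∈ tangentF m) :
    IsOrthoCplx (cayley Q) := by
  obtain ⟨h1, h2⟩ := hQ
  have hJ := stdJ_mul_self m
  have u1 := isUnit_one_sub h1
  have h1' : ∀ u v, ⟪(-Q) u, v⟫ = -⟪u, (-Q) v⟫ := by
    intro u v; simp [h1]
  have u2 : IsUnit (1 + Q) := by simpa using isUnit_one_sub h1'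
  have e1 : (1 - Q) * Ring.inverse (1 - Q) = 1 := Ring.mul_inverse_cancel _ u1
  have e2 : Ring.inverse (1 - Q) * (1 - Q) = 1 := Ring.inverse_mul_cancel _ u1
  have e3 : (1 + Q) * Ring.inverse (1 + Q) = 1 := Ring.mul_inverse_cancel _ u2
  have e4 : Ring.inverse (1 + Q) * (1 + Q) = 1 := Ring.inverse_mul_cancel _ u2
  have c1 : (1 + Q) * stdJ m = stdJ m * (1 - Q) := by
    rw [add_mul, h2, mul_sub]; simp [sub_eq_add_neg]
  have c2 : (1 - Q) * stdJ m = stdJ m * (1 + Q) := by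
    rw [sub_mul, h2, mul_add]; simp
  -- `(1 - Q)⁻¹ J₀ = J₀ (1 + Q)⁻¹`
  have c3 : Ring.inverse (1 - Q) * stdJ m = stdJ m * Ring.inverse (1 + Q) := by
    calc Ring.inverse (1 - Q) * stdJ m
        = Ring.inverse (1 - Q) * (stdJ m * ((1 + Q) * Ring.inverse (1 + Q))) := by
          rw [e3, mul_one]
      _ = Ring.inverse (1 - Q) * ((stdJ m * (1 + Q)) * Ring.inverse (1 + Q)) := by
          simp only [mul_assoc]
      _ = (Ring.inverse (1 - Q) * (1 - Q)) * stdJ m * Ring.inverse (1 + Q) := by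
          rw [← c2]; simp only [mul_assoc]
      _ = _ := by rw [e2, one_mul]
  have c4 : (1 - Q) * (1 + Q) = (1 + Q) * (1 - Q) := by noncomm_ring
  refine ⟨?_, fun u v => ?_⟩
  · have : cayley Q * cayley Q = stdJ m * ((1 + Q) * (Ring.inverse (1 - Q) * stdJ m)
        * ((1 + Q) * Ring.inverse (1 - Q))) := by
      simp only [cayley, mul_assoc]
    rw [this, c3]
    calc stdJ m * ((1 + Q) * (stdJ m * Ring.inverse (1 + Q)) * ((1 + Q) * Ring.inverse (1 - Q)))
        = stdJ m * (((1 + Q) * stdJ m) * (Ring.inverse (1 + Q) * (1 + Q))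
            * Ring.inverse (1 - Q)) := by simp only [mul_assoc]
      _ = (stdJ m * stdJ m) * ((1 - Q) * Ring.inverse (1 - Q)) := by
          rw [e4, mul_one, c1]; simp only [mul_assoc]
      _ = -1 := by rw [e1, hJ, mul_one]
  · have key : ∀ a b, ⟪(1 + Q) a, (1 + Q) b⟫ = ⟪(1 - Q) a, (1 - Q) b⟫ := by
      intro a b
      simp only [add_apply, sub_apply,
        one_apply_eq_self, inner_add_left, inner_add_right, inner_sub_left,
        inner_sub_right, h1 a b]
      ring
    have e1' : ∀ w, (1 - Q) (Ring.inverse (1 - Q) w) = w := fun w => by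
      have := congrArg (fun A : Std m →L[ℝ] Std m => A w) e1
      simpa using this
    change ⟪stdJ m ((1 + Q) (Ring.inverse (1 - Q) u)), stdJ m ((1 + Q) (Ring.inverse (1 - Q) v))⟫
      = ⟪u, v⟫
    rw [inner_stdJ, key, e1', e1']

theorem isUnit_cayley {m : ℕ} {Q : Std m →L[ℝ] Std m} (hQ : Q ∈ tangentF m) :
    IsUnit (1 - stdJ m * cayley Q) ∧ cayleyInv (cayley Q) = Q := by
  have u1 := isUnit_one_sub hQ.1
  have hJ := stdJ_mul_self m
  have e1 : (1 - Q) * Ring.inverse (1 - Q) = 1 := Ring.mul_inverse_cancel _ u1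
  have e2 : Ring.inverse (1 - Q) * (1 - Q) = 1 := Ring.inverse_mul_cancel _ u1
  have a1 : stdJ m * cayley Q = -((1 + Q) * Ring.inverse (1 - Q)) := by
    rw [cayley, ← mul_assoc, hJ, neg_one_mul]
  have a2 : 1 - stdJ m * cayley Q = (2 : ℝ) • Ring.inverse (1 - Q) := by
    rw [a1, sub_neg_eq_add]
    nth_rewrite 1 [← e1]
    rw [← add_mul, two_smul, ← two_mul (Ring.inverse (1 - Q))]
    congr 1
    rw [← one_add_one_eq_two]; abel
  have a3 : -(stdJ m * cayley Q) - 1 = (2 : ℝ) • (Q * Ring.inverse (1 - Q)) := by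
    rw [a1, neg_neg]
    calc (1 + Q) * Ring.inverse (1 - Q) - 1
        = (1 + Q) * Ring.inverse (1 - Q) - (1 - Q) * Ring.inverse (1 - Q) := by rw [e1]
      _ = _ := by
        rw [← sub_mul, ← smul_mul_assoc]
        congr 1
        rw [two_smul]; abel
  have v1 : (1 - stdJ m * cayley Q) * ((1 / 2 : ℝ) • (1 - Q)) = 1 := by
    rw [a2, smul_mul_smul_comm, e2]; norm_num
  have v2 : ((1 / 2 : ℝ) • (1 - Q)) * (1 - stdJ m * cayley Q) = 1 := by
    rw [a2, smul_mul_smul_comm, e1]; norm_num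
  have hu : IsUnit (1 - stdJ m * cayley Q) := ⟨⟨_, _, v1, v2⟩, rfl⟩
  refine ⟨hu, ?_⟩
  have hinv : Ring.inverse (1 - stdJ m * cayley Q) = (1 / 2 : ℝ) • (1 - Q) :=
    ringInverse_eq v1 v2
  rw [cayleyInv, hinv, a3, smul_mul_smul_comm, mul_assoc, e2]
  norm_num

theorem cayleyInv_mem {m : ℕ} {K : Std m →L[ℝ] Std m} (hK : IsOrthoCplx K)
    (hu : IsUnit (1 - stdJ m * K)) :
    cayleyInv K ∈ tangentF m ∧ cayley (cayleyInv K) = K := by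
  have hJ := stdJ_mul_self m
  set A := -(stdJ m * K) with hA
  have hA1 : 1 - stdJ m * K = A + 1 := by rw [hA]; abel
  rw [hA1] at hu
  set R := Ring.inverse (A + 1) with hR
  have e1 : (A + 1) * R = 1 := Ring.mul_inverse_cancel _ hu
  have e2 : R * (A + 1) = 1 := Ring.inverse_mul_cancel _ hu
  have hQ : cayleyInv K = (A - 1) * R := by rw [cayleyInv, ← hA, hA1]
  -- `A⁻¹ = -(K J₀)`
  set B := -(K * stdJ m) with hB
  have AB : A * B = 1 := by
    rw [hA, hB, neg_mul_neg]
    calc stdJ m * K * (K * stdJ m) = stdJ m * (K * K) * stdJ m := by simp only [mul_assoc]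
      _ = 1 := by rw [hK.1]; simp [hJ]
  have BA : B * A = 1 := by
    rw [hA, hB, neg_mul_neg]
    calc K * stdJ m * (stdJ m * K) = K * (stdJ m * stdJ m) * K := by simp only [mul_assoc]
      _ = 1 := by rw [hJ]; simp [hK.1]
  have AJ : A * stdJ m = stdJ m * B := by
    rw [hA, hB]; simp [mul_assoc]
  have JA : stdJ m * A = K := by
    rw [hA, mul_neg, ← mul_assoc, hJ]; simp
  have comm : (A - 1) * R = R * (A - 1) := by
    calc (A - 1) * R = (R * (A + 1)) * ((A - 1) * R) := by rw [e2, one_mul]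
      _ = R * (((A + 1) * (A - 1)) * R) := by simp only [mul_assoc]
      _ = R * (((A - 1) * (A + 1)) * R) := by
          congr 2; noncomm_ring
      _ = R * (A - 1) * ((A + 1) * R) := by simp only [mul_assoc]
      _ = _ := by rw [e1, mul_one]
  -- `1 - Q = 2 R`, `1 + Q = 2 A R`
  have q1 : 1 - (A - 1) * R = (2 : ℝ) • R := by
    nth_rewrite 1 [← e1]
    rw [← sub_mul, two_smul, ← two_mul R]
    congr 1
    rw [← one_add_one_eq_two]; abel
  have q2 : 1 + (A - 1) * R = (2 : ℝ) • (A * R) := by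
    nth_rewrite 1 [← e1]
    rw [← add_mul, ← smul_mul_assoc]
    congr 1
    rw [two_smul]; abel
  have orthA : ∀ u v, ⟪A u, A v⟫ = ⟪u, v⟫ := by
    intro u v
    have : ∀ w, A w = - stdJ m (K w) := fun w => rfl
    rw [this, this, inner_neg_neg, inner_stdJ, hK.2]
  refine ⟨⟨fun u v => ?_, ?_⟩, ?_⟩
  · rw [hQ]
    have hv : ∀ w, (A + 1) (R w) = w := fun w => by
      have := congrArg (fun A : Std m →L[ℝ] Std m => A w) e1
      simpa using this
    have key : ∀ a b, ⟪(A - 1) a, (A + 1) b⟫ = -⟪(A + 1) a, (A - 1) b⟫ := by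
      intro a b
      simp only [add_apply, sub_apply,
        one_apply_eq_self, inner_add_left, inner_add_right, inner_sub_left,
        inner_sub_right, orthA a b]
      ring
    have := key (R u) (R v)
    rw [hv, hv] at this
    exact this
  · rw [hQ]
    -- `Q J₀ = -J₀ Q`
    have b1 : (A + 1) * stdJ m = stdJ m * (B * (A + 1)) := by
      rw [add_mul, AJ, one_mul, mul_add, mul_one, BA, mul_add, mul_one]; abel
    have b2 : (A - 1) * stdJ m = -(stdJ m * (B * (A - 1))) := by
      rw [sub_mul, AJ, one_mul, mul_sub, mul_one, BA, mul_sub, mul_one]; abel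
    have b3 : R * stdJ m = stdJ m * (A * R) := by
      have : (A + 1) * (stdJ m * (A * R)) = stdJ m := by
        rw [← mul_assoc, b1]
        calc stdJ m * (B * (A + 1)) * (A * R)
            = stdJ m * (B * (((A + 1) * A) * R)) := by simp only [mul_assoc]
          _ = stdJ m * (B * ((A * (A + 1)) * R)) := by
              congr 3; noncomm_ring
          _ = stdJ m * ((B * A) * ((A + 1) * R)) := by simp only [mul_assoc]
          _ = stdJ m := by rw [BA, e1, one_mul, mul_one]
      calc R * stdJ m = R * ((A + 1) * (stdJ m * (A * R))) := by rw [this]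
        _ = (R * (A + 1)) * (stdJ m * (A * R)) := by simp only [mul_assoc]
        _ = _ := by rw [e2, one_mul]
    calc (A - 1) * R * stdJ m = ((A - 1) * stdJ m) * (A * R) := by
          rw [mul_assoc, b3]; simp only [mul_assoc]
      _ = -(stdJ m * ((B * ((A - 1) * A)) * R)) := by
          rw [b2]; simp only [neg_mul, mul_assoc]
      _ = -(stdJ m * ((B * (A * (A - 1))) * R)) := by
          congr 4; noncomm_ring
      _ = -(stdJ m * ((A - 1) * R)) := by rw [← mul_assoc B, BA, one_mul]
  · rw [hQ, cayley, q1, q2]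
    have hR2 : Ring.inverse ((2 : ℝ) • R) = (1 / 2 : ℝ) • (A + 1) := by
      have h1 : ((2 : ℝ) • R) * ((1 / 2 : ℝ) • (A + 1)) = 1 := by
        rw [smul_mul_smul_comm, e2]; norm_num
      have h2 : ((1 / 2 : ℝ) • (A + 1)) * ((2 : ℝ) • R) = 1 := by
        rw [smul_mul_smul_comm, e1]; norm_num
      exact ringInverse_eq h1 h2
    rw [hR2, smul_mul_smul_comm, mul_assoc, e2]
    norm_num
    exact JA



/-- Symmetric endomorphisms. -/
def symEnd (V : Type*) [NormedAddCommGroup V] [InnerProductSpace ℝ V] :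
    Submodule ℝ (V →L[ℝ] V) where
  carrier := {S | ∀ u v, ⟪S u, v⟫ = ⟪u, S v⟫}
  add_mem' := by
    intro A B hA hB u v
    simp only [add_apply, inner_add_left, inner_add_right, hA u v, hB u v]
  zero_mem' := by intro u v; simp
  smul_mem' := by
    intro c A hA u v
    simp only [smul_apply, inner_smul_left, inner_smul_right, hA u v]; simp

/-- The inverse function theorem for squaring, near the identity, in a subspace closed under
squaring. -/
theorem exists_sqrt_aux {A W : Type*} [NormedRing A] [NormedAlgebra ℝ A]
    [NormedAddCommGroup W] [NormedSpace ℝ W] [CompleteSpace W] (j : W →L[ℝ] A) (pr : A →L[ℝ] W)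
    (hpr : ∀ w, pr (j w) = w) (hsq : ∀ w, j (pr (j w * j w)) = j w * j w) (i : W) (hi1 : j i = 1) :
    ∃ (r : A → W) (U : Set A), IsOpen U ∧ 1 ∈ U ∧ r 1 = i ∧ ContDiffOn ℝ ω (fun P => j (r P)) U ∧
      ∀ P ∈ U, j (r P) * j (r P) = j (pr P) := by
  let f : W → W := fun S => pr (j S * j S)
  have hf : ContDiff ℝ ω f := pr.contDiff.comp (j.contDiff.mul j.contDiff)
  have hfd : HasFDerivAt f
      ((ContinuousLinearEquiv.smulLeft (Units.mk0 (2 : ℝ) two_ne_zero) : W ≃L[ℝ] W) : W →L[ℝ] W)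
      i := by
    have hs : HasFDerivAt (fun S : W => j S) j i := j.hasFDerivAt
    have := pr.hasFDerivAt.comp i (hs.mul' hs)
    refine this.congr_fderiv ?_
    ext1 H
    have h2 : ((2 : ℝ) • H) = H + H := two_smul _ _
    simp [hi1, hpr]
    exact h2.symm
  have hω : (ω : WithTop ℕ∞) ≠ 0 := by simp
  have hi : f i = i := by
    change pr (j i * j i) = i
    rw [hi1, mul_one, ← hi1, hpr]
  let q := hf.contDiffAt.localInverse (a := i) hfd hω
  have hq : ContDiffAt ℝ ω q i := by
    have := hf.contDiffAt.to_localInverse hfd hω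
    rwa [hi] at this
  have hq1 : q i = i := by
    have := hf.contDiffAt.localInverse_apply_image hfd hω
    rwa [hi] at this
  have hq2 : ∀ᶠ P in 𝓝 i, f (q P) = P := by
    have := (hf.contDiffAt.hasStrictFDerivAt' hfd hω).eventually_right_inverse
    rwa [hi] at this
  have hpr1 : pr 1 = i := by rw [← hi1, hpr]
  have ev : ∀ᶠ P in 𝓝 (1 : A), f (q (pr P)) = pr P ∧ ContDiffAt ℝ ω q (pr P) := by
    have ht : Filter.Tendsto pr (𝓝 1) (𝓝 i) := by
      rw [← hpr1]; exact pr.continuous.continuousAt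
    exact ht.eventually (hq2.and (hq.eventually (by simp)))
  obtain ⟨U, hU, hUo, hU1⟩ := eventually_nhds_iff.1 ev
  refine ⟨fun P => q (pr P), U, hUo, hU1, ?_, ?_, ?_⟩
  · change q (pr 1) = i
    rw [hpr1, hq1]
  · intro P hP
    exact (j.contDiff.contDiffAt.comp P
      ((hU P hP).2.comp P pr.contDiff.contDiffAt)).contDiffWithinAt
  · intro P hP
    rw [← hsq]
    exact congrArg j (hU P hP).1

/-- Near the identity, symmetric endomorphisms have a symmetric square root depending analytically
on the endomorphism. -/
theorem exists_sqrt (V : Type*) [NormedAddCommGroup V] [InnerProductSpace ℝ V]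
    [FiniteDimensional ℝ V] :
    ∃ (r : (V →L[ℝ] V) → (V →L[ℝ] V)) (U : Set (V →L[ℝ] V)), IsOpen U ∧ 1 ∈ U ∧ r 1 = 1 ∧
      ContDiffOn ℝ ω r U ∧
      ∀ P ∈ U, P ∈ symEnd V → r P ∈ symEnd V ∧ r P * r P = P := by
  obtain ⟨pr, hpr⟩ := Submodule.ClosedComplemented.of_finiteDimensional (symEnd V)
  have h1 : (1 : V →L[ℝ] V) ∈ symEnd V := by intro u v; simp
  have hcs : CompleteSpace (symEnd V) := FiniteDimensional.complete ℝ _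
  have hsq : ∀ w : symEnd V, (symEnd V).subtypeL (pr ((symEnd V).subtypeL w * (symEnd V).subtypeL w))
      = (symEnd V).subtypeL w * (symEnd V).subtypeL w := by
    intro S
    have : (S : V →L[ℝ] V) * S ∈ symEnd V := by
      intro u v
      change ⟪S.1 (S.1 u), v⟫ = ⟪u, S.1 (S.1 v)⟫
      rw [S.2, S.2]
    exact congrArg Subtype.val (hpr ⟨_, this⟩)
  obtain ⟨r, U, hU, hU1, hr1, hr, hrs⟩ :=
    exists_sqrt_aux (A := V →L[ℝ] V) (W := symEnd V) (symEnd V).subtypeL pr hpr hsq ⟨1, h1⟩ rfl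
  refine ⟨fun P => (symEnd V).subtypeL (r P), U, hU, hU1, ?_, hr, ?_⟩
  · exact congrArg Subtype.val hr1
  · intro P hP hPs
    refine ⟨(r P).2, (hrs P hP).trans ?_⟩
    exact congrArg Subtype.val (hpr ⟨P, hPs⟩)

/-- Adapted orthonormal bases. -/
theorem exists_unitary {V : Type*} [AddCommGroup V] [Module ℝ V] [FiniteDimensional ℝ V]
    (b : V →ₗ[ℝ] V →ₗ[ℝ] ℝ) (hs : ∀ u v, b u v = b v u) (hp : ∀ v, v ≠ 0 → 0 < b v v)
    (J : V →ₗ[ℝ] V) (hJ : ∀ v, J (J v) = -v) (hJb : ∀ u v, b (J u) (J v) = b u v)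
    (k : ℕ) (hk : 2 * k ≤ Module.finrank ℝ V) :
    ∃ e : Fin k → V, ∀ i j, b (e i) (e j) = (if i = j then 1 else 0) ∧ b (e i) (J (e j)) = 0 := by
  induction k with
  | zero => exact ⟨fun i => i.elim0, fun i => i.elim0⟩
  | succ k ih =>
    obtain ⟨e, he⟩ := ih (by omega)
    have hskew : ∀ u v, b (J u) v = - b u (J v) := by
      intro u v
      have h := hJb u (J v)
      rw [hJ, map_neg] at h
      linarith
    let T : V →ₗ[ℝ] (Fin k → ℝ) × (Fin k → ℝ) :=
      LinearMap.prod (LinearMap.pi fun i => b (e i)) (LinearMap.pi fun i => b (J (e i)))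
    have hT : LinearMap.ker T ≠ ⊥ := by
      apply LinearMap.ker_ne_bot_of_finrank_lt
      simp; omega
    obtain ⟨w, hw, hw0⟩ := (Submodule.ne_bot_iff _).1 hT
    have hwT : T w = 0 := hw
    have w1 : ∀ i, b (e i) w = 0 := fun i => congrFun (congrArg Prod.fst hwT) i
    have w2 : ∀ i, b (J (e i)) w = 0 := fun i => congrFun (congrArg Prod.snd hwT) i
    have hpos := hp w hw0
    set c : ℝ := (Real.sqrt (b w w))⁻¹ with hc
    have hcc : c * c * b w w = 1 := by
      have : Real.sqrt (b w w) * Real.sqrt (b w w) = b w w := Real.mul_self_sqrt hpos.le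
      have h0 : Real.sqrt (b w w) ≠ 0 := (Real.sqrt_pos.2 hpos).ne'
      rw [hc]
      field_simp
      nlinarith
    have wJ : b w (J w) = 0 := by
      have h := hskew w w
      rw [hs] at h
      linarith
    refine ⟨Fin.snoc e (c • w), fun i j => ?_⟩
    refine Fin.lastCases ?_ (fun i => ?_) i <;> refine Fin.lastCases ?_ (fun j => ?_) j
    · simp only [Fin.snoc_last, map_smul, LinearMap.smul_apply, smul_eq_mul, wJ]
      constructor
      · simp; linarith
      · simp
    · simp only [Fin.snoc_last, Fin.snoc_castSucc, map_smul, LinearMap.smul_apply, smul_eq_mul]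
      rw [hs w, hs w, w1, w2]
      have : Fin.last k ≠ j.castSucc := (Fin.castSucc_lt_last j).ne'
      simp [this]
    · simp only [Fin.snoc_last, Fin.snoc_castSucc, map_smul, smul_eq_mul]
      have h2 : b (e i) (J w) = 0 := by
        have := hskew (e i) w
        rw [w2] at this; linarith
      have : i.castSucc ≠ Fin.last k := (Fin.castSucc_lt_last i).ne
      simp [this, w1, h2]
    · simp only [Fin.snoc_castSucc]
      have := he i j
      simpa [Fin.castSucc_inj] using this


/-! ### The twistor space -/

/-- The tangent space `T_x N` of a manifold without boundary modelled on `E`. -/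
abbrev Tan (E : Type*) [NormedAddCommGroup E] [NormedSpace ℝ E] {N : Type*} [TopologicalSpace N]
    [ChartedSpace E N] (x : N) : Type _ := TangentSpace 𝓘(ℝ, E) x

/-- Smooth Riemannian metrics on a manifold modelled on `E`. -/
abbrev RMetric (E : Type*) [NormedAddCommGroup E] [NormedSpace ℝ E] (N : Type*)
    [TopologicalSpace N] [ChartedSpace E N] [IsManifold 𝓘(ℝ, E) ∞ N] : Type _ :=
  Bundle.ContMDiffRiemannianMetric 𝓘(ℝ, E) ∞ E (fun x : N => TangentSpace 𝓘(ℝ, E) x)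

section

variable {E : Type*} [NormedAddCommGroup E] [NormedSpace ℝ E]
  {N : Type*} [TopologicalSpace N] [ChartedSpace E N] [IsManifold 𝓘(ℝ, E) ∞ N]

/-- Half the dimension of `E`. -/
abbrev halfDim (E : Type*) [NormedAddCommGroup E] [NormedSpace ℝ E] : ℕ := Module.finrank ℝ E / 2

/-- The twistor space of a Riemannian manifold `(N, g)`: pairs of a point `p` of `N` and a complex
structure on `T_p N` that is orthogonal for `g_p`. -/
structure TwistorSpace (g : RMetric E N) where
  /-- the projection to `N` -/
  base : N
  /-- the complex structure on the tangent space at `base` -/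
  str : Tan E base →L[ℝ] Tan E base
  sq : ∀ v, str (str v) = -v
  orth : ∀ u v, g.inner base (str u) (str v) = g.inner base u v

/-- A smooth orthonormal frame `ℝ^{2m} ≃ T_x N` over an open subset `dom` of the domain of
the chart at `center` (the values outside `dom` play no role). -/
structure OrthoFrame (g : RMetric E N) where
  center : N
  dom : Set N
  isOpen_dom : IsOpen dom
  dom_subset : dom ⊆ (chartAt E center).source
  frame : ∀ x : N, Std (halfDim E) ≃L[ℝ] Tan E x
  smooth : ∀ v, ContMDiffOn 𝓘(ℝ, E) (𝓘(ℝ, E).prod 𝓘(ℝ, E)) ∞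
    (fun x => (⟨x, frame x v⟩ : TangentBundle 𝓘(ℝ, E) N)) dom
  isometry : ∀ x ∈ dom, ∀ u v, g.inner x (frame x u) (frame x v) = ⟪u, v⟫

variable {g : RMetric E N}

@[ext]
theorem TwistorSpace.ext' {z w : TwistorSpace g} (h : z.base = w.base)
    (h' : HEq z.str w.str) : z = w := by
  cases z; cases w; cases h; cases h'; rfl

namespace OrthoFrame

/-- An endomorphism of `T_x N` read in the frame. -/
def read (F : OrthoFrame g) (x : N) (A : Tan E x →L[ℝ] Tan E x) :
    Std (halfDim E) →L[ℝ] Std (halfDim E) :=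
  ((F.frame x).symm : Tan E x →L[ℝ] Std (halfDim E)) ∘L A ∘L
    (F.frame x : Std (halfDim E) →L[ℝ] Tan E x)

/-- The endomorphism of `T_x N` with a given expression in the frame. -/
def write (F : OrthoFrame g) (x : N) (K : Std (halfDim E) →L[ℝ] Std (halfDim E)) :
    Tan E x →L[ℝ] Tan E x :=
  (F.frame x : Std (halfDim E) →L[ℝ] Tan E x) ∘L K ∘L
    ((F.frame x).symm : Tan E x →L[ℝ] Std (halfDim E))

theorem read_apply (F : OrthoFrame g) (x : N) (A : Tan E x →L[ℝ] Tan E x)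
    (v : Std (halfDim E)) : F.read x A v = (F.frame x).symm (A (F.frame x v)) := rfl

theorem write_apply (F : OrthoFrame g) (x : N) (K : Std (halfDim E) →L[ℝ] Std (halfDim E))
    (v : Tan E x) : F.write x K v = F.frame x (K ((F.frame x).symm v)) := rfl

theorem read_write (F : OrthoFrame g) (x : N) (K : Std (halfDim E) →L[ℝ] Std (halfDim E)) :
    F.read x (F.write x K) = K := by
  ext v; simp [read_apply, write_apply]

theorem write_read (F : OrthoFrame g) (x : N) (A : Tan E x →L[ℝ] Tan E x) :
    F.write x (F.read x A) = A := by
  ext v; simp [read_apply, write_apply]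

theorem isOrthoCplx_read (F : OrthoFrame g) (z : TwistorSpace g) (hz : z.base ∈ F.dom) :
    IsOrthoCplx (F.read z.base z.str) := by
  refine ⟨?_, fun u v => ?_⟩
  · ext v
    change F.read z.base z.str (F.read z.base z.str v) = -v
    simp [read_apply, z.sq]
  · rw [← F.isometry _ hz, read_apply, read_apply, ContinuousLinearEquiv.apply_symm_apply,
      ContinuousLinearEquiv.apply_symm_apply, z.orth, F.isometry _ hz]

/-- The point of the twistor space over `x ∈ F.dom` given by an orthogonal complex structure
of `ℝ^{2m}` and the frame. -/
def mkPoint (F : OrthoFrame g) (x : N) (hx : x ∈ F.dom)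
    (K : Std (halfDim E) →L[ℝ] Std (halfDim E)) (hK : IsOrthoCplx K) : TwistorSpace g where
  base := x
  str := F.write x K
  sq := fun v => by
    have h : ∀ w, K (K w) = -w := fun w => by
      have := congrArg (fun A : Std (halfDim E) →L[ℝ] Std (halfDim E) => A w) hK.1
      simpa using this
    simp [write_apply, h]
  orth := fun u v => by
    rw [write_apply, write_apply, F.isometry _ hx, hK.2, ← F.isometry _ hx]
    simp

theorem mkPoint_read (F : OrthoFrame g) (z : TwistorSpace g) (hz : z.base ∈ F.dom)
    (K : Std (halfDim E) →L[ℝ] Std (halfDim E)) (hK : IsOrthoCplx K)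
    (h : K = F.read z.base z.str) : F.mkPoint z.base hz K hK = z := by
  subst h
  obtain ⟨p, J, h1, h2⟩ := z
  simp only [mkPoint, write_read]

end OrthoFrame

namespace OrthoFrame

open Classical in
/-- The chart of the twistor space given by a local orthonormal frame: the coordinates of `(x, J)`
are those of `x` in the chart of `N` at `F.center` and the inverse Cayley transform of the matrix
of `J` in the frame. (The point `z₀` only serves as a value of the inverse outside the target.) -/
def chart (F : OrthoFrame g) (z₀ : TwistorSpace g) :
    PartialEquiv (TwistorSpace g) (E × FModel (halfDim E)) where
  toFun z := (chartAt E F.center z.base, projF _ (cayleyInv (F.read z.base z.str)))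
  invFun y :=
    if h : (chartAt E F.center).symm y.1 ∈ F.dom then
      F.mkPoint _ h (cayley (inclF _ y.2)) (isOrthoCplx_cayley (inclF_mem y.2))
    else z₀
  source := {z | z.base ∈ F.dom ∧ IsUnit (1 - stdJ (halfDim E) * F.read z.base z.str)}
  target := {y | y.1 ∈ (chartAt E F.center).target ∧ (chartAt E F.center).symm y.1 ∈ F.dom}
  map_source' := by
    rintro z ⟨hz, -⟩
    have h := F.dom_subset hz
    refine ⟨(chartAt E F.center).map_source h, ?_⟩
    change (chartAt E F.center).symm (chartAt E F.center z.base) ∈ F.dom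
    rwa [(chartAt E F.center).left_inv h]
  map_target' := by
    rintro ⟨y, Q⟩ ⟨-, hy⟩
    rw [dif_pos hy]
    refine ⟨hy, ?_⟩
    simp only [mkPoint, read_write]
    exact (isUnit_cayley (inclF_mem Q)).1
  left_inv' := by
    rintro z ⟨hz, hu⟩
    have h := F.dom_subset hz
    have hi := (chartAt E F.center).left_inv h
    have hc := cayleyInv_mem (F.isOrthoCplx_read z hz) hu
    have hz' : (chartAt E F.center).symm (chartAt E F.center z.base) ∈ F.dom := by rwa [hi]
    rw [dif_pos hz']
    have gen : ∀ (x : N) (hx : x ∈ F.dom) (hxz : x = z.base)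
        (K : Std (halfDim E) →L[ℝ] Std (halfDim E)) (hK : IsOrthoCplx K)
        (_ : K = F.read z.base z.str), F.mkPoint x hx K hK = z := by
      intro x hx hxz K hK hKe
      subst hxz
      exact F.mkPoint_read z hx K hK hKe
    exact gen _ _ hi _ _ (by rw [inclF_projF hc.1, hc.2])
  right_inv' := by
    rintro ⟨y, Q⟩ ⟨hy1, hy⟩
    rw [dif_pos hy]
    simp only [mkPoint, read_write, (isUnit_cayley (inclF_mem Q)).2, projF_inclF]
    congr 1
    exact (chartAt E F.center).right_inv hy1

/-- The change of frames. -/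
def trans (F F' : OrthoFrame g) (x : N) : Std (halfDim E) →L[ℝ] Std (halfDim E) :=
  ((F'.frame x).symm : Tan E x →L[ℝ] Std (halfDim E)) ∘L
    (F.frame x : Std (halfDim E) →L[ℝ] Tan E x)

theorem read_write_trans (F F' : OrthoFrame g) (x : N)
    (K : Std (halfDim E) →L[ℝ] Std (halfDim E)) :
    F'.read x (F.write x K) = F.trans F' x * K * F'.trans F x := rfl

theorem inner_trans (F F' : OrthoFrame g) {x : N} (hx : x ∈ F'.dom) (u v : Std (halfDim E)) :
    ⟪F.trans F' x u, v⟫ = g.inner x (F.frame x u) (F'.frame x v) := by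
  rw [← F'.isometry x hx]
  simp [trans]

end OrthoFrame

end
section

variable {E : Type*} [NormedAddCommGroup E] [NormedSpace ℝ E]
  {N : Type*} [TopologicalSpace N] [ChartedSpace E N]

theorem contMDiffOn_end {V : Type*} [NormedAddCommGroup V] [InnerProductSpace ℝ V]
    [FiniteDimensional ℝ V] {f : N → V →L[ℝ] V} {s : Set N}
    (h : ∀ u v, ContMDiffOn 𝓘(ℝ, E) 𝓘(ℝ, ℝ) ∞ (fun x => ⟪f x u, v⟫) s) :
    ContMDiffOn 𝓘(ℝ, E) 𝓘(ℝ, V →L[ℝ] V) ∞ f s := by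
  let b := stdOrthonormalBasis ℝ V
  let ι := Fin (Module.finrank ℝ V)
  let L : (ι → ι → ℝ) →ₗ[ℝ] (V →L[ℝ] V) :=
    { toFun := fun c => ∑ i, ∑ j, c i j • ((innerSL ℝ (b i)).smulRight (b j))
      map_add' := by
        intro c d
        simp only [Pi.add_apply, add_smul, Finset.sum_add_distrib]
      map_smul' := by
        intro r c
        simp only [Pi.smul_apply, smul_eq_mul, mul_smul, Finset.smul_sum, RingHom.id_apply] }
  have hf : f = fun x => L.toContinuousLinearMap (fun i j => ⟪f x (b i), b j⟫) := by
    ext x v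
    have h1 : f x v = ∑ i, ⟪b i, v⟫ • f x (b i) := by
      conv_lhs => rw [← b.sum_repr' v]
      simp
    have h2 : ∀ i, f x (b i) = ∑ j, ⟪f x (b i), b j⟫ • b j := by
      intro i
      conv_lhs => rw [← b.sum_repr' (f x (b i))]
      simp only [real_inner_comm]
    have h3 : f x v = ∑ i, ∑ j, ⟪b i, v⟫ • (⟪f x (b i), b j⟫ • b j) := by
      rw [h1]
      refine Finset.sum_congr rfl fun i _ => ?_
      conv_lhs => rw [h2 i]
      rw [Finset.smul_sum]
    rw [h3]
    simp only [LinearMap.coe_toContinuousLinearMap', LinearMap.coe_mk, AddHom.coe_mk, L,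
      sum_apply, smul_apply, ContinuousLinearMap.smulRight_apply,
      innerSL_apply_apply]
    refine Finset.sum_congr rfl fun i _ => Finset.sum_congr rfl fun j _ => ?_
    rw [smul_comm]
  rw [hf]
  refine (L.toContinuousLinearMap.contDiff (n := ∞)).contMDiff.comp_contMDiffOn ?_
  rw [contMDiffOn_pi_space]
  intro i
  rw [contMDiffOn_pi_space]
  intro j
  exact h _ _

variable [IsManifold 𝓘(ℝ, E) ∞ N]

theorem contMDiffOn_inner (g : RMetric E N) {s : Set N} {X Y : ∀ x : N, Tan E x}
    (hX : ContMDiffOn 𝓘(ℝ, E) (𝓘(ℝ, E).prod 𝓘(ℝ, E)) ∞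
      (fun x => (⟨x, X x⟩ : TangentBundle 𝓘(ℝ, E) N)) s)
    (hY : ContMDiffOn 𝓘(ℝ, E) (𝓘(ℝ, E).prod 𝓘(ℝ, E)) ∞
      (fun x => (⟨x, Y x⟩ : TangentBundle 𝓘(ℝ, E) N)) s) :
    ContMDiffOn 𝓘(ℝ, E) 𝓘(ℝ, ℝ) ∞ (fun x => g.inner x (X x) (Y x)) s := by
  intro x hx
  have : ContMDiffWithinAt 𝓘(ℝ, E) (𝓘(ℝ, E).prod 𝓘(ℝ, ℝ)) ∞
      (fun m ↦ Bundle.TotalSpace.mk' ℝ (E := Bundle.Trivial N ℝ) m (g.inner m (X m) (Y m))) s x := by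
    apply ContMDiffWithinAt.clm_bundle_apply₂ (F₁ := E) (F₂ := E)
    · exact g.contMDiff.contMDiffAt.contMDiffWithinAt
    · exact hX x hx
    · exact hY x hx
  simp only [Bundle.contMDiffWithinAt_totalSpace] at this
  exact this.2

variable {g : RMetric E N}

theorem OrthoFrame.contMDiffOn_trans (F F' : OrthoFrame g) :
    ContMDiffOn 𝓘(ℝ, E) 𝓘(ℝ, Std (halfDim E) →L[ℝ] Std (halfDim E)) ∞ (F.trans F')
      (F.dom ∩ F'.dom) := by
  refine contMDiffOn_end fun u v => ?_
  refine (contMDiffOn_inner g ((F.smooth u).mono Set.inter_subset_left)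
    ((F'.smooth v).mono Set.inter_subset_right)).congr fun x hx => ?_
  exact F.inner_trans F' hx.2 u v

theorem contDiffOn_ringInverse {R : Type*} [NormedRing R] [NormedAlgebra ℝ R] [CompleteSpace R] :
    ContDiffOn ℝ ∞ (Ring.inverse : R → R) {a | IsUnit a} := by
  rintro _ ⟨u, rfl⟩
  exact (contDiffAt_ringInverse ℝ u).contDiffWithinAt

theorem contDiff_cayley (m : ℕ) : ContDiff ℝ ∞ (fun Q : FModel m => cayley (inclF m Q)) := by
  have hi : ContDiff ℝ ∞ (inclF m) := (inclF m).contDiff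
  have h1 : ContDiff ℝ ∞ (fun Q : FModel m => Ring.inverse (1 - inclF m Q)) := by
    rw [← contDiffOn_univ]
    exact contDiffOn_ringInverse.comp (contDiff_const.sub hi).contDiffOn
      fun Q _ => isUnit_one_sub (inclF_mem Q).1
  exact contDiff_const.mul ((contDiff_const.add hi).mul h1)

/-- The domain of the change of coordinates, apart from an invertibility condition. -/
theorem OrthoFrame.contDiffOn_matrix (F F' : OrthoFrame g) :
    IsOpen {y : E × FModel (halfDim E) | y.1 ∈ (chartAt E F.center).target ∧
      (chartAt E F.center).symm y.1 ∈ F.dom ∩ F'.dom} ∧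
    ContDiffOn ℝ ∞ (fun y : E × FModel (halfDim E) =>
      (chartAt E F'.center) ((chartAt E F.center).symm y.1))
      {y | y.1 ∈ (chartAt E F.center).target ∧
        (chartAt E F.center).symm y.1 ∈ F.dom ∩ F'.dom} ∧
    ContDiffOn ℝ ∞ (fun y : E × FModel (halfDim E) =>
      F.trans F' ((chartAt E F.center).symm y.1) * cayley (inclF _ y.2) *
        F'.trans F ((chartAt E F.center).symm y.1))
      {y | y.1 ∈ (chartAt E F.center).target ∧
        (chartAt E F.center).symm y.1 ∈ F.dom ∩ F'.dom} := by
  set D : Set (E × FModel (halfDim E)) := {y | y.1 ∈ (chartAt E F.center).target ∧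
    (chartAt E F.center).symm y.1 ∈ F.dom ∩ F'.dom}
  have hfst : ContMDiff 𝓘(ℝ, E × FModel (halfDim E)) 𝓘(ℝ, E) ∞
      (Prod.fst : E × FModel (halfDim E) → E) := contDiff_fst.contMDiff
  have hx : ContMDiffOn 𝓘(ℝ, E × FModel (halfDim E)) 𝓘(ℝ, E) ∞
      (fun y : E × FModel (halfDim E) => (chartAt E F.center).symm y.1) D :=
    (contMDiffOn_chart_symm (I := 𝓘(ℝ, E)) (n := ∞) (x := F.center)).comp hfst.contMDiffOn
      fun y hy => hy.1
  refine ⟨?_, ?_, ?_⟩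
  · have ho := (chartAt E F.center).isOpen_inter_preimage_symm (F.isOpen_dom.inter F'.isOpen_dom)
    exact ho.preimage continuous_fst
  · rw [← contMDiffOn_iff_contDiffOn]
    exact (contMDiffOn_chart (I := 𝓘(ℝ, E)) (n := ∞) (x := F'.center)).comp hx
      fun y hy => F'.dom_subset hy.2.2
  · have h1 : ContDiffOn ℝ ∞ (fun y : E × FModel (halfDim E) =>
        F.trans F' ((chartAt E F.center).symm y.1)) D := by
      rw [← contMDiffOn_iff_contDiffOn]
      exact (F.contMDiffOn_trans F').comp hx fun y hy => hy.2
    have h2 : ContDiffOn ℝ ∞ (fun y : E × FModel (halfDim E) =>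
        F'.trans F ((chartAt E F.center).symm y.1)) D := by
      rw [← contMDiffOn_iff_contDiffOn]
      exact (F'.contMDiffOn_trans F).comp hx fun y hy => hy.2.symm
    have h3 : ContDiffOn ℝ ∞ (fun y : E × FModel (halfDim E) => cayley (inclF _ y.2)) D :=
      ((contDiff_cayley _).comp contDiff_snd).contDiffOn
    exact (h1.mul h3).mul h2

theorem OrthoFrame.chart_change (F F' : OrthoFrame g) (z₀ z₀' : TwistorSpace g) :
    IsOpen ((F.chart z₀).symm.trans (F'.chart z₀')).source ∧
    ContDiffOn ℝ ∞ ((F.chart z₀).symm.trans (F'.chart z₀'))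
      ((F.chart z₀).symm.trans (F'.chart z₀')).source := by
  obtain ⟨ho, hc, hK⟩ := F.contDiffOn_matrix F'
  set D : Set (E × FModel (halfDim E)) := {y | y.1 ∈ (chartAt E F.center).target ∧
    (chartAt E F.center).symm y.1 ∈ F.dom ∩ F'.dom}
  set K := fun y : E × FModel (halfDim E) =>
      F.trans F' ((chartAt E F.center).symm y.1) * cayley (inclF _ y.2) *
        F'.trans F ((chartAt E F.center).symm y.1)
  have hu : ContDiffOn ℝ ∞ (fun y => 1 - stdJ (halfDim E) * K y) D :=
    contDiffOn_const.sub (contDiffOn_const.mul hK)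
  have hopen : IsOpen (D ∩ (fun y => 1 - stdJ (halfDim E) * K y) ⁻¹' {a | IsUnit a}) :=
    hu.continuousOn.isOpen_inter_preimage ho Units.isOpen
  have hsrc : ((F.chart z₀).symm.trans (F'.chart z₀')).source =
      D ∩ (fun y => 1 - stdJ (halfDim E) * K y) ⁻¹' {a | IsUnit a} := by
    ext y
    rw [PartialEquiv.trans_source]
    constructor
    · rintro ⟨⟨h1, h2⟩, h3⟩
      change (F.chart z₀).symm y ∈ (F'.chart z₀').source at h3
      have e : (F.chart z₀).symm y =
          F.mkPoint _ h2 (cayley (inclF _ y.2)) (isOrthoCplx_cayley (inclF_mem y.2)) := dif_pos h2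
      rw [e] at h3
      exact ⟨⟨h1, h2, h3.1⟩, h3.2⟩
    · rintro ⟨⟨h1, h2, h3⟩, h4⟩
      refine ⟨⟨h1, h2⟩, ?_⟩
      change (F.chart z₀).symm y ∈ (F'.chart z₀').source
      have e : (F.chart z₀).symm y =
          F.mkPoint _ h2 (cayley (inclF _ y.2)) (isOrthoCplx_cayley (inclF_mem y.2)) := dif_pos h2
      rw [e]
      exact ⟨h3, h4⟩
  rw [hsrc]
  refine ⟨hopen, ?_⟩
  have h1 : ContDiffOn ℝ ∞ (fun y => Ring.inverse (1 - stdJ (halfDim E) * K y))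
      (D ∩ (fun y => 1 - stdJ (halfDim E) * K y) ⁻¹' {a | IsUnit a}) :=
    contDiffOn_ringInverse.comp (hu.mono Set.inter_subset_left) fun y hy => hy.2
  have h2 : ContDiffOn ℝ ∞ (fun y => (-(stdJ (halfDim E) * K y) - 1))
      (D ∩ (fun y => 1 - stdJ (halfDim E) * K y) ⁻¹' {a | IsUnit a}) :=
    ((contDiffOn_const.mul hK).neg.sub contDiffOn_const).mono Set.inter_subset_left
  have h3 : ContDiffOn ℝ ∞ (fun y => projF _ (cayleyInv (K y)))
      (D ∩ (fun y => 1 - stdJ (halfDim E) * K y) ⁻¹' {a | IsUnit a}) :=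
    (projF _).contDiff.comp_contDiffOn (h2.mul h1)
  refine ((hc.mono Set.inter_subset_left).prodMk h3).congr ?_
  rintro y ⟨⟨h1, h2, h3⟩, h4⟩
  change (F'.chart z₀') ((F.chart z₀).symm y) = _
  have e : (F.chart z₀).symm y =
      F.mkPoint _ h2 (cayley (inclF _ y.2)) (isOrthoCplx_cayley (inclF_mem y.2)) := dif_pos h2
  rw [e]
  rfl

end
section

variable {E : Type*} [NormedAddCommGroup E] [NormedSpace ℝ E] [FiniteDimensional ℝ E]
  {N : Type*} [TopologicalSpace N] [ChartedSpace E N] [IsManifold 𝓘(ℝ, E) ∞ N]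
  {g : RMetric E N}

theorem finrank_std (m : ℕ) : Module.finrank ℝ (Std m) = 2 * m := by
  rw [LinearEquiv.finrank_eq (Std.equiv m).toLinearEquiv]
  simp [two_mul]

theorem two_mul_halfDim {V : Type*} [AddCommGroup V] [Module ℝ V] [FiniteDimensional ℝ V]
    (J : V →ₗ[ℝ] V) (hJ : ∀ v, J (J v) = -v) :
    2 * (Module.finrank ℝ V / 2) = Module.finrank ℝ V := by
  have h : J ∘ₗ J = (-1 : ℝ) • LinearMap.id := by
    ext v; simp [hJ]
  have hd := congrArg LinearMap.det h
  rw [LinearMap.det_comp, LinearMap.det_smul, LinearMap.det_id, mul_one] at hd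
  rcases Nat.even_or_odd (Module.finrank ℝ V) with he | ho
  · obtain ⟨k, hk⟩ := he
    omega
  · rw [ho.neg_one_pow] at hd
    nlinarith [mul_self_nonneg (LinearMap.det J)]

/-- A complex structure `J` orthogonal for an inner product `b` becomes the standard one in a
suitable orthonormal basis. -/
theorem exists_adapted {V : Type*} [AddCommGroup V] [Module ℝ V] [FiniteDimensional ℝ V]
    (b : V →ₗ[ℝ] V →ₗ[ℝ] ℝ) (hs : ∀ u v, b u v = b v u) (hp : ∀ v, v ≠ 0 → 0 < b v v)
    (J : V →ₗ[ℝ] V) (hJ : ∀ v, J (J v) = -v) (hJb : ∀ u v, b (J u) (J v) = b u v)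
    (m : ℕ) (hm : 2 * m = Module.finrank ℝ V) :
    ∃ L : Std m →ₗ[ℝ] V, (∀ u v, b (L u) (L v) = ⟪u, v⟫) ∧ ∀ v, L (stdJ m v) = J (L v) := by
  obtain ⟨e, he⟩ := exists_unitary b hs hp J hJ hJb m hm.le
  let L : Std m →ₗ[ℝ] V :=
    { toFun := fun v => (∑ k, Std.equiv m v (Sum.inl k) • e k) +
        ∑ k, Std.equiv m v (Sum.inr k) • J (e k)
      map_add' := by
        intro u v
        simp only [map_add, PiLp.add_apply, add_smul, Finset.sum_add_distrib]; abel
      map_smul' := by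
        intro c v
        simp only [map_smul, PiLp.smul_apply, smul_eq_mul, mul_smul, Finset.smul_sum,
          RingHom.id_apply, smul_add] }
  have hL : ∀ v, L v = (∑ k, Std.equiv m v (Sum.inl k) • e k) +
        ∑ k, Std.equiv m v (Sum.inr k) • J (e k) := fun v => rfl
  refine ⟨L, fun u v => ?_, fun v => ?_⟩
  · have h1 : ∀ i j, b (e i) (e j) = (if i = j then 1 else 0) := fun i j => (he i j).1
    have h2 : ∀ i j, b (e i) (J (e j)) = 0 := fun i j => (he i j).2
    have h3 : ∀ i j, b (J (e i)) (e j) = 0 := fun i j => by rw [hs]; exact h2 j i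
    have h4 : ∀ i j, b (J (e i)) (J (e j)) = (if i = j then 1 else 0) := fun i j => by
      rw [hJb]; exact h1 i j
    rw [hL, hL, ← (Std.equiv m).inner_map_map u v]
    simp only [map_add, map_sum, map_smul, LinearMap.add_apply, LinearMap.sum_apply,
      LinearMap.smul_apply, h1, h2, h3, h4, smul_eq_mul, PiLp.inner_apply, Fintype.sum_sum_type]
    simp [mul_comm]
  · rw [hL, hL, map_add, map_sum, map_sum]
    simp only [stdJ_inl, stdJ_inr, map_smul, hJ, neg_smul, smul_neg]
    rw [add_comm]

theorem exists_frame (z : TwistorSpace g) :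
    ∃ F : OrthoFrame g, z.base ∈ F.dom ∧ F.read z.base z.str = stdJ (halfDim E) := by
  classical
  obtain ⟨p, J, hJ, hJg⟩ := z
  simp only
  set m := halfDim E with hm
  have hfinT : ∀ x : N, Module.finrank ℝ (Tan E x) = Module.finrank ℝ E := fun x => rfl
  have hfdT : ∀ x : N, FiniteDimensional ℝ (Tan E x) := fun x =>
    inferInstanceAs (FiniteDimensional ℝ E)
  have heven : 2 * m = Module.finrank ℝ E := two_mul_halfDim (V := Tan E p) J.toLinearMap hJ
  let bil : ∀ x : N, Tan E x →ₗ[ℝ] Tan E x →ₗ[ℝ] ℝ := fun x =>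
    LinearMap.mk₂ ℝ (fun u v => g.inner x u v) (by intros; simp) (by intros; simp)
      (by intros; simp) (by intros; simp)
  obtain ⟨L, hLg, hLJ⟩ := exists_adapted (V := Tan E p) (bil p) (g.symm p) (g.pos p)
    J.toLinearMap hJ hJg m heven
  replace hLg : ∀ u v, g.inner p (L u) (L v) = ⟪u, v⟫ := hLg
  replace hLJ : ∀ v, L (stdJ m v) = J (L v) := hLJ
  let e := trivializationAt E (fun x : N => TangentSpace 𝓘(ℝ, E) x) p
  have hpe : p ∈ e.baseSet := FiberBundle.mem_baseSet_trivializationAt' p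
  have hbase : e.baseSet = (chartAt E p).source := TangentBundle.trivializationAt_baseSet p
  let l : Std m →L[ℝ] E := (e.continuousLinearMapAt ℝ p) ∘L L.toContinuousLinearMap
  let M : ∀ x : N, Std m →L[ℝ] Tan E x := fun x => (e.symmL ℝ x) ∘L l
  have hMp : ∀ v, M p v = L v := fun v => e.symmL_continuousLinearMapAt hpe (L v)
  have hMs : ∀ {s : Set N} {f : N → Std m}, IsOpen s → s ⊆ e.baseSet →
      ContMDiffOn 𝓘(ℝ, E) 𝓘(ℝ, Std m) ∞ f s →
      ContMDiffOn 𝓘(ℝ, E) (𝓘(ℝ, E).prod 𝓘(ℝ, E)) ∞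
        (fun x => (⟨x, M x (f x)⟩ : TangentBundle 𝓘(ℝ, E) N)) s := by
    intro s f hso hs hf
    rw [e.contMDiffOn_section_iff hso hs]
    refine (l.contDiff.contMDiff.comp_contMDiffOn hf).congr fun x hx => ?_
    change (e ⟨x, e.symmL ℝ x (l (f x))⟩).2 = l (f x)
    rw [← e.continuousLinearMapAt_apply_of_mem ℝ (hs hx)]
    exact e.continuousLinearMapAt_symmL (hs hx) _
  have hMinj : ∀ x ∈ e.baseSet, ∀ v, M x v = 0 → v = 0 := by
    intro x hx v hv
    have h1 : l v = 0 := by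
      have := e.continuousLinearMapAt_symmL (R := ℝ) hx (l v)
      rw [← this]
      change e.continuousLinearMapAt ℝ x (M x v) = 0
      rw [hv, map_zero]
    have h2 : L v = 0 := by
      rw [← hMp v]
      change e.symmL ℝ p (l v) = 0
      rw [h1, map_zero]
    have h3 := hLg v v
    rw [h2] at h3
    simp only [map_zero] at h3
    exact inner_self_eq_zero.1 h3.symm
  -- the metric read in the frame `M`
  let b := stdOrthonormalBasis ℝ (Std m)
  let P : N → (Std m →L[ℝ] Std m) := fun x => LinearMap.toContinuousLinearMap
    { toFun := fun u => ∑ i, g.inner x (M x u) (M x (b i)) • b i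
      map_add' := fun u v => by
        simp only [map_add, add_apply, add_smul, Finset.sum_add_distrib]
      map_smul' := fun c u => by
        simp only [map_smul, smul_apply, smul_eq_mul, mul_smul,
          Finset.smul_sum, RingHom.id_apply] }
  have hP : ∀ x u v, ⟪P x u, v⟫ = g.inner x (M x u) (M x v) := by
    intro x u v
    change ⟪∑ i, g.inner x (M x u) (M x (b i)) • b i, v⟫ = _
    conv_rhs => rw [← b.sum_repr' v]
    simp only [sum_inner, map_sum, map_smul, real_inner_smul_left, smul_eq_mul, mul_comm]
  have hPsym : ∀ x, P x ∈ symEnd (Std m) := by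
    intro x u v
    rw [hP x u v, g.symm, ← hP x v u, real_inner_comm]
  have hPp : P p = 1 := by
    ext u
    refine ext_inner_right ℝ fun v => ?_
    rw [hP, hMp, hMp, hLg]; rfl
  have hPs : ContMDiffOn 𝓘(ℝ, E) 𝓘(ℝ, Std m →L[ℝ] Std m) ∞ P e.baseSet := by
    refine contMDiffOn_end fun u v => ?_
    simp only [hP]
    exact contMDiffOn_inner g (hMs e.open_baseSet subset_rfl contMDiffOn_const)
      (hMs e.open_baseSet subset_rfl contMDiffOn_const)
  obtain ⟨r, U, hUo, hU1, hr1, hr, hrU⟩ := exists_sqrt (Std m)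
  let W : Set N := e.baseSet ∩ P ⁻¹' U
  have hWo : IsOpen W := hPs.continuousOn.isOpen_inter_preimage e.open_baseSet hUo
  have hpW : p ∈ W := ⟨hpe, by change P p ∈ U; rwa [hPp]⟩
  have hPinj : ∀ x ∈ e.baseSet, ∀ v, P x v = 0 → v = 0 := by
    intro x hx v hv
    refine hMinj x hx v ?_
    by_contra hne
    have h1 := g.pos x _ hne
    rw [← hP, hv, inner_zero_left] at h1
    exact lt_irrefl _ h1
  have hSu : ∀ x ∈ W, IsUnit (r (P x)) := by
    intro x hx
    refine isUnit_of_forall_ne fun v hv => hPinj x hx.1 v ?_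
    rw [← (hrU (P x) hx.2 (hPsym x)).2]
    change r (P x) (r (P x) v) = 0
    rw [hv, map_zero]
  let T : N → (Std m →L[ℝ] Std m) := fun x => Ring.inverse (r (P x))
  have hT : ContMDiffOn 𝓘(ℝ, E) 𝓘(ℝ, Std m →L[ℝ] Std m) ∞ T W := by
    have h1 : ContMDiffOn 𝓘(ℝ, E) 𝓘(ℝ, Std m →L[ℝ] Std m) ∞ (fun x => r (P x)) W :=
      (hr.of_le le_top).contMDiffOn.comp (hPs.mono Set.inter_subset_left) fun x hx => hx.2
    exact contDiffOn_ringInverse.contMDiffOn.comp h1 fun x hx => hSu x hx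
  let B : ∀ x : N, Std m →L[ℝ] Tan E x := fun x => M x ∘L T x
  have hB : ∀ x ∈ W, ∀ u v, g.inner x (B x u) (B x v) = ⟪u, v⟫ := by
    intro x hx u v
    change g.inner x (M x (T x u)) (M x (T x v)) = _
    have h2 := hrU (P x) hx.2 (hPsym x)
    have h3 : ∀ w, r (P x) (T x w) = w := fun w => by
      have := congrArg (fun A : Std m →L[ℝ] Std m => A w) (Ring.mul_inverse_cancel _ (hSu x hx))
      simpa using this
    rw [← hP]
    have h4 : P x (T x u) = r (P x) (r (P x) (T x u)) :=
      congrArg (fun A : Std m →L[ℝ] Std m => A (T x u)) h2.2.symm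
    rw [h4, h3, h2.1, h3]
  have hBinj : ∀ x ∈ W, Function.Injective (B x) := by
    intro x hx
    refine (injective_iff_map_eq_zero (B x)).2 fun v hv => ?_
    have h := hB x hx v v
    rw [hv] at h
    simp only [map_zero] at h
    exact inner_self_eq_zero.1 h.symm
  have hdim : ∀ x : N, Module.finrank ℝ (Std m) = Module.finrank ℝ (Tan E x) := fun x => by
    rw [finrank_std, hfinT, heven]
  have hBbij : ∀ x ∈ W, Function.Bijective (B x) := fun x hx =>
    ⟨hBinj x hx, (LinearMap.injective_iff_surjective_of_finrank_eq_finrank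
      (f := (B x).toLinearMap) (hdim x)).1 (hBinj x hx)⟩
  have hT2 : ∀ x : N, T2Space (Tan E x) := fun x => inferInstanceAs (T2Space E)
  let fr : ∀ x : N, Std m ≃L[ℝ] Tan E x := fun x =>
    if hx : x ∈ W then
      LinearEquiv.toContinuousLinearEquiv (LinearEquiv.ofBijective (B x).toLinearMap (hBbij x hx))
    else
      LinearEquiv.toContinuousLinearEquiv (LinearEquiv.ofFinrankEq _ _ (hdim x))
  have hfr : ∀ x ∈ W, ∀ v, fr x v = B x v := by
    intro x hx v
    simp only [fr, dif_pos hx]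
    rfl
  refine ⟨⟨p, W, hWo, fun x hx => hbase ▸ hx.1, fr, fun v => ?_, fun x hx u v => ?_⟩, hpW, ?_⟩
  · refine (hMs hWo Set.inter_subset_left (hT.clm_apply contMDiffOn_const) :
      ContMDiffOn _ _ _ (fun x => (⟨x, M x (T x v)⟩ : TangentBundle 𝓘(ℝ, E) N)) W).congr
      fun x hx => ?_
    rw [hfr x hx]; rfl
  · rw [hfr x hx, hfr x hx, hB x hx]
  · have hTp : T p = 1 := by
      simp only [T, hPp, hr1, Ring.inverse_one]
    have hfp : ∀ v, fr p v = L v := by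
      intro v
      rw [hfr p hpW]
      change M p (T p v) = L v
      rw [hTp, one_apply_eq_self, hMp]
    ext v
    change (fr p).symm (J (fr p v)) = stdJ m v
    rw [hfp, ← hLJ, ← hfp, ContinuousLinearEquiv.symm_apply_apply]

/-- An orthonormal frame near a point of the twistor space. -/
def frameAt (z : TwistorSpace g) : OrthoFrame g := (exists_frame z).choose

theorem mem_chart_frameAt (z : TwistorSpace g) : z ∈ ((frameAt z).chart z).source := by
  obtain ⟨h1, h2⟩ := (exists_frame z).choose_spec
  refine ⟨h1, ?_⟩
  change IsUnit (1 - stdJ (halfDim E) * (frameAt z).read z.base z.str)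
  rw [show (frameAt z).read z.base z.str = stdJ (halfDim E) from h2, stdJ_mul_self, sub_neg_eq_add]
  refine ⟨⟨1 + 1, (1 / 2 : ℝ) • 1, ?_, ?_⟩, rfl⟩
  · rw [mul_smul_comm, mul_one, ← two_smul ℝ, smul_smul]; norm_num
  · rw [smul_mul_assoc, one_mul, ← two_smul ℝ, smul_smul]; norm_num

/-- The atlas of the twistor space: the charts given by all smooth local orthonormal frames. -/
def twistorCore (g : RMetric E N) :
    ChartedSpaceCore (E × FModel (halfDim E)) (TwistorSpace g) where
  atlas := {c | ∃ (F : OrthoFrame g) (z₀ : TwistorSpace g), c = F.chart z₀}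
  chartAt z := (frameAt z).chart z
  mem_chart_source := mem_chart_frameAt
  chart_mem_atlas z := ⟨_, _, rfl⟩
  open_source := by
    rintro _ _ ⟨F, z₀, rfl⟩ ⟨F', z₀', rfl⟩
    exact (F.chart_change F' z₀ z₀').1
  continuousOn_toFun := by
    rintro _ _ ⟨F, z₀, rfl⟩ ⟨F', z₀', rfl⟩
    exact (F.chart_change F' z₀ z₀').2.continuousOn

instance (g : RMetric E N) : TopologicalSpace (TwistorSpace g) :=
  (twistorCore g).toTopologicalSpace

instance (g : RMetric E N) : ChartedSpace (E × FModel (halfDim E)) (TwistorSpace g) :=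
  (twistorCore g).toChartedSpace

instance (g : RMetric E N) : IsManifold 𝓘(ℝ, E × FModel (halfDim E)) ∞ (TwistorSpace g) := by
  refine isManifold_of_contDiffOn _ _ _ ?_
  rintro e e' he he'
  have h : e ∈ ⋃ (c) (hc : c ∈ (twistorCore g).atlas),
      {(twistorCore g).openPartialHomeomorph c hc} := he
  have h' : e' ∈ ⋃ (c) (hc : c ∈ (twistorCore g).atlas),
      {(twistorCore g).openPartialHomeomorph c hc} := he'
  simp only [Set.mem_iUnion, Set.mem_singleton_iff] at h h'
  obtain ⟨c, hc, rfl⟩ := h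
  obtain ⟨c', hc', rfl⟩ := h'
  obtain ⟨F, z₀, rfl⟩ := hc
  obtain ⟨F', z₀', rfl⟩ := hc'
  have h := (F.chart_change F' z₀ z₀').2
  simp only [mfld_simps] at h ⊢
  exact h

end

/-! ### The Levi-Civita connection and totally geodesic maps -/

section

variable {E : Type*} [NormedAddCommGroup E] [NormedSpace ℝ E]
  {M : Type*} [TopologicalSpace M] [ChartedSpace E M] [IsManifold 𝓘(ℝ, E) ∞ M]
  {E' : Type*} [NormedAddCommGroup E'] [NormedSpace ℝ E']
  {M' : Type*} [TopologicalSpace M'] [ChartedSpace E' M'] [IsManifold 𝓘(ℝ, E') ∞ M']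

/-- The local trivialization of the tangent bundle given by the chart at `p`. Over `p` itself it is
the identity of `T_p M = E`. -/
abbrev tanTriv (E : Type*) [NormedAddCommGroup E] [NormedSpace ℝ E] {M : Type*}
    [TopologicalSpace M] [ChartedSpace E M] [IsManifold 𝓘(ℝ, E) ∞ M] (p : M) :
    Bundle.Trivialization E (Bundle.TotalSpace.proj (F := E) (E := fun x : M => Tan E x)) :=
  haveI : IsManifold 𝓘(ℝ, E) 1 M := .of_le (n := ∞) (by simp)
  trivializationAt E (fun x : M => Tan E x) p

/-- The coefficients `g_{ij}` of a metric in the chart at `p`, as a function on `E` with values in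
the bilinear forms on `E`. -/
def metricInChart (g : RMetric E M) (p : M) (y : E) : E →L[ℝ] E →L[ℝ] ℝ :=
  let q : M := (chartAt E p).symm y
  let G : E →L[ℝ] E →L[ℝ] ℝ := g.inner q
  let S : E →L[ℝ] E := (tanTriv E p).symmL ℝ q
  G.bilinearComp S S

/-- The Christoffel symbols at `p` of a metric in the chart at `p`: `christoffel g p u v` is the
vector `Γ(u, v)` with
`g(Γ(u, v), w) = (1 / 2) (∂_u g(v, w) + ∂_v g(u, w) - ∂_w g(u, v))`. -/
def christoffel (g : RMetric E M) (p : M) (u : E) : E →L[ℝ] E :=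
  let y := chartAt E p p
  let D : E →L[ℝ] E →L[ℝ] E →L[ℝ] ℝ := fderiv ℝ (metricInChart g p) y
  (metricInChart g p y).inverse ∘L ((1 / 2 : ℝ) • (D u + D.flip u - (D.flip u).flip))

/-- The derivative `(f^*∇)_X s` at `p` of a vector field `s` along `f : M → M'`, for the
Levi-Civita connection `∇` of a metric on `M'`: in the chart at `f p` it is
`∂_X s + Γ(f_* X, s)`. -/
def covDerivAlong (g' : RMetric E' M') (f : M → M') (s : ∀ x : M, Tan E' (f x)) (p : M)
    (X : Tan E p) : Tan E' (f p) :=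
  let c : E' := mfderiv 𝓘(ℝ, E) 𝓘(ℝ, E')
    (fun x => (tanTriv E' (f p)).continuousLinearMapAt ℝ (f x) (s x)) p X
  c + christoffel g' (f p) (mfderiv 𝓘(ℝ, E) 𝓘(ℝ, E') f p X) (s p)

/-- The derivative `∇_X Y` at `p` of a vector field `Y` for the Levi-Civita connection of `g`. -/
def leviCivita (g : RMetric E M) (Y : ∀ x : M, Tan E x) (p : M) (X : Tan E p) : Tan E p :=
  covDerivAlong g id Y p X

/-- The vector field `Y` is smooth at `p`. -/
def SmoothFieldAt (Y : ∀ x : M, Tan E x) (p : M) : Prop :=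
  ContMDiffAt 𝓘(ℝ, E) (𝓘(ℝ, E).prod 𝓘(ℝ, E)) ∞
    (fun x => (⟨x, Y x⟩ : TangentBundle 𝓘(ℝ, E) M)) p

/-- The second fundamental form `(f^*∇')_X (f_* Y) - f_* (∇_X Y)` at `p` of a map
`f : (M, g) → (M', g')`. -/
def secondFundamentalForm (g : RMetric E M) (g' : RMetric E' M') (f : M → M') (p : M)
    (X : Tan E p) (Y : ∀ x : M, Tan E x) : Tan E' (f p) :=
  covDerivAlong g' f (fun x => mfderiv 𝓘(ℝ, E) 𝓘(ℝ, E') f x (Y x)) p X -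
    mfderiv 𝓘(ℝ, E) 𝓘(ℝ, E') f p (leviCivita g Y p X)

/-- A map is totally geodesic if its second fundamental form vanishes. -/
def IsTotallyGeodesic (g : RMetric E M) (g' : RMetric E' M') (f : M → M') : Prop :=
  ∀ (p : M) (X : Tan E p) (Y : ∀ x : M, Tan E x), SmoothFieldAt Y p →
    secondFundamentalForm g g' f p X Y = 0

/-- A smooth embedding that pulls back the metric of the target to the metric of the source. -/
structure IsIsometricEmbedding (g : RMetric E M) (g' : RMetric E' M') (f : M → M') : Prop where
  isSmoothEmbedding : Manifold.IsSmoothEmbedding 𝓘(ℝ, E) 𝓘(ℝ, E') ∞ f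
  isometric : ∀ (p : M) (u v : Tan E p), g'.inner (f p) (mfderiv 𝓘(ℝ, E) 𝓘(ℝ, E') f p u)
    (mfderiv 𝓘(ℝ, E) 𝓘(ℝ, E') f p v) = g.inner p u v

end

/-! ### Kähler structures -/

section

variable {E : Type*} [NormedAddCommGroup E] [NormedSpace ℝ E]
  {N : Type*} [TopologicalSpace N] [ChartedSpace E N] [IsManifold 𝓘(ℝ, E) ∞ N]

/-- The pair `(g, J)` is an almost Hermitian structure: `J` is a smooth field of
`g`-orthogonal complex structures. -/
structure IsAlmostHermitian (g : RMetric E N) (J : ∀ x : N, Tan E x →L[ℝ] Tan E x) : Prop where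
  smooth : ContMDiff 𝓘(ℝ, E) (𝓘(ℝ, E).prod 𝓘(ℝ, E →L[ℝ] E)) ∞
    (fun x => Bundle.TotalSpace.mk' (E →L[ℝ] E)
      (E := fun x : N => Tan E x →L[ℝ] Tan E x) x (J x))
  sq : ∀ (x : N) (v : Tan E x), J x (J x v) = -v
  orth : ∀ (x : N) (u v : Tan E x), g.inner x (J x u) (J x v) = g.inner x u v

/-- The Lie bracket of vector fields. -/
abbrev bracket (X Y : ∀ x : N, Tan E x) : ∀ x : N, Tan E x :=
  VectorField.mlieBracket 𝓘(ℝ, E) X Y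

/-- The Nijenhuis tensor of `J` on the vector fields `X` and `Y`. -/
def nijenhuis (J : ∀ x : N, Tan E x →L[ℝ] Tan E x) (X Y : ∀ x : N, Tan E x) (p : N) : Tan E p :=
  bracket (fun x => J x (X x)) (fun x => J x (Y x)) p - J p (bracket (fun x => J x (X x)) Y p) -
    J p (bracket X (fun x => J x (Y x)) p) - bracket X Y p

/-- The form `ω(u, v) = g(J u, v)`. -/
def kaehlerForm (g : RMetric E N) (J : ∀ x : N, Tan E x →L[ℝ] Tan E x) (x : N)
    (u v : Tan E x) : ℝ :=
  g.inner x (J x u) v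

/-- The derivative at `p` of the function `f` in the direction `v`. -/
def dirDeriv (f : N → ℝ) (p : N) (v : Tan E p) : ℝ :=
  mfderiv 𝓘(ℝ, E) 𝓘(ℝ, ℝ) f p v

/-- The value at `p` of the exterior derivative of the two-form `α` on the vector fields
`X`, `Y`, `Z`. -/
def extDerivTwo (α : ∀ x : N, Tan E x → Tan E x → ℝ) (X Y Z : ∀ x : N, Tan E x) (p : N) : ℝ :=
  dirDeriv (fun x => α x (Y x) (Z x)) p (X p) + dirDeriv (fun x => α x (Z x) (X x)) p (Y p) +
    dirDeriv (fun x => α x (X x) (Y x)) p (Z p) -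
    α p (bracket X Y p) (Z p) - α p (bracket Y Z p) (X p) - α p (bracket Z X p) (Y p)

/-- `(N, g, J)` is Kähler: it is almost Hermitian, `J` is integrable and the Kähler form is
closed. -/
structure IsKaehler (g : RMetric E N) (J : ∀ x : N, Tan E x →L[ℝ] Tan E x) : Prop extends
    IsAlmostHermitian g J where
  integrable : ∀ (p : N) (X Y : ∀ x : N, Tan E x), SmoothFieldAt X p → SmoothFieldAt Y p →
    nijenhuis J X Y p = 0
  closed : ∀ (p : N) (X Y Z : ∀ x : N, Tan E x), SmoothFieldAt X p → SmoothFieldAt Y p →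
    SmoothFieldAt Z p → extDerivTwo (kaehlerForm g J) X Y Z p = 0

/-- An almost Hermitian structure as a section of the twistor space. -/
def IsAlmostHermitian.toTwistor {g : RMetric E N} {J : ∀ x : N, Tan E x →L[ℝ] Tan E x}
    (hJ : IsAlmostHermitian g J) (x : N) : TwistorSpace g :=
  ⟨x, J x, hJ.sq x, hJ.orth x⟩

end

/-! ### The metrics of the twistor space -/

section

variable {E : Type*} [NormedAddCommGroup E] [NormedSpace ℝ E] [FiniteDimensional ℝ E]
  {N : Type*} [TopologicalSpace N] [ChartedSpace E N] [IsManifold 𝓘(ℝ, E) ∞ N]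
  {g : RMetric E N}

/-- The tangent space of the twistor space. -/
abbrev TanTw (z : TwistorSpace g) : Type _ := Tan (E × FModel (halfDim E)) z

/-- The differential at `z` of the projection of the twistor space to `N`. -/
def dProj (z : TwistorSpace g) (ξ : TanTw z) : Tan E z.base :=
  mfderiv 𝓘(ℝ, E × FModel (halfDim E)) 𝓘(ℝ, E) (TwistorSpace.base (g := g)) z ξ

/-- The complex structure of a point `z` of the twistor space, read in the chart of `N` at `p`. -/
def strInChart (p : N) (z : TwistorSpace g) : E →L[ℝ] E :=
  (tanTriv E p).continuousLinearMapAt ℝ z.base ∘L z.str ∘L (tanTriv E p).symmL ℝ z.base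

/-- The vertical part of a tangent vector `ξ` of the twistor space at `z = (p, J)`, as an
endomorphism of `T_p N`: the covariant derivative in the direction `ξ` of the tautological field of
endomorphisms for the Levi-Civita connection, which is `∂_ξ J + [Γ(π_* ξ), J]` in the chart
at `p`. The horizontal space is its kernel, and on a vertical vector (one that is tangent to the
fibre, so that `π_* ξ = 0`) it is the endomorphism which that vector is. -/
def verticalPart (z : TwistorSpace g) (ξ : TanTw z) : Tan E z.base →L[ℝ] Tan E z.base :=
  let d : E →L[ℝ] E :=
    mfderiv 𝓘(ℝ, E × FModel (halfDim E)) 𝓘(ℝ, E →L[ℝ] E) (strInChart z.base) z ξ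
  let J : E →L[ℝ] E := z.str
  let Γ : E →L[ℝ] E := christoffel g z.base (dProj z ξ)
  d + Γ ∘L J - J ∘L Γ

/-- The inner product `G(A, B) = -(1 / n) Trace (A B)` of skew-symmetric endomorphisms,
`n` being the dimension. -/
def traceForm {x : N} (A B : Tan E x →L[ℝ] Tan E x) : ℝ :=
  -(1 / (Module.finrank ℝ E : ℝ)) * LinearMap.trace ℝ (Tan E x) (A ∘L B).toLinearMap

/-- The metric `h_t` of the twistor space: `π^* g` on the horizontal space, `t G` on the vertical
one, the two spaces being orthogonal. -/
def twistorForm (t : ℝ) (z : TwistorSpace g) (ξ η : TanTw z) : ℝ :=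
  g.inner z.base (dProj z ξ) (dProj z η) + t * traceForm (verticalPart z ξ) (verticalPart z η)

end

end Twistor

end

open scoped Manifold ContDiff Topology RealInnerProductSpace

noncomputable section

namespace Twistor

/-! ### Calculus in the charts of a manifold -/

section ChartCalculus

variable {E : Type*} [NormedAddCommGroup E] [NormedSpace ℝ E]
  {M : Type*} [TopologicalSpace M] [ChartedSpace E M]
  {E' : Type*} [NormedAddCommGroup E'] [NormedSpace ℝ E']
  {M' : Type*} [TopologicalSpace M'] [ChartedSpace E' M']
  {G : Type*} [NormedAddCommGroup G] [NormedSpace ℝ G]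

/-! The vertical part of `J_* X` at `(p, J_p)` is the covariant derivative of the field of
endomorphisms `J` along `X`. On a Kähler manifold `∇J = 0`, so the section `J` is horizontal. Since
`π ∘ J = id`, the first term of `h_t = π^* g + t G(vert, vert)` pulls back to `g` and the second to
`0`, so `J` is isometric. A smooth section of the continuous projection `π` is a topological
embedding, and it is an immersion because it is a graph in charts adapted to `π`.

Horizontality also gives total geodesy, without any curvature computation. Locally `h = π^* g + B(φ,
φ)`, where `φ` is a one-form with values in a fixed vector space, `B` is a constant bilinear form,
and `φ` vanishes on the tangent spaces of the section `f`. In Koszul's formula for `h(∇df(u, v), w)`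
the `φ` terms reduce to `B(φ(D²f(u, v)) + ½ (Dφ(f_* u) f_* v + Dφ(f_* v) f_* u), φ(w))`.
Differentiating `φ(df v) = 0` shows that the first argument of `B` is zero. The remaining terms
cancel by the second derivative of `π ∘ f = id`. This is `totallyGeodesic_of_horizontal`, a
statement about open sets of normed spaces.

That `∇J = 0` (`IsKaehler.parallel`) is the classical computation: the Nijenhuis tensor and `dω` are
evaluated on fields constant in a chart and rewritten in terms of `∇J` by means of the symmetric
metric connection. The algebraic identity `eq_zero_of_closed_of_integrable` then concludes.

The other main point is that `twistorForm` is a smooth metric at all. It is defined pointwise, in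
the chart at `z.base`, which jumps with `z`. In a local orthonormal frame the vertical part becomes
`dK + [conn, K]`, where `K` is the matrix of the complex structure (`frInv_vert_fr`). The connection
matrix `conn` is smooth because Koszul's formula writes it through brackets of the frame fields
(`inner_conn_fr`). The same expression supplies the one-form `φ` above, with matrix values, and `B`
is a multiple of the trace form. Positivity holds because the matrices involved are skew
(`vertFr_skew`) and `tr A² = -|A|²` for skew `A`. -/

/-- The derivative of a map between manifolds, as a linear map between the model spaces. -/
def mder (E E' : Type*) [NormedAddCommGroup E] [NormedSpace ℝ E] [NormedAddCommGroup E']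
    [NormedSpace ℝ E'] {M M' : Type*} [TopologicalSpace M] [ChartedSpace E M]
    [TopologicalSpace M'] [ChartedSpace E' M'] (f : M → M') (x : M) : E →L[ℝ] E' :=
  mfderiv 𝓘(ℝ, E) 𝓘(ℝ, E') f x

theorem hasMFDerivAt_mder {f : M → M'} {x : M} (hf : MDifferentiableAt 𝓘(ℝ, E) 𝓘(ℝ, E') f x) :
    HasMFDerivAt 𝓘(ℝ, E) 𝓘(ℝ, E') f x (mder E E' f x) :=
  hf.hasMFDerivAt

theorem mder_eq_of_hasMFDerivAt {f : M → M'} {x : M} {A : E →L[ℝ] E'}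
    (hf : HasMFDerivAt 𝓘(ℝ, E) 𝓘(ℝ, E') f x A) : mder E E' f x = A :=
  hf.mfderiv

theorem mder_congr {f f' : M → M'} {x : M} (h : f =ᶠ[𝓝 x] f') :
    mder E E' f x = mder E E' f' x :=
  h.mfderiv_eq

theorem mder_comp {E'' : Type*} [NormedAddCommGroup E''] [NormedSpace ℝ E''] {M'' : Type*}
    [TopologicalSpace M''] [ChartedSpace E'' M''] {f : M → M'} {f' : M' → M''} {x : M}
    (hf' : MDifferentiableAt 𝓘(ℝ, E') 𝓘(ℝ, E'') f' (f x))
    (hf : MDifferentiableAt 𝓘(ℝ, E) 𝓘(ℝ, E') f x) :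
    mder E E'' (fun x => f' (f x)) x = mder E' E'' f' (f x) ∘L mder E E' f x :=
  mfderiv_comp x hf' hf

theorem mder_eq_fderiv (f : E → E') (x : E) : mder E E' f x = fderiv ℝ f x := mfderiv_eq_fderiv

/-- The derivative at `p` of a map to a vector space, computed in the chart at `p`. -/
theorem mder_eq_fderiv_chart {f : M → G} {p : M}
    (hf : MDifferentiableAt 𝓘(ℝ, E) 𝓘(ℝ, G) f p) :
    mder E G f p = fderiv ℝ (fun y => f ((chartAt E p).symm y)) (chartAt E p p) := by
  refine hf.mfderiv.trans ?_
  simp only [writtenInExtChartAt, mfld_simps, fderivWithin_univ]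
  rfl

theorem hasMFDerivAt_of_hasFDerivAt {f : E → G} {x : E} {A : E →L[ℝ] G} (h : HasFDerivAt f A x) :
    HasMFDerivAt 𝓘(ℝ, E) 𝓘(ℝ, G) f x A := h.hasMFDerivAt

variable [IsManifold 𝓘(ℝ, E) ∞ M]

theorem isManifold_one : IsManifold 𝓘(ℝ, E) 1 M := .of_le (n := ∞) (by simp)

/-- The trivialization of the tangent bundle in the chart at `p`, on the tangent space at `x`. -/
def toChart (E : Type*) [NormedAddCommGroup E] [NormedSpace ℝ E] {M : Type*} [TopologicalSpace M]
    [ChartedSpace E M] [IsManifold 𝓘(ℝ, E) ∞ M] (p x : M) : E →L[ℝ] E :=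
  (tanTriv E p).continuousLinearMapAt ℝ x

/-- The inverse of `toChart`. -/
def ofChart (E : Type*) [NormedAddCommGroup E] [NormedSpace ℝ E] {M : Type*} [TopologicalSpace M]
    [ChartedSpace E M] [IsManifold 𝓘(ℝ, E) ∞ M] (p x : M) : E →L[ℝ] E :=
  (tanTriv E p).symmL ℝ x

/-- Links trivializations to derivatives. A vector of `T_x M` is read in the preferred chart at `x`,
so the trivialization at `p` acts on it by the coordinate change from that chart to the chart at
`p`, which is also how `mfderiv` sees the chart at `p`. -/
theorem toChart_eq_mder {p x : M} (hx : x ∈ (chartAt E p).source) :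
    toChart E p x = mder E E (chartAt E p) x := by
  have : IsManifold 𝓘(ℝ, E) 1 M := isManifold_one
  refine Eq.trans ?_ (mfderiv_chartAt_eq_tangentCoordChange hx).symm
  exact TangentBundle.continuousLinearMapAt_trivializationAt_eq_core hx

theorem ofChart_toChart {p x : M} (hx : x ∈ (chartAt E p).source) (v : E) :
    ofChart E p x (toChart E p x v) = v :=
  (tanTriv E p).symmL_continuousLinearMapAt (R := ℝ)
    (show x ∈ (tanTriv E p).baseSet from hx) v

theorem toChart_ofChart {p x : M} (hx : x ∈ (chartAt E p).source) (v : E) :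
    toChart E p x (ofChart E p x v) = v :=
  (tanTriv E p).continuousLinearMapAt_symmL (R := ℝ)
    (show x ∈ (tanTriv E p).baseSet from hx) v

/-- The coordinate change from the preferred chart at `p` to itself is trivial. Formulas evaluated
at the centre of a chart therefore carry no change of coordinates. -/
theorem toChart_self (p : M) (v : E) : toChart E p p v = v := by
  have : IsManifold 𝓘(ℝ, E) 1 M := isManifold_one
  rw [toChart, TangentBundle.continuousLinearMapAt_trivializationAt_eq_core (mem_chart_source E p)]
  exact (tangentBundleCore 𝓘(ℝ, E) M).coordChange_self _ _ (mem_chart_source E p) v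

theorem ofChart_self (p : M) (v : E) : ofChart E p p v = v := by
  conv_lhs => rw [← toChart_self p v]
  exact ofChart_toChart (mem_chart_source E p) v

theorem mdifferentiableAt_chartAt {p x : M} (hx : x ∈ (chartAt E p).source) :
    MDifferentiableAt 𝓘(ℝ, E) 𝓘(ℝ, E) (chartAt E p) x := by
  have : IsManifold 𝓘(ℝ, E) 1 M := isManifold_one
  exact mdifferentiableAt_atlas (chart_mem_atlas _ _) hx

theorem mdifferentiableAt_chartAt_symm {p : M} {y : E} (hy : y ∈ (chartAt E p).target) :
    MDifferentiableAt 𝓘(ℝ, E) 𝓘(ℝ, E) (chartAt E p).symm y := by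
  have : IsManifold 𝓘(ℝ, E) 1 M := isManifold_one
  exact mdifferentiableAt_atlas_symm (chart_mem_atlas _ _) hy

/-- Differentiating `c ∘ c⁻¹ = id` shows that the derivative of `c⁻¹` is a right inverse of the
invertible map `toChart`. -/
theorem ofChart_eq_mder {p x : M} (hx : x ∈ (chartAt E p).source) :
    ofChart E p x = mder E E (chartAt E p).symm (chartAt E p x) := by
  have hy := (chartAt E p).map_source hx
  have hxx := (chartAt E p).left_inv hx
  have h1 := mder_comp (E'' := E) (f := (chartAt E p).symm) (f' := chartAt E p)
    (x := chartAt E p x) (by rw [hxx]; exact mdifferentiableAt_chartAt hx)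
    (mdifferentiableAt_chartAt_symm hy)
  have h2 : mder E E (fun y => chartAt E p ((chartAt E p).symm y)) (chartAt E p x) =
      ContinuousLinearMap.id ℝ E := by
    rw [mder_eq_fderiv]
    refine Eq.trans (Filter.EventuallyEq.fderiv_eq ?_) fderiv_id
    filter_upwards [(chartAt E p).open_target.mem_nhds hy] with y hy
    exact (chartAt E p).right_inv hy
  rw [h2, hxx, ← toChart_eq_mder hx] at h1
  ext w
  have h3 := DFunLike.congr_fun h1 w
  rw [ContinuousLinearMap.comp_apply, ContinuousLinearMap.id_apply] at h3
  conv_lhs => rw [h3]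
  exact ofChart_toChart hx _

/-- The derivative of a map to a manifold, read in a chart of the source. -/
theorem mder_ofChart {f : M → M'} {p x : M} (hx : x ∈ (chartAt E p).source)
    (hf : MDifferentiableAt 𝓘(ℝ, E) 𝓘(ℝ, E') f x) :
    mder E E' f x ∘L ofChart E p x =
      mder E E' (fun y => f ((chartAt E p).symm y)) (chartAt E p x) := by
  have hxx := (chartAt E p).left_inv hx
  rw [mder_comp (f := (chartAt E p).symm) (f' := f) (x := chartAt E p x)
    (by rwa [hxx]) (mdifferentiableAt_chartAt_symm ((chartAt E p).map_source hx)),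
    hxx, ofChart_eq_mder hx]

theorem mdifferentiableAt_comp_chart_symm {f : M → M'} {p x : M} (hx : x ∈ (chartAt E p).source)
    (hf : MDifferentiableAt 𝓘(ℝ, E) 𝓘(ℝ, E') f x) :
    MDifferentiableAt 𝓘(ℝ, E) 𝓘(ℝ, E') (fun y => f ((chartAt E p).symm y)) (chartAt E p x) := by
  refine MDifferentiableAt.comp (I' := 𝓘(ℝ, E)) (chartAt E p x) (g := f)
    (f := (chartAt E p).symm) ?_ (mdifferentiableAt_chartAt_symm ((chartAt E p).map_source hx))
  rwa [(chartAt E p).left_inv hx]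

/-- The derivative of a map between manifolds, read in two charts. -/
theorem toChart_mder_ofChart [IsManifold 𝓘(ℝ, E') ∞ M'] {f : M → M'} {p x : M} {p' : M'}
    (hx : x ∈ (chartAt E p).source) (hfx : f x ∈ (chartAt E' p').source)
    (hf : MDifferentiableAt 𝓘(ℝ, E) 𝓘(ℝ, E') f x) :
    toChart E' p' (f x) ∘L mder E E' f x ∘L ofChart E p x =
      fderiv ℝ (fun y => chartAt E' p' (f ((chartAt E p).symm y))) (chartAt E p x) := by
  have hxx := (chartAt E p).left_inv hx
  rw [mder_ofChart hx hf, ← mder_eq_fderiv, mder_comp (f' := chartAt E' p')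
    (f := fun y => f ((chartAt E p).symm y)) (by rw [hxx]; exact mdifferentiableAt_chartAt hfx)
    (mdifferentiableAt_comp_chart_symm hx hf), hxx, toChart_eq_mder hfx]

theorem contMDiffAt_comp_chart_symm {f : M → M'} {p x : M} (hx : x ∈ (chartAt E p).source)
    (hf : ContMDiffAt 𝓘(ℝ, E) 𝓘(ℝ, E') ∞ f x) :
    ContMDiffAt 𝓘(ℝ, E) 𝓘(ℝ, E') ∞ (fun y => f ((chartAt E p).symm y)) (chartAt E p x) := by
  refine ContMDiffAt.comp (I' := 𝓘(ℝ, E)) (chartAt E p x) (g := f) (f := (chartAt E p).symm) ?_ ?_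
  · rwa [(chartAt E p).left_inv hx]
  · exact (contMDiffOn_chart_symm (I := 𝓘(ℝ, E)) (n := ∞) (x := p)).contMDiffAt
      ((chartAt E p).open_target.mem_nhds ((chartAt E p).map_source hx))

/-- Smoothness of a vector field in the chart at `p`. -/
theorem contMDiffOn_toChart {Y : ∀ x : M, Tan E x} {s : Set M} (hs : IsOpen s) {p : M}
    (hsp : s ⊆ (chartAt E p).source) :
    ContMDiffOn 𝓘(ℝ, E) (𝓘(ℝ, E).prod 𝓘(ℝ, E)) ∞
      (fun x => (⟨x, Y x⟩ : TangentBundle 𝓘(ℝ, E) M)) s ↔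
    ContMDiffOn 𝓘(ℝ, E) 𝓘(ℝ, E) ∞ (fun x => toChart E p x (Y x)) s := by
  have : IsManifold 𝓘(ℝ, E) 1 M := isManifold_one
  have hb : s ⊆ (tanTriv E p).baseSet := hsp
  rw [(tanTriv E p).contMDiffOn_section_iff hs hb]
  refine ⟨fun h => h.congr fun x hx => ?_, fun h => h.congr fun x hx => ?_⟩
  · exact (tanTriv E p).continuousLinearMapAt_apply_of_mem ℝ (hb hx) (Y x)
  · exact ((tanTriv E p).continuousLinearMapAt_apply_of_mem ℝ (hb hx) (Y x)).symm

theorem contMDiffAt_toChart {Y : ∀ x : M, Tan E x} {p x : M} (hx : x ∈ (chartAt E p).source) :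
    SmoothFieldAt Y x ↔ ContMDiffAt 𝓘(ℝ, E) 𝓘(ℝ, E) ∞ (fun x => toChart E p x (Y x)) x := by
  have : IsManifold 𝓘(ℝ, E) 1 M := isManifold_one
  have hb : x ∈ (tanTriv E p).baseSet := hx
  have key : (fun x => toChart E p x (Y x)) =ᶠ[𝓝 x] fun x => (tanTriv E p ⟨x, Y x⟩).2 := by
    filter_upwards [(tanTriv E p).open_baseSet.mem_nhds hb] with y hy
    exact (tanTriv E p).continuousLinearMapAt_apply_of_mem ℝ hy (Y y)
  rw [SmoothFieldAt, key.contMDiffAt_iff]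
  exact (tanTriv E p).contMDiffAt_section_iff hb

/-- Fields that are constant in the chart at `p` are smooth. -/
theorem smoothFieldAt_ofChart {p x : M} (hx : x ∈ (chartAt E p).source) (w : E) :
    SmoothFieldAt (fun x : M => (ofChart E p x w : Tan E x)) x := by
  refine (contMDiffAt_toChart hx).2 ?_
  refine (contMDiffAt_const (c := w)).congr_of_eventuallyEq ?_
  filter_upwards [(chartAt E p).open_source.mem_nhds hx] with y hy
  exact toChart_ofChart hy w

end ChartCalculus

/-! ### Metrics in charts -/

section MetricInChart

variable {E : Type*} [NormedAddCommGroup E] [NormedSpace ℝ E]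
  {M : Type*} [TopologicalSpace M] [ChartedSpace E M] [IsManifold 𝓘(ℝ, E) ∞ M]

/-- The metric at `x`, as a bilinear form on the model space `E = T_x M`. -/
def metricAt (g : RMetric E M) (x : M) : E →L[ℝ] E →L[ℝ] ℝ := g.inner x

theorem metricAt_symm (g : RMetric E M) (x : M) (u v : E) :
    metricAt g x u v = metricAt g x v u := g.symm x u v

theorem metricAt_pos (g : RMetric E M) (x : M) {v : E} (hv : v ≠ 0) : 0 < metricAt g x v v :=
  g.pos x v hv

/-- A field of bilinear forms on the tangent spaces, read in the chart at `p`. -/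
def formInChart (b : M → E →L[ℝ] E →L[ℝ] ℝ) (p : M) (y : E) : E →L[ℝ] E →L[ℝ] ℝ :=
  (b ((chartAt E p).symm y)).bilinearComp (ofChart E p ((chartAt E p).symm y))
    (ofChart E p ((chartAt E p).symm y))

theorem formInChart_apply (b : M → E →L[ℝ] E →L[ℝ] ℝ) (p : M) (y u v : E) :
    formInChart b p y u v = b ((chartAt E p).symm y) (ofChart E p ((chartAt E p).symm y) u)
      (ofChart E p ((chartAt E p).symm y) v) := rfl

theorem metricInChart_eq_formInChart (g : RMetric E M) (p : M) :
    metricInChart g p = formInChart (metricAt g) p := rfl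

/-- The trivialization at `p` of the bundle of bilinear forms sends `b` to its coefficients in the
chart at `p`. One direction is used for the given metric `g`, the other to prove that the form on
the twistor space is smooth. -/
theorem contMDiff_form_iff (b : M → E →L[ℝ] E →L[ℝ] ℝ) :
    ContMDiff 𝓘(ℝ, E) (𝓘(ℝ, E).prod 𝓘(ℝ, E →L[ℝ] E →L[ℝ] ℝ)) ∞
      (fun x => Bundle.TotalSpace.mk' (E →L[ℝ] E →L[ℝ] ℝ)
        (E := fun x : M => Tan E x →L[ℝ] Tan E x →L[ℝ] ℝ) x (b x)) ↔
    ∀ p : M, ContDiffOn ℝ ∞ (formInChart b p) (chartAt E p).target := by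
  have : IsManifold 𝓘(ℝ, E) 1 M := isManifold_one
  have hca : ∀ x : M, ContinuousAdd (Tan E x →L[ℝ] ℝ) := fun x =>
    inferInstanceAs (ContinuousAdd (E →L[ℝ] ℝ))
  have hcs : ∀ x : M, ContinuousSMul ℝ (Tan E x →L[ℝ] ℝ) := fun x =>
    inferInstanceAs (ContinuousSMul ℝ (E →L[ℝ] ℝ))
  have key : ∀ p : M, (ContMDiffOn 𝓘(ℝ, E) (𝓘(ℝ, E).prod 𝓘(ℝ, E →L[ℝ] E →L[ℝ] ℝ)) ∞
      (fun x => Bundle.TotalSpace.mk' (E →L[ℝ] E →L[ℝ] ℝ)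
        (E := fun x : M => Tan E x →L[ℝ] Tan E x →L[ℝ] ℝ) x (b x)) (chartAt E p).source ↔
      ContMDiffOn 𝓘(ℝ, E) 𝓘(ℝ, E →L[ℝ] E →L[ℝ] ℝ) ∞
        (fun x => formInChart b p (chartAt E p x)) (chartAt E p).source) := by
    intro p
    let e := trivializationAt (E →L[ℝ] E →L[ℝ] ℝ)
      (fun x : M => Tan E x →L[ℝ] Tan E x →L[ℝ] ℝ) p
    have hb : e.baseSet = (chartAt E p).source := by simp [e]
    have he : ∀ x ∈ (chartAt E p).source, (e ⟨x, b x⟩).2 = formInChart b p (chartAt E p x) := by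
      intro x hx
      ext u v
      have h1 := inCoordinates_apply_eq₂ (F₁ := E) (F₂ := E) (F₃ := ℝ) (E₁ := fun x : M => Tan E x)
        (E₂ := fun x : M => Tan E x) (E₃ := Bundle.Trivial M ℝ) (ϕ := b x) (v := u) (w := v)
        (x₀ := p) (x := x) hx hx (by simp)
      refine Eq.trans h1 ?_
      rw [formInChart_apply, (chartAt E p).left_inv hx]
      rw [Bundle.Trivialization.coe_linearMapAt_of_mem _ (by simp)]
      have hs : ∀ u : E, ofChart E p x u =
          (trivializationAt E (fun x : M => Tan E x) p).symm x u := fun u =>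
        (tanTriv E p).symmL_apply (R := ℝ) hx u
      rw [hs, hs]
      rfl
    refine (e.contMDiffOn_section_iff (chartAt E p).open_source hb.ge).trans ?_
    exact contMDiffOn_congr he
  have key2 : ∀ p : M, ContMDiffOn 𝓘(ℝ, E) 𝓘(ℝ, E →L[ℝ] E →L[ℝ] ℝ) ∞
      (fun x => formInChart b p (chartAt E p x)) (chartAt E p).source ↔
      ContDiffOn ℝ ∞ (formInChart b p) (chartAt E p).target := by
    intro p
    rw [← contMDiffOn_iff_contDiffOn]
    constructor
    · intro h
      refine (h.comp (contMDiffOn_chart_symm (I := 𝓘(ℝ, E)) (n := ∞) (x := p))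
        fun y hy => (chartAt E p).map_target hy).congr fun y hy => ?_
      rw [Function.comp_apply, (chartAt E p).right_inv hy]
    · intro h
      exact h.comp (contMDiffOn_chart (I := 𝓘(ℝ, E)) (n := ∞) (x := p))
        fun x hx => (chartAt E p).map_source hx
  constructor
  · intro h p
    rw [← key2, ← key]
    exact h.contMDiffOn
  · intro h x
    have := (key x).2 ((key2 x).2 (h x))
    exact this.contMDiffAt ((chartAt E x).open_source.mem_nhds (mem_chart_source E x))

variable (g : RMetric E M)

theorem contDiffOn_metricInChart (p : M) :
    ContDiffOn ℝ ∞ (metricInChart g p) (chartAt E p).target :=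
  (contMDiff_form_iff (metricAt g)).1 g.contMDiff p

theorem contDiffAt_metricInChart (p : M) :
    ContDiffAt ℝ ∞ (metricInChart g p) (chartAt E p p) :=
  (contDiffOn_metricInChart g p).contDiffAt
    ((chartAt E p).open_target.mem_nhds (mem_chart_target E p))

theorem metricInChart_toChart {p x : M} (hx : x ∈ (chartAt E p).source) (u v : E) :
    metricInChart g p (chartAt E p x) (toChart E p x u) (toChart E p x v) = metricAt g x u v := by
  rw [metricInChart_eq_formInChart, formInChart_apply, (chartAt E p).left_inv hx,
    ofChart_toChart hx, ofChart_toChart hx]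

theorem metricInChart_self (p : M) :
    metricInChart g p (chartAt E p p) = metricAt g p := by
  ext u v
  have := metricInChart_toChart g (mem_chart_source E p) u v
  rwa [toChart_self, toChart_self] at this

theorem metricInChart_symm (p : M) (y u v : E) :
    metricInChart g p y u v = metricInChart g p y v u := by
  rw [metricInChart_eq_formInChart, formInChart_apply, formInChart_apply, metricAt_symm]

theorem fderiv_metricInChart_symm (p : M) (a u v : E) :
    fderiv ℝ (metricInChart g p) (chartAt E p p) a u v =
      fderiv ℝ (metricInChart g p) (chartAt E p p) a v u := by
  have hd : DifferentiableAt ℝ (metricInChart g p) (chartAt E p p) :=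
    (contDiffAt_metricInChart g p).differentiableAt (by simp)
  have h : ∀ u v : E, fderiv ℝ (fun y => metricInChart g p y u v) (chartAt E p p) a =
      fderiv ℝ (metricInChart g p) (chartAt E p p) a u v := by
    intro u v
    have := ((hd.hasFDerivAt.clm_apply (hasFDerivAt_const u _)).clm_apply
      (hasFDerivAt_const v _)).fderiv
    rw [this]; simp
  rw [← h, ← h]
  simp only [metricInChart_symm g p _ u v]

variable [FiniteDimensional ℝ E]

/-- Injectivity suffices, since `E` and its dual have the same dimension. The definition of
`christoffel` uses `ContinuousLinearMap.inverse`, which is `0` on maps that are not invertible, so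
this is what gives that definition its intended meaning. -/
theorem isInvertible_of_pos {b : E →L[ℝ] E →L[ℝ] ℝ} (hb : ∀ v, v ≠ 0 → 0 < b v v) :
    b.IsInvertible := by
  have hinj : Function.Injective b := by
    refine (injective_iff_map_eq_zero b).2 fun v hv => ?_
    by_contra hne
    have := hb v hne
    rw [hv] at this
    simp at this
  have hdim : Module.finrank ℝ E = Module.finrank ℝ (E →L[ℝ] ℝ) := by
    rw [← (LinearMap.toContinuousLinearMap (𝕜 := ℝ) (E := E) (F' := ℝ)).finrank_eq]
    exact (Subspace.dual_finrank_eq (K := ℝ) (V := E)).symm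
  let e := (LinearEquiv.ofInjectiveOfFinrankEq b.toLinearMap hinj hdim).toContinuousLinearEquiv
  exact ⟨e, by ext; rfl⟩

/-- Characterization of the Christoffel symbols. -/
theorem inner_christoffel (p : M) (u v w : E) :
    metricInChart g p (chartAt E p p) (christoffel g p u v) w =
      (1 / 2) * (fderiv ℝ (metricInChart g p) (chartAt E p p) u v w +
        fderiv ℝ (metricInChart g p) (chartAt E p p) v u w -
        fderiv ℝ (metricInChart g p) (chartAt E p p) w u v) := by
  have hinv : (metricInChart g p (chartAt E p p)).IsInvertible := by
    refine isInvertible_of_pos fun v hv => ?_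
    rw [metricInChart_self]
    exact metricAt_pos g p hv
  simp only [christoffel, ContinuousLinearMap.comp_apply]
  rw [hinv.self_apply_inverse]
  simp

/-- By compactness the form has a positive minimum `c` on the unit sphere, hence `c ‖v‖² ≤ b(v, v)`
everywhere. A Riemannian metric in the sense of `RMetric` has to have bounded unit balls. -/
theorem isVonNBounded_of_pos {b : E →L[ℝ] E →L[ℝ] ℝ} (hb : ∀ v, v ≠ 0 → 0 < b v v) :
    Bornology.IsVonNBounded ℝ {v : E | b v v < 1} := by
  rw [NormedSpace.isVonNBounded_iff]
  rcases subsingleton_or_nontrivial E with hE | hE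
  · exact (Set.toFinite _).isBounded
  have hcs : IsCompact (Metric.sphere (0 : E) 1) := isCompact_sphere 0 1
  have hne : (Metric.sphere (0 : E) 1).Nonempty := NormedSpace.sphere_nonempty.2 zero_le_one
  have hc : Continuous fun v : E => b v v := by fun_prop
  obtain ⟨v₀, hv₀, hmin⟩ := hcs.exists_isMinOn hne hc.continuousOn
  have hv₀0 : v₀ ≠ 0 := by
    rintro rfl
    simp at hv₀
  set c := b v₀ v₀
  have hcpos : 0 < c := hb v₀ hv₀0
  have hbd : ∀ v : E, c * ‖v‖ ^ 2 ≤ b v v := by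
    intro v
    rcases eq_or_ne v 0 with rfl | hv
    · simp
    have hn : ‖v‖ ≠ 0 := norm_ne_zero_iff.2 hv
    have h1 : c ≤ b (‖v‖⁻¹ • v) (‖v‖⁻¹ • v) := by
      refine hmin ?_
      simp [norm_smul, hn]
    simp only [map_smul, smul_apply, smul_eq_mul] at h1
    calc c * ‖v‖ ^ 2 ≤ (‖v‖⁻¹ * (‖v‖⁻¹ * b v v)) * ‖v‖ ^ 2 := by gcongr
      _ = b v v := by field_simp
  -- The bound obtained is `‖v‖ ≤ √(1 / c)`; adding `1` places `v` in an open ball.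
  refine (Metric.isBounded_ball (x := (0 : E)) (r := Real.sqrt (1 / c) + 1)).subset fun v hv => ?_
  rw [mem_ball_zero_iff]
  have h1 : ‖v‖ ^ 2 ≤ 1 / c := by
    rw [le_div_iff₀ hcpos]
    have h2 : b v v < 1 := hv
    linarith [hbd v]
  have := Real.le_sqrt_of_sq_le h1
  linarith

end MetricInChart

/-! ### Brackets and derivatives of inner products in charts -/

section Bracket

variable {E : Type*} [NormedAddCommGroup E] [NormedSpace ℝ E]
  {M : Type*} [TopologicalSpace M] [ChartedSpace E M] [IsManifold 𝓘(ℝ, E) ∞ M]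

theorem lieBracketWithin_univ_congr {V W V' W' : E → E} {y : E} (hV : V =ᶠ[𝓝 y] V')
    (hW : W =ᶠ[𝓝 y] W') : VectorField.lieBracketWithin ℝ V W Set.univ y =
      fderiv ℝ W' y (V' y) - fderiv ℝ V' y (W' y) := by
  rw [VectorField.lieBracketWithin_univ, VectorField.lieBracket, hV.fderiv_eq, hW.fderiv_eq,
    hV.eq_of_nhds, hW.eq_of_nhds]

/-- The Lie bracket of vector fields, as a vector of the model space. -/
def brak (X Y : M → E) (p : M) : E := bracket (N := M) X Y p

/-- The bracket of vector fields in the chart at `p`. -/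
theorem brak_eq {X Y : M → E} {p : M}
    (hX : MDifferentiableAt 𝓘(ℝ, E) 𝓘(ℝ, E) (fun x => toChart E p x (X x)) p)
    (hY : MDifferentiableAt 𝓘(ℝ, E) 𝓘(ℝ, E) (fun x => toChart E p x (Y x)) p) :
    brak X Y p = mder E E (fun x => toChart E p x (Y x)) p (X p) -
      mder E E (fun x => toChart E p x (X x)) p (Y p) := by
  -- The manifold bracket at `p` is the bracket in `E` of the fields pulled back by the inverse
  -- chart, transported back by the inverse of the derivative of the chart. At `p` that derivative
  -- is the identity.
  have hext : mder E E (extChartAt 𝓘(ℝ, E) p) p = ContinuousLinearMap.id ℝ E := by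
    ext v
    have h2 : (extChartAt 𝓘(ℝ, E) p : M → E) = chartAt E p := by simp
    rw [h2, ← toChart_eq_mder (E := E) (mem_chart_source E p)]
    exact toChart_self p v
  let pull : (M → E) → E → E := fun V => VectorField.mpullbackWithin 𝓘(ℝ, E) 𝓘(ℝ, E)
      (extChartAt 𝓘(ℝ, E) p).symm V (Set.range 𝓘(ℝ, E))
  have hr : Set.range (𝓘(ℝ, E) : E → E) = Set.univ := by simp
  have hpull : ∀ V : M → E, pull V =ᶠ[𝓝 (chartAt E p p)]
      fun y => toChart E p ((chartAt E p).symm y) (V ((chartAt E p).symm y)) := by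
    intro V
    filter_upwards [(chartAt E p).open_target.mem_nhds (mem_chart_target E p)] with y hy
    have hx := (chartAt E p).map_target hy
    have h2 : ((extChartAt 𝓘(ℝ, E) p).symm : E → M) = (chartAt E p).symm := by simp
    have h1 : mder E E (chartAt E p).symm y = ofChart E p ((chartAt E p).symm y) := by
      rw [ofChart_eq_mder hx, (chartAt E p).right_inv hy]
    have h3 : (ofChart E p ((chartAt E p).symm y)).inverse = toChart E p ((chartAt E p).symm y) := by
      refine ContinuousLinearMap.inverse_eq ?_ ?_
      · ext v; exact ofChart_toChart hx v
      · ext v; exact toChart_ofChart hx v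
    rw [← h3, ← h1, ← h2]
    simp only [pull, VectorField.mpullbackWithin, hr, mfderivWithin_univ]
    rfl
  have h5 : brak X Y p = (mder E E (extChartAt 𝓘(ℝ, E) p) p).inverse
        (VectorField.lieBracketWithin ℝ (pull X) (pull Y)
          ((extChartAt 𝓘(ℝ, E) p).symm ⁻¹' Set.univ ∩ Set.range 𝓘(ℝ, E))
          (extChartAt 𝓘(ℝ, E) p p)) := rfl
  have hset : ((extChartAt 𝓘(ℝ, E) p).symm ⁻¹' Set.univ ∩ Set.range (𝓘(ℝ, E) : E → E)) =
      Set.univ := by simp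
  have hpt : extChartAt 𝓘(ℝ, E) p p = chartAt E p p := by simp
  rw [h5, hext, ContinuousLinearMap.inverse_id, hset, hpt,
    lieBracketWithin_univ_congr (hpull X) (hpull Y), mder_eq_fderiv_chart hX,
    mder_eq_fderiv_chart hY]
  simp only [(chartAt E p).left_inv (mem_chart_source E p), toChart_self]
  rfl

theorem differentiableAt_comp_chart_symm {G : Type*} [NormedAddCommGroup G] [NormedSpace ℝ G]
    {f : M → G} {p x : M} (hx : x ∈ (chartAt E p).source)
    (hf : MDifferentiableAt 𝓘(ℝ, E) 𝓘(ℝ, G) f x) :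
    DifferentiableAt ℝ (fun y => f ((chartAt E p).symm y)) (chartAt E p x) :=
  mdifferentiableAt_iff_differentiableAt.1 (mdifferentiableAt_comp_chart_symm hx hf)

/-- The derivative of the product of two fields for a metric, in the chart at `p`. -/
theorem mder_metricAt (g : RMetric E M) {X Y : M → E} {p : M}
    (hX : MDifferentiableAt 𝓘(ℝ, E) 𝓘(ℝ, E) (fun x => toChart E p x (X x)) p)
    (hY : MDifferentiableAt 𝓘(ℝ, E) 𝓘(ℝ, E) (fun x => toChart E p x (Y x)) p) (u : E) :
    mder E ℝ (fun x => metricAt g x (X x) (Y x)) p u =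
      fderiv ℝ (metricInChart g p) (chartAt E p p) u (X p) (Y p) +
      metricAt g p (mder E E (fun x => toChart E p x (X x)) p u) (Y p) +
      metricAt g p (X p) (mder E E (fun x => toChart E p x (Y x)) p u) := by
  have hsrc : ∀ᶠ x in 𝓝 p, x ∈ (chartAt E p).source :=
    (chartAt E p).open_source.mem_nhds (mem_chart_source E p)
  have hdX := differentiableAt_comp_chart_symm (mem_chart_source E p) hX
  have hdY := differentiableAt_comp_chart_symm (mem_chart_source E p) hY
  have hg : DifferentiableAt ℝ (metricInChart g p) (chartAt E p p) :=
    (contDiffAt_metricInChart g p).differentiableAt (by simp)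
  have h1 := (hg.hasFDerivAt.clm_apply hdX.hasFDerivAt).clm_apply hdY.hasFDerivAt
  have h3 : (fun x => metricAt g x (X x) (Y x)) =ᶠ[𝓝 p]
      fun x => (fun y => metricInChart g p y
        (toChart E p ((chartAt E p).symm y) (X ((chartAt E p).symm y)))
        (toChart E p ((chartAt E p).symm y) (Y ((chartAt E p).symm y)))) (chartAt E p x) := by
    filter_upwards [hsrc] with x hx
    simp only [(chartAt E p).left_inv hx]
    exact (metricInChart_toChart g hx _ _).symm
  rw [mder_congr h3, mder_comp (mdifferentiableAt_iff_differentiableAt.2 h1.differentiableAt)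
    (mdifferentiableAt_chartAt (mem_chart_source E p)), mder_eq_fderiv, h1.fderiv,
    ← toChart_eq_mder (mem_chart_source E p), mder_eq_fderiv_chart hX, mder_eq_fderiv_chart hY]
  simp only [ContinuousLinearMap.comp_apply, add_apply,
    ContinuousLinearMap.flip_apply, (chartAt E p).left_inv (mem_chart_source E p), toChart_self,
    metricInChart_self]
  ring

end Bracket

/-! ### The complex structure of a Kähler manifold is parallel -/

section Parallel

/-- The linear algebra behind the fact that the complex structure of a Kähler manifold is
parallel; `Φ` stands for `(u, v, w) ↦ g((∇_u J) v, w)`. -/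
theorem eq_zero_of_closed_of_integrable {V : Type*} (J : V → V) (Φ : V → V → V → ℝ)
    (hJ : ∀ u v w, Φ u v (J (J w)) = -Φ u v w)
    (hskew : ∀ u v w, Φ u v w = -Φ u w v)
    (hanti : ∀ u v w, Φ u (J v) w = Φ u v (J w))
    (hclosed : ∀ u v w, Φ u v w + Φ v w u + Φ w u v = 0)
    (hint : ∀ u v w, Φ (J u) v w - Φ (J v) u w - Φ v u (J w) + Φ u v (J w) = 0)
    (u v w : V) : Φ u v w = 0 := by
  -- The combination `c1 - c2 + n` reduces to `2 Φ(u, v, w) = 0`: `a1` doubles the first term, while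
  -- skewness and anti-commutation with `J` cancel all the others.
  have c1 := hclosed u v w
  have c2 := hclosed u (J v) (J w)
  have n := hint v w (J u)
  have a1 := hanti u v (J w)
  have a2 := hanti (J v) w u
  have a3 := hanti (J w) u v
  have a4 := hskew (J w) (J u) v
  have a5 := hskew w u v
  rw [hJ, hJ] at n
  rw [hJ] at a1
  linarith

variable {E : Type*} [NormedAddCommGroup E] [NormedSpace ℝ E]

/-- The vanishing of `∇ J` at a point, in terms of the derivatives `DJ` and `dg` of `J` and of
the metric and of the Christoffel symbols `Γ`. -/
theorem parallel_of_kaehler_identities (g : E →L[ℝ] E →L[ℝ] ℝ) (hg : ∀ u v, g u v = g v u)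
    (hpos : ∀ v, v ≠ 0 → 0 < g v v) (J : E →L[ℝ] E) (hJ : ∀ v, J (J v) = -v)
    (hJg : ∀ u v, g (J u) v = -g u (J v)) (dg : E →L[ℝ] E →L[ℝ] E →L[ℝ] ℝ)
    (hdg : ∀ a u v, dg a u v = dg a v u) (Γ DJ : E →L[ℝ] E →L[ℝ] E)
    (hΓ : ∀ u v w, g (Γ u v) w = (1 / 2) * (dg u v w + dg v u w - dg w u v))
    (hDJ : ∀ u v, DJ u (J v) + J (DJ u v) = 0)
    (hDg : ∀ a u v, dg a (J u) v + g (DJ a u) v = -(dg a u (J v) + g u (DJ a v)))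
    (hclosed : ∀ u v w, (dg u (J v) w + g (DJ u v) w) + (dg v (J w) u + g (DJ v w) u) +
      (dg w (J u) v + g (DJ w u) v) = 0)
    (hint : ∀ u v, DJ (J u) v - DJ (J v) u + J (DJ v u) - J (DJ u v) = 0) (u v : E) :
    DJ u v + Γ u (J v) - J (Γ u v) = 0 := by
  let Φ : E → E → E → ℝ := fun u v w => g (DJ u v + Γ u (J v) - J (Γ u v)) w
  have hΦ : ∀ u v w, Φ u v w = g (DJ u v) w + g (Γ u (J v)) w + g (Γ u v) (J w) := by
    intro u v w
    simp only [Φ, map_add, map_sub, add_apply, sub_apply, hJg]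
    ring
  -- Both Koszul expressions agree because `dg w` is symmetric, and positivity makes `g`
  -- nondegenerate.
  have hsymm : ∀ u v, Γ u v = Γ v u := by
    intro u v
    rw [← sub_eq_zero]
    by_contra hne
    have h := hpos _ hne
    rw [map_sub g, sub_apply, hΓ, hΓ, hdg _ u v] at h
    linarith
  -- The hypotheses involve plain derivatives of `J`; the identities required involve `∇J`.
  -- Compatibility of `Γ` with the metric turns `hDg` into skewness of `∇_u J`. In the cyclic sum
  -- and in the Nijenhuis identity the Christoffel terms cancel because `Γ` is torsion-free.
  have key : ∀ w, Φ u v w = 0 := by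
    refine fun w => eq_zero_of_closed_of_integrable J Φ ?_ ?_ ?_ ?_ ?_ u v w
    · intro u v w
      simp only [Φ, hJ, map_neg]
    · intro u v w
      have h := hDg u v w
      rw [hΦ, hΦ, hΓ, hΓ, hΓ, hΓ]
      rw [hg v] at h
      rw [hdg u (J w) v, hdg u w (J v), hdg (J v) u w, hdg v u (J w), hdg (J w) u v,
        hdg w u (J v)]
      linarith [hdg (J v) w u, hdg v (J w) u, hdg (J w) v u, hdg w (J v) u, hdg u (J w) v]
    · intro u v w
      have h := hDJ u v
      have h1 : Φ u v (J w) = -g (J (DJ u v + Γ u (J v) - J (Γ u v))) w := by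
        simp only [Φ]
        rw [hJg]; ring
      rw [h1]
      simp only [Φ]
      rw [← neg_apply, ← map_neg]
      congr 2
      rw [eq_neg_of_add_eq_zero_left h, hJ]
      simp only [map_add, map_sub, hJ, map_neg]
      abel
    · intro u v w
      have h := hclosed u v w
      rw [hΦ, hΦ, hΦ]
      simp only [hΓ]
      linarith [hdg u (J v) w, hdg u w (J v), hdg v (J w) u, hdg v u (J w), hdg w (J u) v,
        hdg w v (J u), hdg (J u) w v, hdg (J u) v w, hdg (J v) u w, hdg (J v) w u, hdg (J w) u v,
        hdg (J w) v u]
    · intro u v w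
      have h := congrArg (fun a => g a w) (hint u v)
      simp only [map_add, map_sub, map_zero, zero_apply, add_apply, sub_apply, hJg] at h
      have e1 := hsymm u v
      have e2 := hsymm (J u) (J v)
      have e3 := hsymm (J u) v
      have e4 := hsymm (J v) u
      simp only [hΦ, hJ, map_neg]
      rw [e1, e2, e3, e4]
      linarith
  by_contra hne
  have := hpos _ hne
  have h2 := key (DJ u v + Γ u (J v) - J (Γ u v))
  simp only [Φ] at h2
  linarith

end Parallel

/-! ### From the Kähler conditions to `∇J = 0`, in the chart at a point. -/

section KaehlerParallel

variable {E : Type*} [NormedAddCommGroup E] [NormedSpace ℝ E]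
  {N : Type*} [TopologicalSpace N] [ChartedSpace E N]
  {G G' : Type*} [NormedAddCommGroup G] [NormedSpace ℝ G] [NormedAddCommGroup G']
  [NormedSpace ℝ G']

theorem hasMFDerivAt_clm_apply {A : N → G →L[ℝ] G'} {p : N}
    (hA : MDifferentiableAt 𝓘(ℝ, E) 𝓘(ℝ, G →L[ℝ] G') A p) (v : G) :
    HasMFDerivAt 𝓘(ℝ, E) 𝓘(ℝ, G') (fun x => A x v) p
      ((mder E (G →L[ℝ] G') A p).flip v) :=
  HasMFDerivAt.comp p (hasMFDerivAt_of_hasFDerivAt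
    (ContinuousLinearMap.apply ℝ G' v).hasFDerivAt) (hasMFDerivAt_mder hA)

theorem mder_clm_apply {A : N → G →L[ℝ] G'} {p : N}
    (hA : MDifferentiableAt 𝓘(ℝ, E) 𝓘(ℝ, G →L[ℝ] G') A p) (v : G) (u : E) :
    mder E G' (fun x => A x v) p u = mder E (G →L[ℝ] G') A p u v := by
  rw [mder_eq_of_hasMFDerivAt (hasMFDerivAt_clm_apply hA v), ContinuousLinearMap.flip_apply]

theorem mder_const_fun {c : G} (p : N) : mder E G (fun _ : N => c) p = 0 :=
  mder_eq_of_hasMFDerivAt (hasMFDerivAt_const c p)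

variable [IsManifold 𝓘(ℝ, E) ∞ N]

/-- Product rule for composition. -/
theorem mder_clm_comp {G'' : Type*} [NormedAddCommGroup G''] [NormedSpace ℝ G'']
    {A : N → G' →L[ℝ] G''} {B : N → G →L[ℝ] G'} {p : N}
    (hA : MDifferentiableAt 𝓘(ℝ, E) 𝓘(ℝ, G' →L[ℝ] G'') A p)
    (hB : MDifferentiableAt 𝓘(ℝ, E) 𝓘(ℝ, G →L[ℝ] G') B p) :
    MDifferentiableAt 𝓘(ℝ, E) 𝓘(ℝ, G →L[ℝ] G'') (fun x => A x ∘L B x) p ∧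
    ∀ u : E, mder E (G →L[ℝ] G'') (fun x => A x ∘L B x) p u =
      A p ∘L mder E (G →L[ℝ] G') B p u + mder E (G' →L[ℝ] G'') A p u ∘L B p := by
  have h1 := hA.prodMk_space hB
  have h2 : HasFDerivAt (fun q : (G' →L[ℝ] G'') × (G →L[ℝ] G') => q.1 ∘L q.2) _ (A p, B p) :=
    hasFDerivAt_fst.clm_comp hasFDerivAt_snd
  have h3 : MDifferentiableAt 𝓘(ℝ, E) 𝓘(ℝ, G →L[ℝ] G'') (fun x => A x ∘L B x) p :=
    (HasMFDerivAt.comp p (f := fun x => (A x, B x)) h2.hasMFDerivAt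
      h1.hasMFDerivAt).mdifferentiableAt
  refine ⟨h3, fun u => ?_⟩
  have hps := mem_chart_source E p
  have h4 := (differentiableAt_comp_chart_symm hps hA).hasFDerivAt.clm_comp
    (differentiableAt_comp_chart_symm hps hB).hasFDerivAt
  rw [mder_eq_fderiv_chart h3, mder_eq_fderiv_chart hA, mder_eq_fderiv_chart hB, h4.fderiv]
  simp [(chartAt E p).left_inv hps]

/-- The value at `x` of a field of endomorphisms, as an endomorphism of the model space. -/
def endAt (J : ∀ x : N, Tan E x →L[ℝ] Tan E x) (x : N) : E →L[ℝ] E := J x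

/-- A field of endomorphisms in the chart at `p`. -/
def endInChart (J : ∀ x : N, Tan E x →L[ℝ] Tan E x) (p x : N) : E →L[ℝ] E :=
  toChart E p x ∘L endAt J x ∘L ofChart E p x

variable {g : RMetric E N} {J : ∀ x : N, Tan E x →L[ℝ] Tan E x}

theorem endInChart_self (J : ∀ x : N, Tan E x →L[ℝ] Tan E x) (p : N) :
    endInChart J p p = endAt J p := by
  ext v
  simp only [endInChart, ContinuousLinearMap.comp_apply, toChart_self, ofChart_self]

theorem endAt_endAt (hJ : IsAlmostHermitian g J) (x : N) (v : E) :
    endAt J x (endAt J x v) = -v := hJ.sq x v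

theorem metricAt_endAt (hJ : IsAlmostHermitian g J) (x : N) (u v : E) :
    metricAt g x (endAt J x u) (endAt J x v) = metricAt g x u v := hJ.orth x u v

theorem metricAt_endAt_left (hJ : IsAlmostHermitian g J) (x : N) (u v : E) :
    metricAt g x (endAt J x u) v = -metricAt g x u (endAt J x v) := by
  have := metricAt_endAt hJ x u (endAt J x v)
  rw [endAt_endAt hJ, map_neg] at this
  linarith

theorem IsAlmostHermitian.contMDiffAt_endInChart (hJ : IsAlmostHermitian g J) (p : N) :
    ContMDiffAt 𝓘(ℝ, E) 𝓘(ℝ, E →L[ℝ] E) ∞ (endInChart J p) p := by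
  have : IsManifold 𝓘(ℝ, E) 1 N := isManifold_one
  exact ((contMDiffAt_hom_bundle _).1 (hJ.smooth p)).2

variable [FiniteDimensional ℝ E]

/-- The Christoffel symbols as a bilinear map. -/
def christoffelL (g : RMetric E N) (p : N) : E →L[ℝ] E →L[ℝ] E :=
  LinearMap.toContinuousLinearMap
    { toFun := fun u => christoffel g p u
      map_add' := fun a b => by simp only [christoffel, map_add]; ext; simp; module
      map_smul' := fun a b => by simp only [christoffel, map_smul]; ext; simp; module }

/-- The complex structure of a Kähler manifold is parallel. -/
theorem IsKaehler.parallel (hJ : IsKaehler g J) (p : N) (u : E) :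
    mder E (E →L[ℝ] E) (endInChart J p) p u + christoffel g p u ∘L endAt J p -
      endAt J p ∘L christoffel g p u = 0 := by
  have hah := hJ.toIsAlmostHermitian
  have hps := mem_chart_source E p
  have hsrc : ∀ᶠ x in 𝓝 p, x ∈ (chartAt E p).source :=
    (chartAt E p).open_source.mem_nhds hps
  have hsm := hah.contMDiffAt_endInChart p
  have hdiff := hsm.mdifferentiableAt (by simp)
  -- constant fields
  let c : E → N → E := fun u x => ofChart E p x u
  let jc : E → N → E := fun u x => endAt J x (ofChart E p x u)
  have hc0 : ∀ u, (fun x => toChart E p x (c u x)) =ᶠ[𝓝 p] fun _ => u := fun u => by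
    filter_upwards [hsrc] with x hx using toChart_ofChart hx u
  have hcp : ∀ u, c u p = u := fun u => ofChart_self p u
  have hjp : ∀ u, jc u p = endAt J p u := fun u => by simp only [jc, ofChart_self]
  have hjc : ∀ u, (fun x => toChart E p x (jc u x)) = fun x => endInChart J p x u := fun u => rfl
  have hcs : ∀ u, SmoothFieldAt (c u) p := fun u => smoothFieldAt_ofChart hps u
  have hcd : ∀ u, MDifferentiableAt 𝓘(ℝ, E) 𝓘(ℝ, E) (fun x => toChart E p x (c u x)) p :=
    fun u => ((contMDiffAt_toChart hps).1 (hcs u)).mdifferentiableAt (by simp)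
  have hjd : ∀ u, MDifferentiableAt 𝓘(ℝ, E) 𝓘(ℝ, E) (fun x => toChart E p x (jc u x)) p :=
    fun u => (hasMFDerivAt_clm_apply hdiff u).mdifferentiableAt
  have hcm : ∀ u, mder E E (fun x => toChart E p x (c u x)) p = 0 := fun u => by
    rw [mder_congr (hc0 u), mder_const_fun]
  have hjm : ∀ u a, mder E E (fun x => toChart E p x (jc u x)) p a =
      mder E (E →L[ℝ] E) (endInChart J p) p a u := fun u a => mder_clm_apply hdiff u a
  set D := mder E (E →L[ℝ] E) (endInChart J p) p with hD
  set dg := fderiv ℝ (metricInChart g p) (chartAt E p p) with hdg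
  ext v
  refine parallel_of_kaehler_identities (metricAt g p) (metricAt_symm g p)
    (fun v hv => metricAt_pos g p hv) (endAt J p) (endAt_endAt hah p) (metricAt_endAt_left hah p)
    dg (fderiv_metricInChart_symm g p) (christoffelL g p) D ?_ ?_ ?_ ?_ ?_ u v
  · intro u v w
    rw [← metricInChart_self]
    exact inner_christoffel g p u v w
  · intro u v
    -- Differentiate `J² = -1`.
    obtain ⟨-, h1⟩ := mder_clm_comp hdiff hdiff
    have h2 : (fun x => endInChart J p x ∘L endInChart J p x) =ᶠ[𝓝 p]
        fun _ => -ContinuousLinearMap.id ℝ E := by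
      filter_upwards [hsrc] with x hx
      ext v
      simp only [endInChart, ContinuousLinearMap.comp_apply, ofChart_toChart hx, endAt_endAt hah,
        map_neg, toChart_ofChart hx, neg_apply, ContinuousLinearMap.id_apply]
    have h3 := h1 u
    rw [mder_congr h2, mder_const_fun, endInChart_self] at h3
    have h4 := DFunLike.congr_fun h3 v
    simp only [zero_apply, add_apply, ContinuousLinearMap.comp_apply] at h4
    rw [add_comm]
    exact h4.symm
  · intro a u v
    -- Differentiate `g(J u, v) = -g(u, J v)` for fields constant in the chart.
    have h1 := mder_metricAt g (hjd u) (hcd v) a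
    have h2 := mder_metricAt g (hcd u) (hjd v) a
    have h3 : (fun x => metricAt g x (jc u x) (c v x)) =
        fun x => -metricAt g x (c u x) (jc v x) := by
      ext x
      exact metricAt_endAt_left hah x _ _
    have h4 : mder E ℝ (fun x => -metricAt g x (c u x) (jc v x)) p =
        -mder E ℝ (fun x => metricAt g x (c u x) (jc v x)) p :=
      mfderiv_neg
    rw [h3, h4, neg_apply, h2] at h1
    simp only [hjp, hcp, hcm, hjm, zero_apply, map_zero, add_zero] at h1
    exact h1.symm
  · intro u v w
    -- Fields constant in the chart commute, so the three bracket terms of `dω` drop out.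
    have h := hJ.closed p (c u) (c v) (c w) (hcs u) (hcs v) (hcs w)
    have h1 : mder E ℝ (fun x => metricAt g x (jc v x) (c w x)) p (c u p) +
        mder E ℝ (fun x => metricAt g x (jc w x) (c u x)) p (c v p) +
        mder E ℝ (fun x => metricAt g x (jc u x) (c v x)) p (c w p) -
        metricAt g p (endAt J p (brak (c u) (c v) p)) (c w p) -
        metricAt g p (endAt J p (brak (c v) (c w) p)) (c u p) -
        metricAt g p (endAt J p (brak (c w) (c u) p)) (c v p) = 0 := h
    rw [brak_eq (hcd u) (hcd v), brak_eq (hcd v) (hcd w), brak_eq (hcd w) (hcd u),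
      mder_metricAt g (hjd v) (hcd w), mder_metricAt g (hjd w) (hcd u),
      mder_metricAt g (hjd u) (hcd v)] at h1
    simp only [hjp, hcp, hcm, hjm, zero_apply, map_zero, add_zero, sub_zero] at h1
    exact h1
  · intro u v
    -- On fields constant in the chart the brackets contain only derivatives of `J`.
    have h := hJ.integrable p (c u) (c v) (hcs u) (hcs v)
    have h1 : brak (jc u) (jc v) p - endAt J p (brak (jc u) (c v) p) -
        endAt J p (brak (c u) (jc v) p) - brak (c u) (c v) p = 0 := h
    rw [brak_eq (hcd u) (hcd v), brak_eq (hjd u) (hcd v), brak_eq (hcd u) (hjd v),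
      brak_eq (hjd u) (hjd v)] at h1
    simp only [hjp, hcp, hcm, hjm, zero_apply, sub_zero, zero_sub, map_neg,
      sub_neg_eq_add] at h1
    exact h1

end KaehlerParallel

/-! ### Sections that are horizontal for a metric of Kaluza-Klein type are totally geodesic -/

section Horizontal

variable {V W S : Type*} [NormedAddCommGroup V] [NormedSpace ℝ V] [NormedAddCommGroup W]
  [NormedSpace ℝ W] [NormedAddCommGroup S] [NormedSpace ℝ S]

/-- A section `f` of a submersion `π`, horizontal in the sense that `φ` vanishes on its tangent
spaces, is totally geodesic for the metric `π^* g + B(φ, φ)`. -/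
theorem totallyGeodesic_of_horizontal {f : V → W} {π : W → V} {gm : V → V →L[ℝ] V →L[ℝ] ℝ}
    {hm : W → W →L[ℝ] W →L[ℝ] ℝ} {φ : W → W →L[ℝ] S} {B : S →L[ℝ] S →L[ℝ] ℝ} {x₀ : V}
    (hf : ContDiffAt ℝ 2 f x₀) (hπ : ContDiffAt ℝ 2 π (f x₀)) (hg : DifferentiableAt ℝ gm x₀)
    (hgs : ∀ u v, gm x₀ u v = gm x₀ v u)
    (hφ : DifferentiableAt ℝ φ (f x₀)) (hπf : ∀ᶠ x in 𝓝 x₀, π (f x) = x)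
    (hh : ∀ᶠ y in 𝓝 (f x₀), ∀ w w', hm y w w' =
      gm (π y) (fderiv ℝ π y w) (fderiv ℝ π y w') + B (φ y w) (φ y w'))
    (hhd : DifferentiableAt ℝ hm (f x₀))
    (hpar : ∀ᶠ x in 𝓝 x₀, ∀ u, φ (f x) (fderiv ℝ f x u) = 0)
    {Γg : V → V → V} (hΓg : ∀ u v w, gm x₀ (Γg u v) w =
      (1 / 2) * (fderiv ℝ gm x₀ u v w + fderiv ℝ gm x₀ v u w - fderiv ℝ gm x₀ w u v))
    {Γh : W → W → W} (hΓh : ∀ u v w, hm (f x₀) (Γh u v) w =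
      (1 / 2) * (fderiv ℝ hm (f x₀) u v w + fderiv ℝ hm (f x₀) v u w - fderiv ℝ hm (f x₀) w u v))
    (u v : V) (w : W) :
    hm (f x₀) (fderiv ℝ (fderiv ℝ f) x₀ u v + Γh (fderiv ℝ f x₀ u) (fderiv ℝ f x₀ v) -
      fderiv ℝ f x₀ (Γg u v)) w = 0 := by
  have hfd : DifferentiableAt ℝ f x₀ := hf.differentiableAt (by simp)
  have hπd : DifferentiableAt ℝ π (f x₀) := hπ.differentiableAt (by simp)
  have hf2 : DifferentiableAt ℝ (fderiv ℝ f) x₀ :=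
    (hf.fderiv_right (m := 1) (by norm_num)).differentiableAt (by simp)
  have hπ2 : DifferentiableAt ℝ (fderiv ℝ π) (f x₀) :=
    (hπ.fderiv_right (m := 1) (by norm_num)).differentiableAt (by simp)
  have hfs : ∀ a b, fderiv ℝ (fderiv ℝ f) x₀ a b = fderiv ℝ (fderiv ℝ f) x₀ b a :=
    fun a b => (hf.isSymmSndFDerivAt (by simp)) a b
  have hπs : ∀ a b, fderiv ℝ (fderiv ℝ π) (f x₀) a b = fderiv ℝ (fderiv ℝ π) (f x₀) b a :=
    fun a b => (hπ.isSymmSndFDerivAt (by simp)) a b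
  have hx0 : π (f x₀) = x₀ := hπf.self_of_nhds
  -- first derivative of `π ∘ f = id`
  have e1 : ∀ᶠ x in 𝓝 x₀, ∀ a, fderiv ℝ π (f x) (fderiv ℝ f x a) = a := by
    have c1 : ∀ᶠ x in 𝓝 x₀, DifferentiableAt ℝ f x :=
      (hf.eventually (by simp)).mono fun x hx => hx.differentiableAt (by simp)
    have c2 : ∀ᶠ x in 𝓝 x₀, DifferentiableAt ℝ π (f x) :=
      hfd.continuousAt.eventually
        ((hπ.eventually (by simp)).mono fun x hx => hx.differentiableAt (by simp))
    filter_upwards [hπf.eventually_nhds, c1, c2] with x h1 h2 h3 a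
    have h4 := (h3.hasFDerivAt.comp x h2.hasFDerivAt).fderiv
    have h5 : fderiv ℝ (π ∘ f) x = ContinuousLinearMap.id ℝ V := by
      refine Eq.trans (Filter.EventuallyEq.fderiv_eq ?_) fderiv_id
      exact h1
    rw [h5] at h4
    exact (DFunLike.congr_fun h4 a).symm
  -- second derivative of `π ∘ f = id`
  have e2 : ∀ a b, fderiv ℝ (fderiv ℝ π) (f x₀) (fderiv ℝ f x₀ a) (fderiv ℝ f x₀ b) +
      fderiv ℝ π (f x₀) (fderiv ℝ (fderiv ℝ f) x₀ a b) = 0 := by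
    intro a b
    have h1 := (hπ2.hasFDerivAt.comp x₀ hfd.hasFDerivAt).clm_apply
      (hf2.hasFDerivAt.clm_apply (hasFDerivAt_const b x₀))
    have h2 : (fun x => (fderiv ℝ π ∘ f) x (fderiv ℝ f x b)) =ᶠ[𝓝 x₀] fun _ => b := by
      filter_upwards [e1] with x hx using hx b
    have h3 := DFunLike.congr_fun (h1.fderiv.symm.trans (h2.fderiv_eq.trans (fderiv_const_apply b)))
      a
    simpa [add_comm] using h3
  -- Differentiate `φ(f x)(df_x b) = 0` along the section. This is where horizontality is needed on
  -- a neighbourhood and not only at `x₀`.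
  have e3 : ∀ a b, fderiv ℝ φ (f x₀) (fderiv ℝ f x₀ a) (fderiv ℝ f x₀ b) +
      φ (f x₀) (fderiv ℝ (fderiv ℝ f) x₀ a b) = 0 := by
    intro a b
    have h1 := (hφ.hasFDerivAt.comp x₀ hfd.hasFDerivAt).clm_apply
      (hf2.hasFDerivAt.clm_apply (hasFDerivAt_const b x₀))
    have h2 : (fun x => (φ ∘ f) x (fderiv ℝ f x b)) =ᶠ[𝓝 x₀] fun _ => 0 := by
      filter_upwards [hpar] with x hx using hx b
    have h3 := DFunLike.congr_fun (h1.fderiv.symm.trans (h2.fderiv_eq.trans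
      (fderiv_const_apply (0 : S)))) a
    simpa [add_comm] using h3
  have p0 : ∀ a, φ (f x₀) (fderiv ℝ f x₀ a) = 0 := hpar.self_of_nhds
  have i0 : ∀ a, fderiv ℝ π (f x₀) (fderiv ℝ f x₀ a) = a := e1.self_of_nhds
  have m0 : ∀ a b, hm (f x₀) a b = gm x₀ (fderiv ℝ π (f x₀) a) (fderiv ℝ π (f x₀) b) +
      B (φ (f x₀) a) (φ (f x₀) b) := by
    have := hh.self_of_nhds
    rwa [hx0] at this
  -- the derivative of the metric
  have m1 : ∀ a b c, fderiv ℝ hm (f x₀) a b c =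
      fderiv ℝ gm x₀ (fderiv ℝ π (f x₀) a) (fderiv ℝ π (f x₀) b) (fderiv ℝ π (f x₀) c) +
      gm x₀ (fderiv ℝ (fderiv ℝ π) (f x₀) a b) (fderiv ℝ π (f x₀) c) +
      gm x₀ (fderiv ℝ π (f x₀) b) (fderiv ℝ (fderiv ℝ π) (f x₀) a c) +
      B (fderiv ℝ φ (f x₀) a b) (φ (f x₀) c) + B (φ (f x₀) b) (fderiv ℝ φ (f x₀) a c) := by
    intro a b c
    have hπb : ∀ b, HasFDerivAt (fun y => fderiv ℝ π y b) _ (f x₀) := fun b =>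
      hπ2.hasFDerivAt.clm_apply (hasFDerivAt_const b _)
    have hφb : ∀ b, HasFDerivAt (fun y => φ y b) _ (f x₀) := fun b =>
      hφ.hasFDerivAt.clm_apply (hasFDerivAt_const b _)
    have hg' : HasFDerivAt gm (fderiv ℝ gm x₀) (π (f x₀)) := by rw [hx0]; exact hg.hasFDerivAt
    have h1 := (((hg'.comp (f x₀) hπd.hasFDerivAt).clm_apply (hπb b)).clm_apply (hπb c)).add
      (((B.hasFDerivAt (x := φ (f x₀) b)).comp (f x₀) (hφb b)).clm_apply (hφb c))
    have h2 := (hhd.hasFDerivAt.clm_apply (hasFDerivAt_const b _)).clm_apply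
      (hasFDerivAt_const c _)
    have h3 : (fun y => hm y b c) =ᶠ[𝓝 (f x₀)] _ := hh.mono fun y hy => hy b c
    have h4 := DFunLike.congr_fun (h2.fderiv.symm.trans (h3.fderiv_eq.trans h1.fderiv)) a
    simp [hx0] at h4
    rw [h4]
    ring
  -- `q2` and `q3`, paired with `φ(w)` and each taken with weight `1/2`, cancel the terms in `B`;
  -- `q3` uses the symmetry of `D²f`. The terms with `φ(f_* u)` or `φ(f_* v)` undifferentiated are
  -- zero, among them the whole `B` part of the derivative in the direction `w`. On the `g` side,
  -- `q1` removes `D²π(f_* u, f_* v)`, the terms `D²π(·, w)` cancel in pairs, and the derivative of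
  -- `g` is matched by `Γg`.
  have q1 := e2 u v
  have q2 := e3 u v
  have q3 := e3 v u
  rw [hfs v u] at q3
  have k1 := congrArg (fun s => gm x₀ s (fderiv ℝ π (f x₀) w)) q1
  have k2 := congrArg (fun s => B s (φ (f x₀) w)) q2
  have k3 := congrArg (fun s => B s (φ (f x₀) w)) q3
  simp only [map_add, add_apply, map_zero, zero_apply] at k1 k2 k3
  rw [map_sub, map_add, sub_apply, add_apply, hΓh]
  simp only [m0, m1, i0, p0, map_zero, zero_apply, add_zero]
  rw [hΓg, hπs _ (fderiv ℝ f x₀ u), hπs _ (fderiv ℝ f x₀ v), hπs w, hπs w,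
    hgs u (fderiv ℝ (fderiv ℝ π) (f x₀) (fderiv ℝ f x₀ v) w)]
  rw [hπs (fderiv ℝ f x₀ v) (fderiv ℝ f x₀ u)]
  have hgs1 := hgs v (fderiv ℝ (fderiv ℝ π) (f x₀) (fderiv ℝ f x₀ u) w)
  linarith

end Horizontal

/-! ### Orthonormal frames and their connection matrices -/

section Smoothness

variable {E : Type*} [NormedAddCommGroup E] [NormedSpace ℝ E]
  {N : Type*} [TopologicalSpace N] [ChartedSpace E N]

theorem contMDiffOn_clm {V G : Type*} [NormedAddCommGroup V] [NormedSpace ℝ V]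
    [FiniteDimensional ℝ V] [NormedAddCommGroup G] [NormedSpace ℝ G] [FiniteDimensional ℝ G]
    {f : N → V →L[ℝ] G} {s : Set N}
    (h : ∀ v, ContMDiffOn 𝓘(ℝ, E) 𝓘(ℝ, G) ∞ (fun x => f x v) s) :
    ContMDiffOn 𝓘(ℝ, E) 𝓘(ℝ, V →L[ℝ] G) ∞ f s := by
  let b := Module.finBasis ℝ V
  let L : (Fin (Module.finrank ℝ V) → G) →ₗ[ℝ] (V →L[ℝ] G) :=
    (LinearMap.toContinuousLinearMap (𝕜 := ℝ) (E := V) (F' := G)).toLinearMap ∘ₗ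
      (b.constr ℝ).toLinearMap
  have hf : f = fun x => L.toContinuousLinearMap (fun i => f x (b i)) := by
    funext x
    refine ContinuousLinearMap.coe_injective (b.ext fun i => ?_)
    simp [L]
  rw [hf]
  refine (L.toContinuousLinearMap.contDiff (n := ∞)).contMDiff.comp_contMDiffOn ?_
  rw [contMDiffOn_pi_space]
  exact fun i => h (b i)

theorem contMDiffOn_of_inner {V : Type*} [NormedAddCommGroup V] [InnerProductSpace ℝ V]
    [FiniteDimensional ℝ V] {f : N → V} {s : Set N}
    (h : ∀ v, ContMDiffOn 𝓘(ℝ, E) 𝓘(ℝ, ℝ) ∞ (fun x => ⟪f x, v⟫) s) :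
    ContMDiffOn 𝓘(ℝ, E) 𝓘(ℝ, V) ∞ f s := by
  let b := stdOrthonormalBasis ℝ V
  let L : (Fin (Module.finrank ℝ V) → ℝ) →ₗ[ℝ] V := b.toBasis.equivFun.symm.toLinearMap
  have hf : f = fun x => L.toContinuousLinearMap (fun i => ⟪f x, b i⟫) := by
    funext x
    conv_lhs => rw [← b.sum_repr' (f x)]
    simp only [LinearMap.coe_toContinuousLinearMap', L, LinearEquiv.coe_coe,
      Module.Basis.equivFun_symm_apply, OrthonormalBasis.coe_toBasis, real_inner_comm]
  rw [hf]
  refine (L.toContinuousLinearMap.contDiff (n := ∞)).contMDiff.comp_contMDiffOn ?_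
  rw [contMDiffOn_pi_space]
  exact fun i => h (b i)

variable [IsManifold 𝓘(ℝ, E) ∞ N] [FiniteDimensional ℝ E]

theorem contMDiffOn_brak {X Y : N → E} {s : Set N} (hs : IsOpen s)
    (hX : ContMDiffOn 𝓘(ℝ, E) (𝓘(ℝ, E).prod 𝓘(ℝ, E)) ∞
      (fun x => (⟨x, X x⟩ : TangentBundle 𝓘(ℝ, E) N)) s)
    (hY : ContMDiffOn 𝓘(ℝ, E) (𝓘(ℝ, E).prod 𝓘(ℝ, E)) ∞
      (fun x => (⟨x, Y x⟩ : TangentBundle 𝓘(ℝ, E) N)) s) :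
    ContMDiffOn 𝓘(ℝ, E) (𝓘(ℝ, E).prod 𝓘(ℝ, E)) ∞
      (fun x => (⟨x, brak (M := N) (E := E) X Y x⟩ : TangentBundle 𝓘(ℝ, E) N)) s := by
  intro x hx
  -- Over `ℝ` the function `minSmoothness` changes nothing, and `∞ + 1 = ∞`, so taking a bracket
  -- costs no regularity.
  have hm2 : IsManifold 𝓘(ℝ, E) (minSmoothness ℝ 2) N := by
    rw [minSmoothness_of_isRCLikeNormedField]; infer_instance
  have hm3 : IsManifold 𝓘(ℝ, E) (minSmoothness ℝ 3) N := by
    rw [minSmoothness_of_isRCLikeNormedField]; infer_instance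
  have hc : CompleteSpace E := FiniteDimensional.complete ℝ E
  have hm : IsManifold 𝓘(ℝ, E) (((⊤ : ℕ∞) : WithTop ℕ∞) + 1) N :=
    inferInstanceAs (IsManifold 𝓘(ℝ, E) ∞ N)
  refine ContMDiffAt.contMDiffWithinAt ?_
  exact ContMDiffAt.mlieBracket_vectorField (m := (⊤ : ℕ∞)) (n := (⊤ : ℕ∞))
    (hX.contMDiffAt (hs.mem_nhds hx)) (hY.contMDiffAt (hs.mem_nhds hx)) (by simp)

end Smoothness

/-! ### The Levi-Civita connection in an orthonormal frame. -/

namespace OrthoFrame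

variable {E : Type*} [NormedAddCommGroup E] [NormedSpace ℝ E]
  {N : Type*} [TopologicalSpace N] [ChartedSpace E N] [IsManifold 𝓘(ℝ, E) ∞ N]
  {g : RMetric E N} (F : OrthoFrame g)

/-- The frame as a map to the model space. -/
def fr (x : N) : Std (halfDim E) →L[ℝ] E := (F.frame x : Std (halfDim E) →L[ℝ] Tan E x)

/-- The inverse of the frame as a map from the model space. -/
def frInv (x : N) : E →L[ℝ] Std (halfDim E) := ((F.frame x).symm : Tan E x →L[ℝ] Std (halfDim E))

theorem fr_frInv (x : N) (v : E) : F.fr x (F.frInv x v) = v := (F.frame x).apply_symm_apply v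

theorem frInv_fr (x : N) (v : Std (halfDim E)) : F.frInv x (F.fr x v) = v :=
  (F.frame x).symm_apply_apply v

theorem metricAt_fr {x : N} (hx : x ∈ F.dom) (u v : Std (halfDim E)) :
    metricAt g x (F.fr x u) (F.fr x v) = ⟪u, v⟫ := F.isometry x hx u v

theorem inner_frInv {x : N} (hx : x ∈ F.dom) (u : E) (v : Std (halfDim E)) :
    ⟪F.frInv x u, v⟫ = metricAt g x u (F.fr x v) := by
  rw [← F.metricAt_fr hx, F.fr_frInv]

/-- The frame in the chart at `q`. -/
def frChart (q x : N) : Std (halfDim E) →L[ℝ] E := toChart E q x ∘L F.fr x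

/-- The inverse of the frame in the chart at `q`. -/
def frChartInv (q x : N) : E →L[ℝ] Std (halfDim E) := F.frInv x ∘L ofChart E q x

theorem frChartInv_frChart {q x : N} (hx : x ∈ (chartAt E q).source) :
    F.frChartInv q x ∘L F.frChart q x = ContinuousLinearMap.id ℝ _ := by
  ext v
  simp only [frChart, frChartInv, ContinuousLinearMap.comp_apply, ofChart_toChart hx, F.frInv_fr,
    ContinuousLinearMap.id_apply]

theorem frChart_self (q : N) : F.frChart q q = F.fr q := by
  ext v; simp only [frChart, ContinuousLinearMap.comp_apply, toChart_self]

theorem frChartInv_self (q : N) : F.frChartInv q q = F.frInv q := by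
  ext v; simp only [frChartInv, ContinuousLinearMap.comp_apply, ofChart_self]

variable [FiniteDimensional ℝ E]

theorem contMDiffOn_frChart (q : N) :
    ContMDiffOn 𝓘(ℝ, E) 𝓘(ℝ, Std (halfDim E) →L[ℝ] E) ∞ (F.frChart q)
      (F.dom ∩ (chartAt E q).source) := by
  refine contMDiffOn_clm fun v => ?_
  exact (contMDiffOn_toChart (Y := fun x => F.frame x v)
    (F.isOpen_dom.inter (chartAt E q).open_source) Set.inter_subset_right).1
    ((F.smooth v).mono Set.inter_subset_left)

/-- For an orthonormal frame the inverse is the adjoint: its coefficients are the products `g(u, F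
v)`, so no matrix has to be inverted. -/
theorem contMDiffOn_frChartInv (q : N) :
    ContMDiffOn 𝓘(ℝ, E) 𝓘(ℝ, E →L[ℝ] Std (halfDim E)) ∞ (F.frChartInv q)
      (F.dom ∩ (chartAt E q).source) := by
  refine contMDiffOn_clm fun u => contMDiffOn_of_inner fun v => ?_
  have h : ContMDiffOn 𝓘(ℝ, E) (𝓘(ℝ, E).prod 𝓘(ℝ, E)) ∞
      (fun x => (⟨x, ofChart E q x u⟩ : TangentBundle 𝓘(ℝ, E) N))
      (F.dom ∩ (chartAt E q).source) := fun x hx =>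
    ContMDiffAt.contMDiffWithinAt (smoothFieldAt_ofChart hx.2 u)
  refine (contMDiffOn_inner g h ((F.smooth v).mono Set.inter_subset_left)).congr fun x hx => ?_
  exact F.inner_frInv hx.1 _ v

theorem mdifferentiableAt_frChart {q x : N} (hx : x ∈ F.dom) (hq : x ∈ (chartAt E q).source) :
    MDifferentiableAt 𝓘(ℝ, E) 𝓘(ℝ, Std (halfDim E) →L[ℝ] E) (F.frChart q) x :=
  ((F.contMDiffOn_frChart q).contMDiffAt ((F.isOpen_dom.inter (chartAt E q).open_source).mem_nhds
    ⟨hx, hq⟩)).mdifferentiableAt (by simp)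

theorem mdifferentiableAt_frChartInv {q x : N} (hx : x ∈ F.dom)
    (hq : x ∈ (chartAt E q).source) :
    MDifferentiableAt 𝓘(ℝ, E) 𝓘(ℝ, E →L[ℝ] Std (halfDim E)) (F.frChartInv q) x :=
  ((F.contMDiffOn_frChartInv q).contMDiffAt
    ((F.isOpen_dom.inter (chartAt E q).open_source).mem_nhds
    ⟨hx, hq⟩)).mdifferentiableAt (by simp)

/-- The connection matrix of the frame: `conn x X v` is the expression in the frame of the
derivative of the field `v` of the frame in the direction `X`. -/
def conn (x : N) : E →L[ℝ] Std (halfDim E) →L[ℝ] Std (halfDim E) :=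
  ContinuousLinearMap.compL ℝ (Std (halfDim E)) E (Std (halfDim E)) (F.frInv x) ∘L
    (mder E (Std (halfDim E) →L[ℝ] E) (F.frChart x) x +
      (ContinuousLinearMap.compL ℝ (Std (halfDim E)) E E).flip (F.fr x) ∘L christoffelL g x)

theorem conn_apply (x : N) (X : E) (v : Std (halfDim E)) : F.conn x X v =
    F.frInv x (mder E (Std (halfDim E) →L[ℝ] E) (F.frChart x) x X v +
      christoffel g x X (F.fr x v)) := rfl

theorem inner_conn {x : N} (hx : x ∈ F.dom) (X : E) (v w : Std (halfDim E)) :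
    ⟪F.conn x X v, w⟫ =
      metricAt g x (mder E (Std (halfDim E) →L[ℝ] E) (F.frChart x) x X v) (F.fr x w) +
      (1 / 2) * (fderiv ℝ (metricInChart g x) (chartAt E x x) X (F.fr x v) (F.fr x w) +
        fderiv ℝ (metricInChart g x) (chartAt E x x) (F.fr x v) X (F.fr x w) -
        fderiv ℝ (metricInChart g x) (chartAt E x x) (F.fr x w) X (F.fr x v)) := by
  rw [conn_apply, F.inner_frInv hx, map_add, add_apply, ← inner_christoffel, metricInChart_self]

theorem mdifferentiableAt_frChart_apply {x : N} (hx : x ∈ F.dom) (v : Std (halfDim E)) :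
    MDifferentiableAt 𝓘(ℝ, E) 𝓘(ℝ, E) (fun y => toChart E x y (F.fr y v)) x :=
  (hasMFDerivAt_clm_apply (F.mdifferentiableAt_frChart hx (mem_chart_source E x))
    v).mdifferentiableAt

theorem mder_frChart_apply {x : N} (hx : x ∈ F.dom) (v : Std (halfDim E)) (X : E) :
    mder E E (fun y => toChart E x y (F.fr y v)) x X =
      mder E (Std (halfDim E) →L[ℝ] E) (F.frChart x) x X v :=
  mder_clm_apply (F.mdifferentiableAt_frChart hx (mem_chart_source E x)) v X

/-- The products of the fields of the frame are constant. -/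
theorem fderiv_metricInChart_fr {x : N} (hx : x ∈ F.dom) (X : E) (v w : Std (halfDim E)) :
    fderiv ℝ (metricInChart g x) (chartAt E x x) X (F.fr x v) (F.fr x w) +
      metricAt g x (mder E (Std (halfDim E) →L[ℝ] E) (F.frChart x) x X v) (F.fr x w) +
      metricAt g x (F.fr x v) (mder E (Std (halfDim E) →L[ℝ] E) (F.frChart x) x X w) = 0 := by
  have h := mder_metricAt g (F.mdifferentiableAt_frChart_apply hx v)
    (F.mdifferentiableAt_frChart_apply hx w) X
  have h2 : (fun y => metricAt g y (F.fr y v) (F.fr y w)) =ᶠ[𝓝 x] fun _ => ⟪v, w⟫ := by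
    filter_upwards [F.isOpen_dom.mem_nhds hx] with y hy using F.metricAt_fr hy v w
  rw [mder_congr h2, mder_const_fun, F.mder_frChart_apply hx, F.mder_frChart_apply hx] at h
  exact h.symm

/-- The connection is metric. When the two formulas `inner_conn` are added, the last two derivatives
of the metric cancel, and what remains is the derivative of the constant function `g(F v, F w)`. -/
theorem conn_skew {x : N} (hx : x ∈ F.dom) (X : E) (v w : Std (halfDim E)) :
    ⟪F.conn x X v, w⟫ = -⟪v, F.conn x X w⟫ := by
  rw [real_inner_comm (F.conn x X w) v, F.inner_conn hx, F.inner_conn hx]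
  have h := F.fderiv_metricInChart_fr hx X v w
  rw [metricAt_symm g x (F.fr x v)] at h
  linarith [fderiv_metricInChart_symm g x X (F.fr x v) (F.fr x w)]

/-- Koszul's formula for the fields of an orthonormal frame. -/
theorem inner_conn_fr {x : N} (hx : x ∈ F.dom) (u v w : Std (halfDim E)) :
    ⟪F.conn x (F.fr x u) v, w⟫ = (1 / 2) *
      (metricAt g x (brak (fun y => F.fr y u) (fun y => F.fr y v) x) (F.fr x w) -
        metricAt g x (brak (fun y => F.fr y v) (fun y => F.fr y w) x) (F.fr x u) +
        metricAt g x (brak (fun y => F.fr y w) (fun y => F.fr y u) x) (F.fr x v)) := by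
  have hd := fun v => F.mdifferentiableAt_frChart_apply hx v
  rw [F.inner_conn hx, brak_eq (hd u) (hd v), brak_eq (hd v) (hd w), brak_eq (hd w) (hd u)]
  simp only [F.mder_frChart_apply hx, map_sub, sub_apply]
  -- Orthonormality replaces each derivative of the metric coefficients by derivatives of the frame
  -- fields; the latter recombine into the three brackets.
  have h1 := F.fderiv_metricInChart_fr hx (F.fr x u) v w
  have h2 := F.fderiv_metricInChart_fr hx (F.fr x v) u w
  have h3 := F.fderiv_metricInChart_fr hx (F.fr x w) u v
  rw [metricAt_symm g x (F.fr x v)] at h1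
  rw [metricAt_symm g x (F.fr x u)] at h2
  rw [metricAt_symm g x (F.fr x u)] at h3
  linarith

/-- In the definition of `conn` the Christoffel symbols at `x` are taken in the chart at `x`, so the
definition does not display any regularity in `x`. Koszul's formula contains only brackets and
products of smooth fields. -/
theorem contMDiffOn_conn_fr :
    ContMDiffOn 𝓘(ℝ, E) 𝓘(ℝ, Std (halfDim E) →L[ℝ] Std (halfDim E) →L[ℝ] Std (halfDim E)) ∞
      (fun x => F.conn x ∘L F.fr x) F.dom := by
  refine contMDiffOn_clm fun u => contMDiffOn_end fun v w => ?_
  have hb : ∀ u v w, ContMDiffOn 𝓘(ℝ, E) 𝓘(ℝ, ℝ) ∞ (fun x =>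
      metricAt g x (brak (fun y => F.fr y u) (fun y => F.fr y v) x) (F.fr x w)) F.dom :=
    fun u v w => contMDiffOn_inner g (contMDiffOn_brak F.isOpen_dom (F.smooth u) (F.smooth v))
      (F.smooth w)
  refine ContMDiffOn.congr ?_ fun x hx => F.inner_conn_fr hx u v w
  exact contMDiffOn_const.mul (((hb u v w).sub (hb v w u)).add (hb w u v))

/-- The connection matrix in the chart at `q`. -/
theorem contMDiffOn_conn_ofChart (q : N) :
    ContMDiffOn 𝓘(ℝ, E) 𝓘(ℝ, E →L[ℝ] Std (halfDim E) →L[ℝ] Std (halfDim E)) ∞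
      (fun x => F.conn x ∘L ofChart E q x) (F.dom ∩ (chartAt E q).source) := by
  refine ((F.contMDiffOn_conn_fr.mono Set.inter_subset_left).clm_comp
    (F.contMDiffOn_frChartInv q)).congr fun x hx => ?_
  ext u v
  simp only [ContinuousLinearMap.comp_apply, frChartInv, F.fr_frInv]

end OrthoFrame

/-! ### The twistor space in its charts -/

section TwistorCharts

variable {E : Type*} [NormedAddCommGroup E] [NormedSpace ℝ E] [FiniteDimensional ℝ E]
  {N : Type*} [TopologicalSpace N] [ChartedSpace E N] [IsManifold 𝓘(ℝ, E) ∞ N]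
  {g : RMetric E N}

/-- The model space of the twistor space. -/
abbrev TwModel (E : Type*) [NormedAddCommGroup E] [NormedSpace ℝ E] : Type _ :=
  E × FModel (halfDim E)

/-- The complex structure of a point of the twistor space, as a matrix in the frame. -/
def OrthoFrame.matrix (F : OrthoFrame g) (z : TwistorSpace g) :
    Std (halfDim E) →L[ℝ] Std (halfDim E) := F.read z.base z.str

theorem twistorChart_apply (z₀ z : TwistorSpace g) : chartAt (TwModel E) z₀ z =
    (chartAt E (frameAt z₀).center z.base,
      projF (halfDim E) (cayleyInv ((frameAt z₀).matrix z))) := rfl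

theorem base_mem_dom {z₀ z : TwistorSpace g} (hz : z ∈ (chartAt (TwModel E) z₀).source) :
    z.base ∈ (frameAt z₀).dom := hz.1

theorem base_eq_of_mem {z₀ z : TwistorSpace g} (hz : z ∈ (chartAt (TwModel E) z₀).source) :
    z.base = (chartAt E (frameAt z₀).center).symm (chartAt (TwModel E) z₀ z).1 :=
  ((chartAt E (frameAt z₀).center).left_inv ((frameAt z₀).dom_subset hz.1)).symm

/-- The fibre coordinate is the inverse Cayley transform of the matrix, so on the chart domain the
matrix is recovered by the Cayley transform, which is smooth on the whole model space. -/
theorem matrix_eq_of_mem {z₀ z : TwistorSpace g} (hz : z ∈ (chartAt (TwModel E) z₀).source) :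
    (frameAt z₀).matrix z = cayley (inclF (halfDim E) (chartAt (TwModel E) z₀ z).2) := by
  have h := cayleyInv_mem ((frameAt z₀).isOrthoCplx_read z hz.1) hz.2
  rw [twistorChart_apply]
  change _ = cayley (inclF (halfDim E) (projF (halfDim E) (cayleyInv ((frameAt z₀).matrix z))))
  exact (congrArg cayley (inclF_projF h.1)).trans h.2 |>.symm

/-- The first component of a twistor chart is a chart of `N` composed with the projection, so in
these charts the projection is `Prod.fst`. -/
theorem contMDiffOn_base (z₀ : TwistorSpace g) :
    ContMDiffOn 𝓘(ℝ, TwModel E) 𝓘(ℝ, E) ∞ (TwistorSpace.base (g := g))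
      (chartAt (TwModel E) z₀).source := by
  have h1 : ContMDiffOn 𝓘(ℝ, TwModel E) 𝓘(ℝ, E) ∞
      (fun z : TwistorSpace g => (chartAt (TwModel E) z₀ z).1) (chartAt (TwModel E) z₀).source :=
    (contDiff_fst (n := ∞)).contMDiff.comp_contMDiffOn
      (contMDiffOn_chart (I := 𝓘(ℝ, TwModel E)) (n := ∞) (x := z₀))
  refine ((contMDiffOn_chart_symm (I := 𝓘(ℝ, E)) (n := ∞) (x := (frameAt z₀).center)).comp h1
    fun z hz => ?_).congr fun z hz => base_eq_of_mem hz
  exact (chartAt E (frameAt z₀).center).map_source ((frameAt z₀).dom_subset hz.1)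

theorem contMDiff_base : ContMDiff 𝓘(ℝ, TwModel E) 𝓘(ℝ, E) ∞ (TwistorSpace.base (g := g)) :=
  fun z => (contMDiffOn_base z).contMDiffAt
    ((chartAt (TwModel E) z).open_source.mem_nhds (mem_chart_source _ z))

theorem contMDiffOn_matrix (z₀ : TwistorSpace g) :
    ContMDiffOn 𝓘(ℝ, TwModel E) 𝓘(ℝ, Std (halfDim E) →L[ℝ] Std (halfDim E)) ∞
      (frameAt z₀).matrix (chartAt (TwModel E) z₀).source := by
  have h1 : ContMDiffOn 𝓘(ℝ, TwModel E) 𝓘(ℝ, Std (halfDim E) →L[ℝ] Std (halfDim E)) ∞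
      (fun z : TwistorSpace g => cayley (inclF (halfDim E) (chartAt (TwModel E) z₀ z).2))
      (chartAt (TwModel E) z₀).source :=
    ((contDiff_cayley (halfDim E)).comp contDiff_snd).contMDiff.comp_contMDiffOn
      (contMDiffOn_chart (I := 𝓘(ℝ, TwModel E)) (n := ∞) (x := z₀))
  exact h1.congr fun z hz => matrix_eq_of_mem hz

theorem mdifferentiableAt_base (z : TwistorSpace g) :
    MDifferentiableAt 𝓘(ℝ, TwModel E) 𝓘(ℝ, E) (TwistorSpace.base (g := g)) z :=
  (contMDiff_base z).mdifferentiableAt (by simp)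

theorem mdifferentiableAt_matrix {z₀ z : TwistorSpace g}
    (hz : z ∈ (chartAt (TwModel E) z₀).source) :
    MDifferentiableAt 𝓘(ℝ, TwModel E) 𝓘(ℝ, Std (halfDim E) →L[ℝ] Std (halfDim E))
      (frameAt z₀).matrix z :=
  ((contMDiffOn_matrix z₀).contMDiffAt
    ((chartAt (TwModel E) z₀).open_source.mem_nhds hz)).mdifferentiableAt (by simp)

/-- The differential of the projection to `N`. -/
def dBase (z : TwistorSpace g) : TwModel E →L[ℝ] E :=
  mder (TwModel E) E (TwistorSpace.base (g := g)) z

/-- The complex structure of a point of the twistor space on the model space. -/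
def strAt (z : TwistorSpace g) : E →L[ℝ] E := z.str

/-- The vertical part of a tangent vector, as a linear map. -/
def vert (z : TwistorSpace g) : TwModel E →L[ℝ] E →L[ℝ] E :=
  mder (TwModel E) (E →L[ℝ] E) (strInChart z.base) z +
    ((ContinuousLinearMap.compL ℝ E E E).flip (strAt z) -
      ContinuousLinearMap.compL ℝ E E E (strAt z)) ∘L christoffelL g z.base ∘L dBase z

theorem vert_apply (z : TwistorSpace g) (ξ : TwModel E) : vert z ξ =
    mder (TwModel E) (E →L[ℝ] E) (strInChart z.base) z ξ +
      (christoffel g z.base (dBase z ξ) ∘L strAt z -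
        strAt z ∘L christoffel g z.base (dBase z ξ)) := rfl

theorem verticalPart_eq_vert (z : TwistorSpace g) (ξ : TwModel E) :
    verticalPart z ξ = vert z ξ := by
  rw [vert_apply, ← add_sub_assoc]
  rfl

/-- The tautological complex structure in the chart at `q`, by means of a frame. -/
theorem OrthoFrame.strInChart_eq (F : OrthoFrame g) (q : N) :
    (strInChart q : TwistorSpace g → E →L[ℝ] E) = fun w =>
      F.frChart q w.base ∘L (F.matrix w ∘L F.frChartInv q w.base) := by
  funext w
  ext v
  change toChart E q w.base (strAt w (ofChart E q w.base v)) =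
    toChart E q w.base (F.fr w.base (F.frInv w.base (strAt w (F.fr w.base
      (F.frInv w.base (ofChart E q w.base v))))))
  rw [F.fr_frInv, F.fr_frInv]

/-- The vertical part of a tangent vector, read in a frame. -/
theorem frInv_vert_fr (F : OrthoFrame g) {z : TwistorSpace g} (hz : z.base ∈ F.dom)
    (hK : MDifferentiableAt 𝓘(ℝ, TwModel E) 𝓘(ℝ, Std (halfDim E) →L[ℝ] Std (halfDim E))
      F.matrix z) (ξ : TwModel E) :
    F.frInv z.base ∘L vert z ξ ∘L F.fr z.base =
      mder (TwModel E) (Std (halfDim E) →L[ℝ] Std (halfDim E)) F.matrix z ξ +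
        (F.conn z.base (dBase z ξ) ∘L F.matrix z - F.matrix z ∘L F.conn z.base (dBase z ξ)) := by
  have hb := mdifferentiableAt_base z
  have hq := mem_chart_source E z.base
  have hA := F.mdifferentiableAt_frChart hz hq
  have hB := F.mdifferentiableAt_frChartInv hz hq
  have hAb : MDifferentiableAt 𝓘(ℝ, TwModel E) 𝓘(ℝ, Std (halfDim E) →L[ℝ] E)
    (fun w : TwistorSpace g => F.frChart z.base w.base) z := hA.comp z hb
  have hBb : MDifferentiableAt 𝓘(ℝ, TwModel E) 𝓘(ℝ, E →L[ℝ] Std (halfDim E))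
    (fun w : TwistorSpace g => F.frChartInv z.base w.base) z := hB.comp z hb
  have hAd := mder_comp (f' := F.frChart z.base) hA hb
  have hBd := mder_comp (f' := F.frChartInv z.base) hB hb
  obtain ⟨hKB, hKBd⟩ := mder_clm_comp hK hBb
  obtain ⟨-, hd⟩ := mder_clm_comp hAb hKB
  obtain ⟨-, hBA⟩ := mder_clm_comp hB hA
  -- The derivative of the inverse frame, `d(A⁻¹) A = -A⁻¹ dA`, from differentiating `A⁻¹ A = 1`.
  have hinv : ∀ v, mder E (E →L[ℝ] Std (halfDim E)) (F.frChartInv z.base) z.base (dBase z ξ)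
      (F.fr z.base v) = -F.frInv z.base (mder E (Std (halfDim E) →L[ℝ] E) (F.frChart z.base)
        z.base (dBase z ξ) v) := by
    intro v
    have h1 : (fun x => F.frChartInv z.base x ∘L F.frChart z.base x) =ᶠ[𝓝 z.base]
        fun _ => ContinuousLinearMap.id ℝ _ := by
      filter_upwards [(chartAt E z.base).open_source.mem_nhds hq] with x hx
        using F.frChartInv_frChart hx
    have h2 := hBA (dBase z ξ)
    rw [mder_congr h1, mder_const_fun, F.frChart_self, F.frChartInv_self] at h2
    have h3 := DFunLike.congr_fun h2 v
    simp only [zero_apply, add_apply, ContinuousLinearMap.comp_apply] at h3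
    exact eq_neg_of_add_eq_zero_right h3.symm
  have hs : ∀ v, strAt z v = F.fr z.base (F.matrix z (F.frInv z.base v)) := by
    intro v
    change _ = F.fr z.base (F.frInv z.base (strAt z (F.fr z.base (F.frInv z.base v))))
    rw [F.fr_frInv, F.fr_frInv]
  -- With `A` the frame and `K` the matrix, the tautological field is `A K A⁻¹`. Conjugating its
  -- derivative back by `A` gives `dK + [A⁻¹ dA, K]`, and the Christoffel terms complete `A⁻¹ dA` to
  -- `conn = A⁻¹ dA + A⁻¹ Γ A`.
  ext1 v
  rw [vert_apply, F.strInChart_eq z.base, hd ξ, hKBd ξ, hAd, hBd]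
  simp only [ContinuousLinearMap.comp_apply, add_apply, sub_apply, F.frChart_self,
    F.frChartInv_self, map_add, map_sub, F.frInv_fr, hs, F.conn_apply]
  have hdb : mder (TwModel E) E (TwistorSpace.base (g := g)) z = dBase z := rfl
  simp only [hdb, hinv, map_neg]
  abel

end TwistorCharts

/-! ### The trace form -/

section TraceForm

variable {V : Type*} [NormedAddCommGroup V] [NormedSpace ℝ V] [FiniteDimensional ℝ V]

/-- The bilinear form `c Trace (A B)` on endomorphisms. -/
def trForm (V : Type*) [NormedAddCommGroup V] [NormedSpace ℝ V] [FiniteDimensional ℝ V] (c : ℝ) :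
    (V →L[ℝ] V) →L[ℝ] (V →L[ℝ] V) →L[ℝ] ℝ :=
  c • (ContinuousLinearMap.compL ℝ (V →L[ℝ] V) (V →L[ℝ] V) ℝ (LinearMap.toContinuousLinearMap
    (LinearMap.trace ℝ V ∘ₗ ContinuousLinearMap.coeLM ℝ)) ∘L ContinuousLinearMap.compL ℝ V V V)

theorem trForm_apply (c : ℝ) (A B : V →L[ℝ] V) :
    trForm V c A B = c * LinearMap.trace ℝ V (A ∘L B).toLinearMap := rfl

theorem trForm_symm (c : ℝ) (A B : V →L[ℝ] V) : trForm V c A B = trForm V c B A := by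
  rw [trForm_apply, trForm_apply]
  congr 1
  exact LinearMap.trace_mul_comm ℝ A.toLinearMap B.toLinearMap

/-- The inner factor `i ∘ j` disappears from the product, and cyclicity of the trace removes the
outer one; a one-sided inverse is enough. -/
theorem trForm_conj {U : Type*} [NormedAddCommGroup U] [NormedSpace ℝ U] [FiniteDimensional ℝ U]
    (c : ℝ) (A B : V →L[ℝ] V) (i : U →L[ℝ] V) (j : V →L[ℝ] U) (hij : ∀ v, i (j v) = v) :
    trForm U c (j ∘L A ∘L i) (j ∘L B ∘L i) = trForm V c A B := by
  rw [trForm_apply, trForm_apply]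
  congr 1
  have h1 : ((j ∘L A ∘L i) ∘L (j ∘L B ∘L i)).toLinearMap =
      j.toLinearMap ∘ₗ ((A ∘L B).toLinearMap ∘ₗ i.toLinearMap) := by
    ext v; simp [hij]
  have h2 : ((A ∘L B).toLinearMap ∘ₗ i.toLinearMap) ∘ₗ j.toLinearMap = (A ∘L B).toLinearMap := by
    ext v; simp [hij]
  rw [h1, LinearMap.trace_comp_comm', h2]

variable {U : Type*} [NormedAddCommGroup U] [InnerProductSpace ℝ U] [FiniteDimensional ℝ U]

/-- In an orthonormal basis the diagonal entries of `A²` are `⟪b, A (A b)⟫ = -‖A b‖²`. Hence a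
negative multiple of the trace form is positive definite on skew maps. -/
theorem trace_comp_self_of_skew {A : U →L[ℝ] U} (hA : ∀ u v, ⟪A u, v⟫ = -⟪u, A v⟫) :
    LinearMap.trace ℝ U (A ∘L A).toLinearMap =
      -∑ i, ‖A (stdOrthonormalBasis ℝ U i)‖ ^ 2 := by
  rw [LinearMap.trace_eq_sum_inner _ (stdOrthonormalBasis ℝ U), ← Finset.sum_neg_distrib]
  refine Finset.sum_congr rfl fun i _ => ?_
  rw [← real_inner_self_eq_norm_sq, hA, neg_neg]
  rfl

theorem trForm_self_nonneg {c : ℝ} (hc : c ≤ 0) {A : U →L[ℝ] U}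
    (hA : ∀ u v, ⟪A u, v⟫ = -⟪u, A v⟫) : 0 ≤ trForm U c A A := by
  rw [trForm_apply, trace_comp_self_of_skew hA]
  have : 0 ≤ ∑ i, ‖A (stdOrthonormalBasis ℝ U i)‖ ^ 2 := Finset.sum_nonneg fun i _ => by positivity
  nlinarith

theorem eq_zero_of_trForm_self {c : ℝ} (hc : c < 0) {A : U →L[ℝ] U}
    (hA : ∀ u v, ⟪A u, v⟫ = -⟪u, A v⟫) (h : trForm U c A A = 0) : A = 0 := by
  rw [trForm_apply, trace_comp_self_of_skew hA, mul_eq_zero, or_iff_right hc.ne, neg_eq_zero,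
    Finset.sum_eq_zero_iff_of_nonneg fun i _ => by positivity] at h
  refine ContinuousLinearMap.coe_injective
    ((stdOrthonormalBasis ℝ U).toBasis.ext fun i => ?_)
  have := h i (Finset.mem_univ i)
  simpa using this

end TraceForm

/-! ### The metric of the twistor space -/

section TwistorMetric

variable {E : Type*} [NormedAddCommGroup E] [NormedSpace ℝ E] [FiniteDimensional ℝ E]
  {N : Type*} [TopologicalSpace N] [ChartedSpace E N] [IsManifold 𝓘(ℝ, E) ∞ N]
  {g : RMetric E N}

theorem mder_clm_left {M G G' : Type*} [TopologicalSpace M] [ChartedSpace E M]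
    [NormedAddCommGroup G] [NormedSpace ℝ G] [NormedAddCommGroup G'] [NormedSpace ℝ G']
    (L : G →L[ℝ] G') {f : M → G} {x : M} (hf : MDifferentiableAt 𝓘(ℝ, E) 𝓘(ℝ, G) f x) :
    mder E G' (fun x => L (f x)) x = L ∘L mder E G f x := by
  rw [mder_comp (f' := L) (mdifferentiableAt_iff_differentiableAt.2 L.differentiableAt) hf,
    mder_eq_fderiv, L.fderiv]

/-- The factor of the trace form in the metric of the twistor space. -/
def trFactor (E : Type*) [NormedAddCommGroup E] [NormedSpace ℝ E] (t : ℝ) : ℝ :=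
  t * (-(1 / (Module.finrank ℝ E : ℝ)))

/-- The metric of the twistor space as a field of bilinear forms on the model space. -/
def twForm (t : ℝ) (z : TwistorSpace g) : TwModel E →L[ℝ] TwModel E →L[ℝ] ℝ :=
  (metricAt g z.base).bilinearComp (dBase z) (dBase z) +
    (trForm E (trFactor E t)).bilinearComp (vert z) (vert z)

theorem twForm_apply (t : ℝ) (z : TwistorSpace g) (ξ η : TwModel E) : twForm t z ξ η =
    metricAt g z.base (dBase z ξ) (dBase z η) + trForm E (trFactor E t) (vert z ξ) (vert z η) :=
  rfl

theorem twForm_eq_twistorForm (t : ℝ) (z : TwistorSpace g) (ξ η : TwModel E) :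
    twForm t z ξ η = twistorForm t z ξ η := by
  rw [twForm_apply, trForm_apply, trFactor, mul_assoc, ← verticalPart_eq_vert,
    ← verticalPart_eq_vert]
  rfl

theorem twForm_symm (t : ℝ) (z : TwistorSpace g) (ξ η : TwModel E) :
    twForm t z ξ η = twForm t z η ξ := by
  rw [twForm_apply, twForm_apply, metricAt_symm, trForm_symm]

/-- The vertical part of tangent vectors, read in a frame. -/
def OrthoFrame.vertFr (F : OrthoFrame g) (z : TwistorSpace g) :
    TwModel E →L[ℝ] Std (halfDim E) →L[ℝ] Std (halfDim E) :=
  mder (TwModel E) (Std (halfDim E) →L[ℝ] Std (halfDim E)) F.matrix z +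
    ((ContinuousLinearMap.compL ℝ _ _ _).flip (F.matrix z) -
      ContinuousLinearMap.compL ℝ _ _ _ (F.matrix z)) ∘L F.conn z.base ∘L dBase z

theorem OrthoFrame.vertFr_apply (F : OrthoFrame g) (z : TwistorSpace g) (ξ : TwModel E) :
    F.vertFr z ξ = mder (TwModel E) (Std (halfDim E) →L[ℝ] Std (halfDim E)) F.matrix z ξ +
        (F.conn z.base (dBase z ξ) ∘L F.matrix z - F.matrix z ∘L F.conn z.base (dBase z ξ)) :=
  rfl

/-- The trace form is invariant under conjugation by the frame. This moves the vertical part from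
the varying space of endomorphisms of `T_p N` to a fixed space of matrices with a constant bilinear
form, where it can be differentiated. -/
theorem twForm_eq_vertFr (t : ℝ) {z₀ z : TwistorSpace g}
    (hz : z ∈ (chartAt (TwModel E) z₀).source) (ξ η : TwModel E) :
    twForm t z ξ η = metricAt g z.base (dBase z ξ) (dBase z η) +
      trForm (Std (halfDim E)) (trFactor E t) ((frameAt z₀).vertFr z ξ)
        ((frameAt z₀).vertFr z η) := by
  rw [twForm_apply, OrthoFrame.vertFr_apply, OrthoFrame.vertFr_apply,
    ← frInv_vert_fr _ hz.1 (mdifferentiableAt_matrix hz),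
    ← frInv_vert_fr _ hz.1 (mdifferentiableAt_matrix hz),
    trForm_conj _ _ _ _ _ ((frameAt z₀).fr_frInv z.base)]

theorem OrthoFrame.matrix_skew (F : OrthoFrame g) {z : TwistorSpace g} (hz : z.base ∈ F.dom)
    (u v : Std (halfDim E)) : ⟪F.matrix z u, v⟫ = -⟪u, F.matrix z v⟫ :=
  (F.isOrthoCplx_read z hz).skew u v

/-- Orthogonal complex structures are skew, so the derivative of the matrix stays in the linear
space of skew maps; the other term is a commutator of two skew maps. -/
theorem vertFr_skew {z₀ z : TwistorSpace g} (hz : z ∈ (chartAt (TwModel E) z₀).source)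
    (ξ : TwModel E) (u v : Std (halfDim E)) :
    ⟪(frameAt z₀).vertFr z ξ u, v⟫ = -⟪u, (frameAt z₀).vertFr z ξ v⟫ := by
  set F := frameAt z₀
  have hd := mdifferentiableAt_matrix hz
  -- The functional `A ↦ ⟪A u, v⟫ + ⟪u, A v⟫` vanishes on the matrices of all nearby points, hence
  -- also on their derivative.
  let L : (Std (halfDim E) →L[ℝ] Std (halfDim E)) →L[ℝ] ℝ :=
    innerSL ℝ v ∘L ContinuousLinearMap.apply ℝ _ u + innerSL ℝ u ∘L ContinuousLinearMap.apply ℝ _ v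
  have hL : ∀ A, L A = ⟪A u, v⟫ + ⟪u, A v⟫ := fun A => by
    simp [L, real_inner_comm]
  have h1 : (fun w => L (F.matrix w)) =ᶠ[𝓝 z] fun _ => 0 := by
    filter_upwards [(chartAt (TwModel E) z₀).open_source.mem_nhds hz] with w hw
    rw [hL, F.matrix_skew hw.1]
    ring
  have h2 := mder_clm_left L hd
  rw [mder_congr h1, mder_const_fun] at h2
  have h3 := DFunLike.congr_fun h2 ξ
  rw [zero_apply, ContinuousLinearMap.comp_apply, hL] at h3
  rw [OrthoFrame.vertFr_apply]
  simp only [add_apply, sub_apply, ContinuousLinearMap.comp_apply, inner_add_left, inner_sub_left,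
    inner_add_right, inner_sub_right]
  have h4 := F.matrix_skew hz.1 (F.conn z.base (dBase z ξ) u) v
  have h5 := F.conn_skew hz.1 (dBase z ξ) (F.matrix z u) v
  have h6 := F.matrix_skew hz.1 u (F.conn z.base (dBase z ξ) v)
  have h7 := F.conn_skew hz.1 (dBase z ξ) u (F.matrix z v)
  linarith

theorem contDiffAt_cayleyInv {m : ℕ} {K : Std m →L[ℝ] Std m} (hK : IsUnit (1 - stdJ m * K)) :
    ContDiffAt ℝ ∞ (cayleyInv (m := m)) K := by
  have h1 : ContDiffAt ℝ ∞ (fun K : Std m →L[ℝ] Std m => 1 - stdJ m * K) K :=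
    contDiffAt_const.sub (contDiffAt_const.mul contDiffAt_id)
  have h2 : ContDiffAt ℝ ∞ (fun K : Std m →L[ℝ] Std m => -(stdJ m * K) - 1) K :=
    (contDiffAt_const.mul contDiffAt_id).neg.sub contDiffAt_const
  have h3 : ContDiffAt ℝ ∞ (Ring.inverse : (Std m →L[ℝ] Std m) → Std m →L[ℝ] Std m) (1 - stdJ m * K) := by
    obtain ⟨u, hu⟩ := hK
    rw [← hu]
    exact contDiffAt_ringInverse ℝ u
  have h4 := ContDiffAt.comp K h3 h1
  exact h2.mul h4

/-- The chart at `z` factors through the base point and the matrix, so its derivative kills `ξ`; but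
that derivative at its own centre is the identity. -/
theorem eq_zero_of_mder_eq_zero {z : TwistorSpace g} {ξ : TwModel E} (h1 : dBase z ξ = 0)
    (h2 : mder (TwModel E) (Std (halfDim E) →L[ℝ] Std (halfDim E)) (frameAt z).matrix z ξ = 0) :
    ξ = 0 := by
  have hz := mem_chart_source (TwModel E) z
  have hd := mdifferentiableAt_matrix hz
  have hb := mdifferentiableAt_base z
  have hc : MDifferentiableAt 𝓘(ℝ, TwModel E) 𝓘(ℝ, TwModel E) (chartAt (TwModel E) z) z :=
    mdifferentiableAt_chartAt hz
  have h3 : mder (TwModel E) (TwModel E) (chartAt (TwModel E) z) z ξ = ξ := by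
    rw [← toChart_eq_mder hz, toChart_self]
  rw [← h3]
  refine Prod.ext ?_ ?_
  · have h4 := mder_clm_left (ContinuousLinearMap.fst ℝ E (FModel (halfDim E))) hc
    have h5 := mder_comp (f' := chartAt E (frameAt z).center)
      (mdifferentiableAt_chartAt ((frameAt z).dom_subset hz.1)) hb
    have h6 := DFunLike.congr_fun (h4.symm.trans h5) ξ
    refine h6.trans ?_
    change mder E E (chartAt E (frameAt z).center) z.base (dBase z ξ) = 0
    rw [h1, map_zero]
  · have h4 := mder_clm_left (ContinuousLinearMap.snd ℝ E (FModel (halfDim E))) hc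
    have hci : MDifferentiableAt 𝓘(ℝ, Std (halfDim E) →L[ℝ] Std (halfDim E))
        𝓘(ℝ, FModel (halfDim E)) (fun K => projF (halfDim E) (cayleyInv K))
        ((frameAt z).matrix z) :=
      mdifferentiableAt_iff_differentiableAt.2 ((projF (halfDim E)).differentiableAt.comp _
        ((contDiffAt_cayleyInv hz.2).differentiableAt (by simp)))
    have h5 := mder_comp hci hd
    have h6 := DFunLike.congr_fun (h4.symm.trans h5) ξ
    refine h6.trans ?_
    rw [ContinuousLinearMap.comp_apply, h2, map_zero]
    rfl

/-- Both summands are nonnegative. If the horizontal one vanishes then `dBase z ξ = 0`, the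
connection terms disappear from the vertical part, and the latter is just the derivative of the
matrix. -/
theorem twForm_pos {t : ℝ} (ht : 0 < t) (z : TwistorSpace g) (ξ : TwModel E) (hξ : ξ ≠ 0) :
    0 < twForm t z ξ ξ := by
  have hz := mem_chart_source (TwModel E) z
  have hc : trFactor E t ≤ 0 := by
    rw [trFactor, mul_neg, neg_nonpos]
    positivity
  have hsk := vertFr_skew hz ξ
  rw [twForm_eq_vertFr t hz]
  have hA := trForm_self_nonneg hc hsk
  by_cases hb : dBase z ξ = 0
  · rw [hb]
    simp only [map_zero, zero_add]
    refine lt_of_le_of_ne hA fun h0 => hξ ?_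
    have hv : (frameAt z).vertFr z ξ = 0 := by
      -- In dimension `0` the factor `1 / n` is `0` by convention and the trace form is not
      -- definite, but then there are no nonzero matrices either.
      by_cases hn : Module.finrank ℝ E = 0
      · ext1 v
        have hm : halfDim E = 0 := by simp [halfDim, hn]
        have : Subsingleton (Std (halfDim E)) := by
          rw [← Module.finrank_zero_iff (R := ℝ), finrank_std, hm]
        exact Subsingleton.elim _ _
      · refine eq_zero_of_trForm_self ?_ hsk h0.symm
        rw [trFactor, mul_neg, neg_lt_zero]
        have : (0 : ℝ) < Module.finrank ℝ E := by exact_mod_cast Nat.pos_of_ne_zero hn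
        positivity
    refine eq_zero_of_mder_eq_zero hb ?_
    rw [OrthoFrame.vertFr_apply, hb] at hv
    simpa using hv
  · have := metricAt_pos g z.base hb
    linarith

end TwistorMetric

/-! ### The metric of the twistor space in its charts -/

section TwistorMetricInChart

variable {E : Type*} [NormedAddCommGroup E] [NormedSpace ℝ E] [FiniteDimensional ℝ E]
  {N : Type*} [TopologicalSpace N] [ChartedSpace E N] [IsManifold 𝓘(ℝ, E) ∞ N]
  {g : RMetric E N}

theorem contDiffOn_clm_left {G G' G'' : Type*} [NormedAddCommGroup G] [NormedSpace ℝ G]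
    [NormedAddCommGroup G'] [NormedSpace ℝ G'] [NormedAddCommGroup G''] [NormedSpace ℝ G'']
    (L : G' →L[ℝ] G'') {f : G → G'} {s : Set G} (hf : ContDiffOn ℝ ∞ f s) :
    ContDiffOn ℝ ∞ (fun y => L (f y)) s :=
  L.contDiff.comp_contDiffOn hf

/-- The part of the target of the chart at `z₀` that lies over the chart of `N` at `p`. -/
def overChart (z₀ : TwistorSpace g) (p : N) : Set (TwModel E) :=
  (chartAt (TwModel E) z₀).target ∩ (chartAt (TwModel E) z₀).symm ⁻¹'
    (TwistorSpace.base ⁻¹' (chartAt E p).source)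

/-- The projection to `N` in the charts at `z₀` and `p`. -/
def baseInChart (z₀ : TwistorSpace g) (p : N) (y : TwModel E) : E :=
  chartAt E p ((chartAt (TwModel E) z₀).symm y).base

/-- The tautological complex structure in the frame and the chart at `z₀`. -/
def matrixInChart (z₀ : TwistorSpace g) (y : TwModel E) : Std (halfDim E) →L[ℝ] Std (halfDim E) :=
  (frameAt z₀).matrix ((chartAt (TwModel E) z₀).symm y)

/-- The connection matrix of the frame at `z₀`, in the charts at `z₀` and `p`. -/
def connInChart (z₀ : TwistorSpace g) (p : N) (y : TwModel E) :
    E →L[ℝ] Std (halfDim E) →L[ℝ] Std (halfDim E) :=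
  (frameAt z₀).conn ((chartAt (TwModel E) z₀).symm y).base ∘L
    ofChart E p ((chartAt (TwModel E) z₀).symm y).base

/-- The vertical part of tangent vectors in the frame at `z₀` and in the charts at `z₀`
and `p`. -/
def vertInChart (z₀ : TwistorSpace g) (p : N) (y : TwModel E) :
    TwModel E →L[ℝ] Std (halfDim E) →L[ℝ] Std (halfDim E) :=
  fderiv ℝ (matrixInChart z₀) y +
    ((ContinuousLinearMap.compL ℝ _ _ _).flip (matrixInChart z₀ y) -
      ContinuousLinearMap.compL ℝ _ _ _ (matrixInChart z₀ y)) ∘L connInChart z₀ p y ∘L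
        fderiv ℝ (baseInChart z₀ p) y

theorem isOpen_overChart (z₀ : TwistorSpace g) (p : N) : IsOpen (overChart z₀ p) :=
  (chartAt (TwModel E) z₀).isOpen_inter_preimage_symm
    ((chartAt E p).open_source.preimage contMDiff_base.continuous)

theorem contMDiffOn_base_symm (z₀ : TwistorSpace g) :
    ContMDiffOn 𝓘(ℝ, TwModel E) 𝓘(ℝ, E) ∞
      (fun y => ((chartAt (TwModel E) z₀).symm y).base) (chartAt (TwModel E) z₀).target :=
  contMDiff_base.comp_contMDiffOn
    (contMDiffOn_chart_symm (I := 𝓘(ℝ, TwModel E)) (n := ∞) (x := z₀))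

theorem contDiffOn_baseInChart (z₀ : TwistorSpace g) (p : N) :
    ContDiffOn ℝ ∞ (baseInChart z₀ p) (overChart z₀ p) := by
  rw [← contMDiffOn_iff_contDiffOn]
  exact (contMDiffOn_chart (I := 𝓘(ℝ, E)) (n := ∞) (x := p)).comp
    ((contMDiffOn_base_symm z₀).mono Set.inter_subset_left) fun y hy => hy.2

theorem contDiffOn_matrixInChart (z₀ : TwistorSpace g) :
    ContDiffOn ℝ ∞ (matrixInChart z₀) (chartAt (TwModel E) z₀).target := by
  rw [← contMDiffOn_iff_contDiffOn]
  exact (contMDiffOn_matrix z₀).comp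
    (contMDiffOn_chart_symm (I := 𝓘(ℝ, TwModel E)) (n := ∞) (x := z₀))
    fun y hy => (chartAt (TwModel E) z₀).map_target hy

theorem contDiffOn_connInChart (z₀ : TwistorSpace g) (p : N) :
    ContDiffOn ℝ ∞ (connInChart z₀ p) (overChart z₀ p) := by
  rw [← contMDiffOn_iff_contDiffOn]
  exact ((frameAt z₀).contMDiffOn_conn_ofChart p).comp
    ((contMDiffOn_base_symm z₀).mono Set.inter_subset_left)
    fun y hy => ⟨base_mem_dom ((chartAt (TwModel E) z₀).map_target hy.1), hy.2⟩

theorem contDiffOn_vertInChart (z₀ : TwistorSpace g) (p : N) :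
    ContDiffOn ℝ ∞ (vertInChart z₀ p) (overChart z₀ p) := by
  have hK : ContDiffOn ℝ ∞ (matrixInChart z₀) (overChart z₀ p) :=
    (contDiffOn_matrixInChart z₀).mono Set.inter_subset_left
  have hK' : ContDiffOn ℝ ∞ (fderiv ℝ (matrixInChart z₀)) (overChart z₀ p) :=
    hK.fderiv_of_isOpen (isOpen_overChart z₀ p) (by simp)
  have hπ' : ContDiffOn ℝ ∞ (fderiv ℝ (baseInChart z₀ p)) (overChart z₀ p) :=
    (contDiffOn_baseInChart z₀ p).fderiv_of_isOpen (isOpen_overChart z₀ p) (by simp)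
  have h1 := contDiffOn_clm_left (G'' := (Std (halfDim E) →L[ℝ] Std (halfDim E)) →L[ℝ]
    Std (halfDim E) →L[ℝ] Std (halfDim E)) (ContinuousLinearMap.compL ℝ (Std (halfDim E)) (Std (halfDim E))
    (Std (halfDim E))).flip hK
  have h2 := contDiffOn_clm_left (G'' := (Std (halfDim E) →L[ℝ] Std (halfDim E)) →L[ℝ]
    Std (halfDim E) →L[ℝ] Std (halfDim E)) (ContinuousLinearMap.compL ℝ (Std (halfDim E)) (Std (halfDim E))
    (Std (halfDim E))) hK
  exact hK'.add ((h1.sub h2).clm_comp ((contDiffOn_connInChart z₀ p).clm_comp hπ'))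

theorem toChart_dBase_ofChart {z₀ : TwistorSpace g} {p : N} {y : TwModel E}
    (hy : y ∈ overChart z₀ p) (w : TwModel E) :
    toChart E p ((chartAt (TwModel E) z₀).symm y).base (dBase ((chartAt (TwModel E) z₀).symm y)
      (ofChart (TwModel E) z₀ ((chartAt (TwModel E) z₀).symm y) w)) =
      fderiv ℝ (baseInChart z₀ p) y w := by
  have h := toChart_mder_ofChart (f := TwistorSpace.base (g := g)) (p := z₀) (p' := p)
    ((chartAt (TwModel E) z₀).map_target hy.1) hy.2 (mdifferentiableAt_base _)
  rw [(chartAt (TwModel E) z₀).right_inv hy.1] at h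
  exact DFunLike.congr_fun h w

/-- The coordinate changes of `N` hidden in `connInChart` and `baseInChart` cancel, so `vertInChart`
does not depend on the auxiliary chart at `p` where it is used. -/
theorem vertFr_ofChart {z₀ : TwistorSpace g} {p : N} {y : TwModel E}
    (hy : y ∈ overChart z₀ p) (w : TwModel E) :
    (frameAt z₀).vertFr ((chartAt (TwModel E) z₀).symm y)
      (ofChart (TwModel E) z₀ ((chartAt (TwModel E) z₀).symm y) w) = vertInChart z₀ p y w := by
  have hz := (chartAt (TwModel E) z₀).map_target hy.1
  have h := mder_ofChart hz (mdifferentiableAt_matrix hz)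
  rw [(chartAt (TwModel E) z₀).right_inv hy.1, mder_eq_fderiv] at h
  have h1 := DFunLike.congr_fun h w
  have h2 : connInChart z₀ p y (fderiv ℝ (baseInChart z₀ p) y w) =
      (frameAt z₀).conn ((chartAt (TwModel E) z₀).symm y).base
        (dBase ((chartAt (TwModel E) z₀).symm y)
          (ofChart (TwModel E) z₀ ((chartAt (TwModel E) z₀).symm y) w)) := by
    rw [← toChart_dBase_ofChart hy, connInChart, ContinuousLinearMap.comp_apply,
      ofChart_toChart hy.2]
  rw [OrthoFrame.vertFr_apply, ← h2]
  exact congrArg₂ (· + ·) h1 rfl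

/-- The local shape `π^* g + B(φ, φ)` of the metric. The point `p` is left free: smoothness on a
whole chart domain calls for the centre of the frame, while the second fundamental form at `p` calls
for the chart at `p` itself. The existence statement for frames does not say that the two agree. -/
theorem formInChart_twForm (t : ℝ) {z₀ : TwistorSpace g} {p : N} {y : TwModel E}
    (hy : y ∈ overChart z₀ p) (w w' : TwModel E) :
    formInChart (twForm t) z₀ y w w' =
      metricInChart g p (baseInChart z₀ p y) (fderiv ℝ (baseInChart z₀ p) y w)
        (fderiv ℝ (baseInChart z₀ p) y w') +
      trForm (Std (halfDim E)) (trFactor E t) (vertInChart z₀ p y w) (vertInChart z₀ p y w') := by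
  rw [formInChart_apply, twForm_eq_vertFr t ((chartAt (TwModel E) z₀).map_target hy.1),
    vertFr_ofChart hy, vertFr_ofChart hy, ← toChart_dBase_ofChart hy, ← toChart_dBase_ofChart hy,
    baseInChart, metricInChart_toChart g hy.2]

theorem overChart_center (z₀ : TwistorSpace g) :
    overChart z₀ (frameAt z₀).center = (chartAt (TwModel E) z₀).target :=
  Set.inter_eq_left.2 fun _ hy =>
    (frameAt z₀).dom_subset (base_mem_dom ((chartAt (TwModel E) z₀).map_target hy))

/-- With `p` the centre of the frame the entire target of the twistor chart lies over one chart of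
`N`, so the local formula is available everywhere and all its ingredients are smooth. -/
theorem contDiffOn_formInChart_twForm (t : ℝ) (z₀ : TwistorSpace g) :
    ContDiffOn ℝ ∞ (formInChart (twForm t) z₀) (chartAt (TwModel E) z₀).target := by
  rw [← overChart_center z₀]
  set p := (frameAt z₀).center
  have hπ' : ContDiffOn ℝ ∞ (fderiv ℝ (baseInChart z₀ p)) (overChart z₀ p) :=
    (contDiffOn_baseInChart z₀ p).fderiv_of_isOpen (isOpen_overChart z₀ p) (by simp)
  have hg : ContDiffOn ℝ ∞ (fun y => metricInChart g p (baseInChart z₀ p y)) (overChart z₀ p) :=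
    (contDiffOn_metricInChart g p).comp (contDiffOn_baseInChart z₀ p)
      fun y hy => (chartAt E p).map_source hy.2
  have hφ := contDiffOn_vertInChart z₀ p
  refine contDiffOn_clm_apply.2 fun w => contDiffOn_clm_apply.2 fun w' => ?_
  refine ContDiffOn.congr ?_ fun y hy => formInChart_twForm t hy w w'
  have hφw := fun w : TwModel E => hφ.clm_apply (contDiffOn_const (c := w))
  have hπw := fun w : TwModel E => hπ'.clm_apply (contDiffOn_const (c := w))
  exact ((hg.clm_apply (hπw w)).clm_apply (hπw w')).add
    ((contDiffOn_clm_left (trForm (Std (halfDim E)) (trFactor E t)) (hφw w)).clm_apply (hφw w'))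

/-- The metric of the twistor space. -/
def twistorMetric (g : RMetric E N) {t : ℝ} (ht : 0 < t) :
    RMetric (TwModel E) (TwistorSpace g) where
  inner z := twForm t z
  symm z ξ η := twForm_symm t z ξ η
  pos z ξ hξ := twForm_pos ht z ξ hξ
  isVonNBounded z := by
    have h : Bornology.IsVonNBounded ℝ {ξ : TwModel E | twForm t z ξ ξ < 1} :=
      isVonNBounded_of_pos (twForm_pos ht z)
    exact h
  contMDiff := by
    have h := (contMDiff_form_iff (E := TwModel E) (M := TwistorSpace g) (twForm t)).2
      (contDiffOn_formInChart_twForm t)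
    exact h

end TwistorMetricInChart

/-! ### Sections of a submersion are immersions -/

section Immersion

variable {E : Type*} [NormedAddCommGroup E] [NormedSpace ℝ E]
  {M : Type*} [TopologicalSpace M] [ChartedSpace E M] [IsManifold 𝓘(ℝ, E) ∞ M]
  {G : Type*} [NormedAddCommGroup G] [NormedSpace ℝ G]
  {Z : Type*} [TopologicalSpace Z] [ChartedSpace (E × G) Z] [IsManifold 𝓘(ℝ, E × G) ∞ Z]

/-- The map `(x, y) ↦ (x, y - q x)`. -/
def shear (q : E → G) {V : Set E} (hV : IsOpen V) (hq : ContinuousOn q V) :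
    OpenPartialHomeomorph (E × G) (E × G) where
  toFun w := (w.1, w.2 - q w.1)
  invFun w := (w.1, w.2 + q w.1)
  source := V ×ˢ Set.univ
  target := V ×ˢ Set.univ
  map_source' _ hw := ⟨hw.1, trivial⟩
  map_target' _ hw := ⟨hw.1, trivial⟩
  left_inv' _ _ := Prod.ext rfl (sub_add_cancel _ _)
  right_inv' _ _ := Prod.ext rfl (add_sub_cancel_right _ _)
  open_source := hV.prod isOpen_univ
  open_target := hV.prod isOpen_univ
  continuousOn_toFun := continuousOn_fst.prodMk
    (continuousOn_snd.sub (hq.comp continuousOn_fst fun _ hw => hw.1))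
  continuousOn_invFun := continuousOn_fst.prodMk
    (continuousOn_snd.add (hq.comp continuousOn_fst fun _ hw => hw.1))

/-- A map that is the graph of a function in suitable charts is an immersion. -/
theorem isImmersionAt_of_graph {f : M → Z} (hf : ContMDiff 𝓘(ℝ, E) 𝓘(ℝ, E × G) ∞ f) {x p : M}
    {z : Z} (hx : x ∈ (chartAt E p).source) (hz : f x ∈ (chartAt (E × G) z).source)
    (h : ∀ x ∈ (chartAt E p).source, f x ∈ (chartAt (E × G) z).source →
      (chartAt (E × G) z (f x)).1 = chartAt E p x) :
    Manifold.IsImmersionAtOfComplement G 𝓘(ℝ, E) 𝓘(ℝ, E × G) ∞ f x := by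
  set c := chartAt E p with hc
  set c' := chartAt (E × G) z with hc'
  have hU : IsOpen (f ⁻¹' c'.source) := c'.open_source.preimage hf.continuous
  set V : Set E := c.target ∩ c.symm ⁻¹' (f ⁻¹' c'.source) with hVdef
  have hV : IsOpen V := c.isOpen_inter_preimage_symm hU
  have hcs : ContMDiffOn 𝓘(ℝ, E) 𝓘(ℝ, E) ∞ c c.source :=
    contMDiffOn_chart (I := 𝓘(ℝ, E)) (n := ∞) (x := p)
  have hcs' : ContMDiffOn 𝓘(ℝ, E) 𝓘(ℝ, E) ∞ c.symm c.target :=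
    contMDiffOn_chart_symm (I := 𝓘(ℝ, E)) (n := ∞) (x := p)
  have hc's : ContMDiffOn 𝓘(ℝ, E × G) 𝓘(ℝ, E × G) ∞ c' c'.source :=
    contMDiffOn_chart (I := 𝓘(ℝ, E × G)) (n := ∞) (x := z)
  have hc's' : ContMDiffOn 𝓘(ℝ, E × G) 𝓘(ℝ, E × G) ∞ c'.symm c'.target :=
    contMDiffOn_chart_symm (I := 𝓘(ℝ, E × G)) (n := ∞) (x := z)
  let q : E → G := fun y => (c' (f (c.symm y))).2
  have hq : ContDiffOn ℝ ∞ q V := by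
    rw [← contMDiffOn_iff_contDiffOn]
    exact (contDiff_snd (n := ∞)).contMDiff.comp_contMDiffOn
      (hc's.comp (hf.comp_contMDiffOn (hcs'.mono Set.inter_subset_left)) fun y hy => hy.2)
  let S := shear q hV hq.continuousOn
  have hS : ContMDiffOn 𝓘(ℝ, E × G) 𝓘(ℝ, E × G) ∞ S S.source := by
    rw [contMDiffOn_iff_contDiffOn]
    exact contDiffOn_fst.prodMk
      (contDiffOn_snd.sub (hq.comp contDiffOn_fst fun _ hw => hw.1))
  have hS' : ContMDiffOn 𝓘(ℝ, E × G) 𝓘(ℝ, E × G) ∞ S.symm S.target := by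
    rw [contMDiffOn_iff_contDiffOn]
    exact contDiffOn_fst.prodMk
      (contDiffOn_snd.add (hq.comp contDiffOn_fst fun _ hw => hw.1))
  have hmem : ∀ x ∈ c.source, f x ∈ c'.source → c x ∈ V := fun x h1 h2 =>
    ⟨c.map_source h1, by rw [Set.mem_preimage, c.left_inv h1]; exact h2⟩
  -- In the charts `c` and `c'` the map is `y ↦ (y, q y)`; following `c'` by the shear straightens
  -- it to `y ↦ (y, 0)`, the normal form of an immersion.
  refine Manifold.IsImmersionAtOfComplement.mk_of_continuousAt hf.continuous.continuousAt
    (ContinuousLinearEquiv.refl ℝ (E × G)) (c.restrOpen _ hU) (c'.trans S) ⟨hx, hz⟩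
    ⟨hz, ?_, trivial⟩ ?_ ?_ ?_
  · change (c' (f x)).1 ∈ V
    rw [h x hx hz]
    exact hmem x hx hz
  · refine OpenPartialHomeomorph.mem_maximalAtlas_of_contMDiffOn _ ?_ ?_
    · exact hcs.mono Set.inter_subset_left
    · exact hcs'.mono Set.inter_subset_left
  · refine OpenPartialHomeomorph.mem_maximalAtlas_of_contMDiffOn _ ?_ ?_
    · exact hS.comp (hc's.mono Set.inter_subset_left) fun y hy => hy.2
    · exact hc's'.comp (hS'.mono Set.inter_subset_left) fun y hy => hy.2
  · intro y hy
    have hy' : y ∈ c.target ∧ f (c.symm y) ∈ c'.source := by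
      simpa [OpenPartialHomeomorph.extend, OpenPartialHomeomorph.restrOpen] using hy
    have h1 := h (c.symm y) (c.map_target hy'.1) hy'.2
    rw [c.right_inv hy'.1] at h1
    change ((c' (f (c.symm y))).1, (c' (f (c.symm y))).2 - q (c' (f (c.symm y))).1) = (y, 0)
    rw [h1, sub_self]

end Immersion

/-! ### The section of the twistor space given by a Kähler structure -/

section KaehlerSection

variable {E : Type*} [NormedAddCommGroup E] [NormedSpace ℝ E] [FiniteDimensional ℝ E]
  {N : Type*} [TopologicalSpace N] [ChartedSpace E N] [IsManifold 𝓘(ℝ, E) ∞ N]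
  {g : RMetric E N} {J : ∀ x : N, Tan E x →L[ℝ] Tan E x}

theorem IsAlmostHermitian.contMDiffOn_matrix_toTwistor (hJ : IsAlmostHermitian g J)
    (F : OrthoFrame g) :
    ContMDiffOn 𝓘(ℝ, E) 𝓘(ℝ, Std (halfDim E) →L[ℝ] Std (halfDim E)) ∞
      (fun x => F.matrix (hJ.toTwistor x)) F.dom := by
  refine contMDiffOn_end fun u v => ?_
  have h1 : ContMDiffOn 𝓘(ℝ, E) (𝓘(ℝ, E).prod 𝓘(ℝ, E)) ∞
      (fun x => (⟨x, J x (F.frame x u)⟩ : TangentBundle 𝓘(ℝ, E) N)) F.dom :=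
    ContMDiffOn.clm_bundle_apply (F₁ := E) (F₂ := E) hJ.smooth.contMDiffOn (F.smooth u)
  refine (contMDiffOn_inner g h1 (F.smooth v)).congr fun x hx => ?_
  exact F.inner_frInv hx _ v

/-- The chart domain is cut out by an open condition on the base point and by invertibility of `1 -
J₀ K`, which is open in the continuous matrix `K`. Continuity of the section is not available here;
its proof relies on this fact. -/
theorem IsAlmostHermitian.eventually_mem_source (hJ : IsAlmostHermitian g J) (p : N) :
    ∀ᶠ x in 𝓝 p, hJ.toTwistor x ∈ (chartAt (TwModel E) (hJ.toTwistor p)).source := by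
  have hp := mem_chart_source (TwModel E) (hJ.toTwistor p)
  set F := frameAt (hJ.toTwistor p)
  have hd : ∀ᶠ x in 𝓝 p, x ∈ F.dom := F.isOpen_dom.mem_nhds hp.1
  have hK := (hJ.contMDiffOn_matrix_toTwistor F).continuousOn.continuousAt
    (F.isOpen_dom.mem_nhds hp.1)
  have hK' : ContinuousAt (fun x => 1 - stdJ (halfDim E) * F.matrix (hJ.toTwistor x)) p :=
    continuousAt_const.sub (continuousAt_const.mul hK)
  filter_upwards [hd, hK'.eventually (Units.isOpen.mem_nhds hp.2)] with x h1 h2 using ⟨h1, h2⟩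

theorem IsAlmostHermitian.contMDiff_toTwistor (hJ : IsAlmostHermitian g J) :
    ContMDiff 𝓘(ℝ, E) 𝓘(ℝ, TwModel E) ∞ hJ.toTwistor := by
  intro p
  have hp := mem_chart_source (TwModel E) (hJ.toTwistor p)
  set F := frameAt (hJ.toTwistor p)
  have hK : ContMDiffAt 𝓘(ℝ, E) 𝓘(ℝ, Std (halfDim E) →L[ℝ] Std (halfDim E)) ∞
      (fun x => F.matrix (hJ.toTwistor x)) p :=
    (hJ.contMDiffOn_matrix_toTwistor F).contMDiffAt (F.isOpen_dom.mem_nhds hp.1)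
  have h1 : ContMDiffAt 𝓘(ℝ, E) 𝓘(ℝ, FModel (halfDim E)) ∞
      (fun x => projF (halfDim E) (cayleyInv (F.matrix (hJ.toTwistor x)))) p := by
    have h2 : ContDiffAt ℝ ∞ (fun K => projF (halfDim E) (cayleyInv K))
        (F.matrix (hJ.toTwistor p)) :=
      (projF (halfDim E)).contDiff.contDiffAt.comp _ (contDiffAt_cayleyInv hp.2)
    exact ContMDiffAt.comp p (g := fun K => projF (halfDim E) (cayleyInv K)) h2.contMDiffAt hK
  have h3 : ContMDiffAt 𝓘(ℝ, E) 𝓘(ℝ, E) ∞ (chartAt E F.center) p :=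
    (contMDiffOn_chart (I := 𝓘(ℝ, E)) (n := ∞)).contMDiffAt
      ((chartAt E F.center).open_source.mem_nhds (F.dom_subset hp.1))
  have h4 : ContMDiffAt 𝓘(ℝ, E) 𝓘(ℝ, TwModel E) ∞
      (fun x => chartAt (TwModel E) (hJ.toTwistor p) (hJ.toTwistor x)) p := h3.prodMk_space h1
  have h5 : ContMDiffAt 𝓘(ℝ, TwModel E) 𝓘(ℝ, TwModel E) ∞
      (chartAt (TwModel E) (hJ.toTwistor p)).symm
      (chartAt (TwModel E) (hJ.toTwistor p) (hJ.toTwistor p)) :=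
    (contMDiffOn_chart_symm (I := 𝓘(ℝ, TwModel E)) (n := ∞)).contMDiffAt
      ((chartAt (TwModel E) (hJ.toTwistor p)).open_target.mem_nhds (mem_chart_target _ _))
  refine (h5.comp p h4).congr_of_eventuallyEq ?_
  filter_upwards [hJ.eventually_mem_source p] with x hx
  exact ((chartAt (TwModel E) (hJ.toTwistor p)).left_inv hx).symm

/-- The projection is a continuous left inverse, which gives the topological embedding, and twistor
charts present a section as a graph, which gives the immersion. -/
theorem IsAlmostHermitian.isSmoothEmbedding_toTwistor (hJ : IsAlmostHermitian g J) :
    Manifold.IsSmoothEmbedding 𝓘(ℝ, E) 𝓘(ℝ, TwModel E) ∞ hJ.toTwistor := by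
  refine ⟨?_, ?_⟩
  · have h : Manifold.IsImmersionOfComplement (FModel (halfDim E)) 𝓘(ℝ, E) 𝓘(ℝ, TwModel E) ∞
        hJ.toTwistor := fun x => by
      have hx := mem_chart_source (TwModel E) (hJ.toTwistor x)
      -- The chart of `N` to use is the one at the centre of the frame: the first component of the
      -- twistor chart is by definition that chart applied to the base point.
      exact isImmersionAt_of_graph hJ.contMDiff_toTwistor
        ((frameAt (hJ.toTwistor x)).dom_subset hx.1) hx fun _ _ _ => rfl
    exact h.isImmersion
  · exact Function.LeftInverse.isEmbedding (f := TwistorSpace.base) (fun x => rfl)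
      contMDiff_base.continuous hJ.contMDiff_toTwistor.continuous

theorem IsAlmostHermitian.mdifferentiableAt_toTwistor (hJ : IsAlmostHermitian g J) (p : N) :
    MDifferentiableAt 𝓘(ℝ, E) 𝓘(ℝ, TwModel E) hJ.toTwistor p :=
  (hJ.contMDiff_toTwistor p).mdifferentiableAt (by simp)

theorem IsAlmostHermitian.dBase_mder_toTwistor (hJ : IsAlmostHermitian g J) (p : N) (u : E) :
    dBase (hJ.toTwistor p) (mder E (TwModel E) hJ.toTwistor p u) = u := by
  have h := mder_comp (mdifferentiableAt_base (hJ.toTwistor p)) (hJ.mdifferentiableAt_toTwistor p)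
  have h2 : mder E E (fun x => (hJ.toTwistor x).base) p = ContinuousLinearMap.id ℝ E :=
    mfderiv_id
  exact DFunLike.congr_fun (h.symm.trans h2) u

theorem mdifferentiableAt_strInChart (z : TwistorSpace g) :
    MDifferentiableAt 𝓘(ℝ, TwModel E) 𝓘(ℝ, E →L[ℝ] E) (strInChart z.base) z := by
  set F := frameAt z
  have hz := mem_chart_source (TwModel E) z
  have hq := mem_chart_source E z.base
  have hb := mdifferentiableAt_base z
  have hA : MDifferentiableAt 𝓘(ℝ, TwModel E) 𝓘(ℝ, Std (halfDim E) →L[ℝ] E)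
    (fun w : TwistorSpace g => F.frChart z.base w.base) z :=
    (F.mdifferentiableAt_frChart hz.1 hq).comp z hb
  have hB : MDifferentiableAt 𝓘(ℝ, TwModel E) 𝓘(ℝ, E →L[ℝ] Std (halfDim E))
    (fun w : TwistorSpace g => F.frChartInv z.base w.base) z :=
    (F.mdifferentiableAt_frChartInv hz.1 hq).comp z hb
  rw [F.strInChart_eq]
  exact (mder_clm_comp hA (mder_clm_comp (mdifferentiableAt_matrix hz) hB).1).1

/-- By the chain rule the derivative of the tautological structure along the section is the
derivative of `J` in the chart, so the vertical part of `J_* u` is `∇_u J`. -/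
theorem IsKaehler.vert_mder_toTwistor (hJ : IsKaehler g J) (p : N) (u : E) :
    vert (hJ.toTwistor p) (mder E (TwModel E) hJ.toTwistor p u) = 0 := by
  have h := mder_comp (mdifferentiableAt_strInChart (hJ.toTwistor p))
    (hJ.mdifferentiableAt_toTwistor p)
  have h2 := DFunLike.congr_fun h u
  rw [vert_apply, hJ.dBase_mder_toTwistor, ← add_sub_assoc]
  refine Eq.trans ?_ (hJ.parallel p u)
  exact congrArg₂ (· - ·) (congrArg₂ (· + ·) h2.symm rfl) rfl

end KaehlerSection

/-! ### The second fundamental form in charts -/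

section SecondFundamentalForm

variable {E : Type*} [NormedAddCommGroup E] [NormedSpace ℝ E]
  {M : Type*} [TopologicalSpace M] [ChartedSpace E M] [IsManifold 𝓘(ℝ, E) ∞ M]
  {E' : Type*} [NormedAddCommGroup E'] [NormedSpace ℝ E']
  {M' : Type*} [TopologicalSpace M'] [ChartedSpace E' M'] [IsManifold 𝓘(ℝ, E') ∞ M']

/-- A map in the charts at `p` and at its image. -/
def inCharts (E E' : Type*) [NormedAddCommGroup E] [NormedSpace ℝ E] [NormedAddCommGroup E']
    [NormedSpace ℝ E'] {M M' : Type*} [TopologicalSpace M] [ChartedSpace E M]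
    [TopologicalSpace M'] [ChartedSpace E' M'] (f : M → M') (p : M) (y : E) : E' :=
  chartAt E' (f p) (f ((chartAt E p).symm y))

theorem contDiffAt_inCharts {f : M → M'} (hf : ContMDiff 𝓘(ℝ, E) 𝓘(ℝ, E') ∞ f) (p : M) :
    ContDiffAt ℝ ∞ (inCharts E E' f p) (chartAt E p p) := by
  rw [← contMDiffAt_iff_contDiffAt]
  have h1 := contMDiffAt_comp_chart_symm (mem_chart_source E p) (hf p)
  refine ContMDiffAt.comp (I' := 𝓘(ℝ, E')) (chartAt E p p) (g := chartAt E' (f p)) ?_ h1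
  rw [(chartAt E p).left_inv (mem_chart_source E p)]
  exact (contMDiffOn_chart (I := 𝓘(ℝ, E')) (n := ∞)).contMDiffAt
    ((chartAt E' (f p)).open_source.mem_nhds (mem_chart_source E' (f p)))

theorem inCharts_self (f : M → M') (p : M) :
    inCharts E E' f p (chartAt E p p) = chartAt E' (f p) (f p) := by
  rw [inCharts, (chartAt E p).left_inv (mem_chart_source E p)]

theorem fderiv_inCharts {f : M → M'} {p x : M} (hx : x ∈ (chartAt E p).source)
    (hfx : f x ∈ (chartAt E' (f p)).source)
    (hf : MDifferentiableAt 𝓘(ℝ, E) 𝓘(ℝ, E') f x) (u : E) :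
    fderiv ℝ (inCharts E E' f p) (chartAt E p x) u =
      toChart E' (f p) (f x) (mder E E' f x (ofChart E p x u)) :=
  (DFunLike.congr_fun (toChart_mder_ofChart hx hfx hf) u).symm

theorem fderiv_inCharts_self {f : M → M'} {p : M}
    (hf : MDifferentiableAt 𝓘(ℝ, E) 𝓘(ℝ, E') f p) (u : E) :
    fderiv ℝ (inCharts E E' f p) (chartAt E p p) u = mder E E' f p u := by
  rw [fderiv_inCharts (mem_chart_source E p) (mem_chart_source E' (f p)) hf, toChart_self,
    ofChart_self]

/-- In charts `f_* Y` is `DF(Y)`, whose derivative is `D²F(X, Y) + DF(∂_X Y)`. The last term also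
occurs in `f_*(∇_X Y)` and cancels, leaving an expression in the value `Y p` alone. -/
theorem secondFundamentalForm_eq (g : RMetric E M) (g' : RMetric E' M') {f : M → M'}
    (hf : ContMDiff 𝓘(ℝ, E) 𝓘(ℝ, E') ∞ f) (p : M) (X : E) (Y : M → E)
    (hY : SmoothFieldAt (M := M) Y p) :
    secondFundamentalForm g g' f p X Y =
      (fderiv ℝ (fderiv ℝ (inCharts E E' f p)) (chartAt E p p) X (Y p) +
        christoffel g' (f p) (fderiv ℝ (inCharts E E' f p) (chartAt E p p) X)
          (fderiv ℝ (inCharts E E' f p) (chartAt E p p) (Y p)) -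
        fderiv ℝ (inCharts E E' f p) (chartAt E p p) (christoffel g p X (Y p)) : E') := by
  have hps := mem_chart_source E p
  have hfd : ∀ x, MDifferentiableAt 𝓘(ℝ, E) 𝓘(ℝ, E') f x := fun x =>
    (hf x).mdifferentiableAt (by simp)
  have hYd : MDifferentiableAt 𝓘(ℝ, E) 𝓘(ℝ, E) (fun x => toChart E p x (Y x)) p :=
    ((contMDiffAt_toChart hps).1 hY).mdifferentiableAt (by simp)
  have hid : mder E E (id : M → M) p = ContinuousLinearMap.id ℝ E := mfderiv_id
  have h1 : secondFundamentalForm g g' f p X Y =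
      (mder E E' (fun x => toChart E' (f p) (f x) (mder E E' f x (Y x))) p X +
        christoffel g' (f p) (mder E E' f p X) (mder E E' f p (Y p)) -
        mder E E' f p (mder E E (fun x => toChart E p x (Y x)) p X +
          christoffel g p (mder E E (id : M → M) p X) (Y p)) : E') := rfl
  have hF2 : DifferentiableAt ℝ (fderiv ℝ (inCharts E E' f p)) (chartAt E p p) :=
    ((contDiffAt_inCharts hf p).fderiv_right (m := 1) (by norm_num; exact ENat.LEInfty.out)).differentiableAt (by simp)
  have hYc := differentiableAt_comp_chart_symm hps hYd
  have h2 := hF2.hasFDerivAt.clm_apply hYc.hasFDerivAt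
  have h3 : (fun x => toChart E' (f p) (f x) (mder E E' f x (Y x))) =ᶠ[𝓝 p]
      fun x => (fun y => fderiv ℝ (inCharts E E' f p) y
        (toChart E p ((chartAt E p).symm y) (Y ((chartAt E p).symm y)))) (chartAt E p x) := by
    filter_upwards [(chartAt E p).open_source.mem_nhds hps, hf.continuous.continuousAt.eventually
      ((chartAt E' (f p)).open_source.mem_nhds (mem_chart_source E' (f p)))] with x hx hfx
    simp only [(chartAt E p).left_inv hx]
    rw [fderiv_inCharts hx hfx (hfd x), ofChart_toChart hx]
  have h4 : mder E E' (fun x => toChart E' (f p) (f x) (mder E E' f x (Y x))) p X =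
      fderiv ℝ (inCharts E E' f p) (chartAt E p p) (mder E E (fun x => toChart E p x (Y x)) p X) +
        fderiv ℝ (fderiv ℝ (inCharts E E' f p)) (chartAt E p p) X (Y p) := by
    rw [mder_congr h3, mder_comp (mdifferentiableAt_iff_differentiableAt.2 h2.differentiableAt)
      (mdifferentiableAt_chartAt hps), mder_eq_fderiv, h2.fderiv, ← toChart_eq_mder hps,
      mder_eq_fderiv_chart hYd]
    simp only [ContinuousLinearMap.comp_apply, add_apply, ContinuousLinearMap.flip_apply,
      (chartAt E p).left_inv hps, toChart_self]
  rw [h1, h4, hid, ContinuousLinearMap.id_apply]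
  simp only [fderiv_inCharts_self (hfd p), map_add]
  abel

end SecondFundamentalForm

/-! ### The section given by a Kähler structure is isometric and totally geodesic. -/

section TotallyGeodesic

variable {E : Type*} [NormedAddCommGroup E] [NormedSpace ℝ E] [FiniteDimensional ℝ E]
  {N : Type*} [TopologicalSpace N] [ChartedSpace E N] [IsManifold 𝓘(ℝ, E) ∞ N]
  {g : RMetric E N} {J : ∀ x : N, Tan E x →L[ℝ] Tan E x}

theorem metricInChart_twistorMetric {t : ℝ} (ht : 0 < t) (z : TwistorSpace g) :
    metricInChart (twistorMetric g ht) z = formInChart (twForm t) z := rfl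

/-- Horizontality at all points `x` near `p`, in the single chart and frame attached to `J_p`, as
needed to differentiate it. At each `x` the frame expression is a conjugate of the intrinsic
vertical part, which vanishes. -/
theorem IsKaehler.vertInChart_toTwistor (hJ : IsKaehler g J) (p : N) :
    ∀ᶠ y in 𝓝 (chartAt E p p), ∀ u, vertInChart (hJ.toTwistor p) p
      (inCharts E (TwModel E) hJ.toTwistor p y)
      (fderiv ℝ (inCharts E (TwModel E) hJ.toTwistor p) y u) = 0 := by
  have hps := mem_chart_source E p
  have hs : Filter.Tendsto (chartAt E p).symm (𝓝 (chartAt E p p)) (𝓝 p) := by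
    have := (chartAt E p).symm.continuousAt (mem_chart_target E p)
    rwa [ContinuousAt, (chartAt E p).left_inv hps] at this
  filter_upwards [(chartAt E p).open_target.mem_nhds (mem_chart_target E p),
    hs.eventually (hJ.eventually_mem_source p)] with y hy hz u
  set x := (chartAt E p).symm y with hx
  have hxs : x ∈ (chartAt E p).source := (chartAt E p).map_target hy
  have hyx : chartAt E p x = y := (chartAt E p).right_inv hy
  have hinv := (chartAt (TwModel E) (hJ.toTwistor p)).left_inv hz
  have hyc : inCharts E (TwModel E) hJ.toTwistor p y ∈ overChart (hJ.toTwistor p) p := by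
    refine ⟨(chartAt (TwModel E) (hJ.toTwistor p)).map_source hz, ?_⟩
    change ((chartAt (TwModel E) (hJ.toTwistor p)).symm
      (chartAt (TwModel E) (hJ.toTwistor p) (hJ.toTwistor x))).base ∈ (chartAt E p).source
    rw [hinv]
    exact hxs
  have hinv' : (chartAt (TwModel E) (hJ.toTwistor p)).symm
      (inCharts E (TwModel E) hJ.toTwistor p y) = hJ.toTwistor x := hinv
  rw [← vertFr_ofChart hyc, hinv', ← hyx,
    fderiv_inCharts hxs hz (hJ.mdifferentiableAt_toTwistor x), ofChart_toChart hz,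
    OrthoFrame.vertFr_apply, ← frInv_vert_fr _ hz.1 (mdifferentiableAt_matrix hz),
    hJ.vert_mder_toTwistor]
  simp

theorem IsKaehler.isTotallyGeodesic_toTwistor (hJ : IsKaehler g J) {t : ℝ} (ht : 0 < t) :
    IsTotallyGeodesic g (twistorMetric g ht) hJ.toTwistor := by
  intro p X Y hY
  have hps := mem_chart_source E p
  have hf := hJ.contMDiff_toTwistor
  have hfc := contDiffAt_inCharts hf p
  have hsrc := mem_chart_source (TwModel E) (hJ.toTwistor p)
  have hself := inCharts_self (E := E) (E' := TwModel E) hJ.toTwistor p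
  have hover : inCharts E (TwModel E) hJ.toTwistor p (chartAt E p p) ∈
      overChart (hJ.toTwistor p) p := by
    rw [hself]
    refine ⟨mem_chart_target _ _, ?_⟩
    change ((chartAt (TwModel E) (hJ.toTwistor p)).symm
      (chartAt (TwModel E) (hJ.toTwistor p) (hJ.toTwistor p))).base ∈ (chartAt E p).source
    rw [(chartAt (TwModel E) (hJ.toTwistor p)).left_inv hsrc]
    exact hps
  have hnhds := (isOpen_overChart (hJ.toTwistor p) p).mem_nhds hover
  have hπ := (contDiffOn_baseInChart (hJ.toTwistor p) p).contDiffAt hnhds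
  have hφ := (contDiffOn_vertInChart (hJ.toTwistor p) p).contDiffAt hnhds
  have hh := contDiffAt_metricInChart (twistorMetric g ht) (hJ.toTwistor p)
  have hs : Filter.Tendsto (chartAt E p).symm (𝓝 (chartAt E p p)) (𝓝 p) := by
    have := (chartAt E p).symm.continuousAt (mem_chart_target E p)
    rwa [ContinuousAt, (chartAt E p).left_inv hps] at this
  rw [← hself] at hh
  have key := totallyGeodesic_of_horizontal (f := inCharts E (TwModel E) hJ.toTwistor p)
    (π := baseInChart (hJ.toTwistor p) p) (gm := metricInChart g p)
    (hm := metricInChart (twistorMetric g ht) (hJ.toTwistor p))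
    (φ := vertInChart (hJ.toTwistor p) p) (B := trForm (Std (halfDim E)) (trFactor E t))
    (x₀ := chartAt E p p) (hfc.of_le ENat.LEInfty.out) (hπ.of_le ENat.LEInfty.out)
    ((contDiffAt_metricInChart g p).differentiableAt (by simp)) (metricInChart_symm g p _)
    (hφ.differentiableAt (by simp)) ?_ ?_ (hh.differentiableAt (by simp))
    (hJ.vertInChart_toTwistor p) (Γg := fun u v => christoffel g p u v)
    (inner_christoffel g p)
    (Γh := fun u v => christoffel (twistorMetric g ht) (hJ.toTwistor p) u v) ?_ X (Y p)
  · refine (secondFundamentalForm_eq g (twistorMetric g ht) hf p X Y hY).trans ?_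
    -- `key` states that the second fundamental form is orthogonal to every `w`; taking `w` to be
    -- its own value contradicts positivity unless that value is zero.
    by_contra hne
    have h1 := metricAt_pos (twistorMetric g ht) (hJ.toTwistor p) hne
    rw [← metricInChart_self, ← hself, key] at h1
    exact lt_irrefl _ h1
  · filter_upwards [(chartAt E p).open_target.mem_nhds (mem_chart_target E p),
      hs.eventually (hJ.eventually_mem_source p)] with y hy hz
    change chartAt E p ((chartAt (TwModel E) (hJ.toTwistor p)).symm
      (chartAt (TwModel E) (hJ.toTwistor p) (hJ.toTwistor ((chartAt E p).symm y)))).base = y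
    rw [(chartAt (TwModel E) (hJ.toTwistor p)).left_inv hz]
    exact (chartAt E p).right_inv hy
  · filter_upwards [hnhds] with y hy w w'
    rw [metricInChart_twistorMetric]
    exact formInChart_twForm t hy w w'
  · rw [hself]
    exact inner_christoffel (twistorMetric g ht) (hJ.toTwistor p)

theorem IsKaehler.twForm_mder_toTwistor (hJ : IsKaehler g J) (t : ℝ) (p : N) (u v : E) :
    twForm t (hJ.toTwistor p) (mder E (TwModel E) hJ.toTwistor p u)
      (mder E (TwModel E) hJ.toTwistor p v) = metricAt g p u v := by
  rw [twForm_apply, hJ.vert_mder_toTwistor, hJ.vert_mder_toTwistor, hJ.dBase_mder_toTwistor,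
    hJ.dBase_mder_toTwistor, map_zero, add_zero]
  rfl

theorem IsKaehler.isIsometricEmbedding_toTwistor (hJ : IsKaehler g J) {t : ℝ} (ht : 0 < t) :
    IsIsometricEmbedding g (twistorMetric g ht) hJ.toTwistor where
  isSmoothEmbedding := hJ.isSmoothEmbedding_toTwistor
  isometric p u v := hJ.twForm_mder_toTwistor t p u v

end TotallyGeodesic

end Twistor

end

/-- The only data of an `RMetric` is its inner product, so the first condition determines `h` and
the existential speaks of the metric `h_t` itself; it includes the assertion that `twistorForm` is a
smooth metric. -/
theorem corollary1 {E : Type*} [NormedAddCommGroup E] [NormedSpace ℝ E] [FiniteDimensional ℝ E]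
    {N : Type*} [TopologicalSpace N] [ChartedSpace E N] [IsManifold 𝓘(ℝ, E) ∞ N]
    (g : Twistor.RMetric E N)
    (J : ∀ x : N, Twistor.Tan E x →L[ℝ] Twistor.Tan E x)
    (hJ : Twistor.IsKaehler g J)
    (t : ℝ) (ht : 0 < t) :
    ∃ h : Twistor.RMetric (E × Twistor.FModel (Twistor.halfDim E)) (Twistor.TwistorSpace g),
      (∀ (z : Twistor.TwistorSpace g) (ξ η : Twistor.TanTw z),
        h.inner z ξ η = Twistor.twistorForm t z ξ η) ∧
      Twistor.IsIsometricEmbedding g h hJ.toTwistor ∧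
      Twistor.IsTotallyGeodesic g h hJ.toTwistor :=
  ⟨Twistor.twistorMetric g ht, fun z ξ η => Twistor.twForm_eq_twistorForm t z ξ η,
    hJ.isIsometricEmbedding_toTwistor ht, hJ.isTotallyGeodesic_toTwistor ht⟩
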